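/- **Notation.** Let $d\in\mathbb N$ and let $m\in[2,\infty)$. Let $\kappa_{m,d}$ be the best constant of the discrete Burkholder–Davis–Gundy inequality: the least $\kappa\ge 0$ such that for every probability space, every filtration $(\mathcal G_n)_{n\ge 1}$ and all $\mathbb R^d$-valued $X_n\in L_m$, with $X_n$ $\mathcal G_n$-measurable for $n\ge1$ and $\mathbb E[X_n\mid\mathcal G_{n-1}]=0$ for $n\ge 2$, one has $$\Big\|\sum_{n=1}^N X_n\Big\|_{L_m}\le \kappa\,\Big\|\sum_{n=1}^N |X_n|^2\Big\|_{L_{m/2}}^{1/2}\quad\text{for all } N .$$ We write $A\lesssim_{a,b,\dots}B$ if $A\le c\,B$ with a constant $c\ge0$ that depends only on $a,b,\dots$. For a partition $\pi$ of an interval, $|\pi|$ denotes the maximal length of its subintervals. Put $\delta A_{s,u,t}=A_{s,t}-A_{s,u}-A_{u,t}$. **Statement.** Let $T\ge 0$, let $(\mathcal F_t)_{t\in[0,T]}$ be a filtration on a probability space $(\Omega,\mathcal A_\Omega,\mathbb P)$, and let $(A_{s,t})_{0\le s\le t\le T}$ be $\mathbb R^d$-valued random variables such that $A_{s,s}=0$,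 $A_{s,t}$ is $\mathcal F_t$-measurable and $A_{s,t}\in L_m(\mathbb P)$. Let $$\Gamma_1,\Gamma_2,\Gamma_3,M,\alpha,\beta_1,\beta_2,\beta_3,\gamma_1,\gamma_2\in[0,\infty)$$ satisfy $$\beta_1>1,\quad \beta_2>\tfrac12,\quad \beta_1-\alpha>\tfrac12,\quad \gamma_1,\gamma_2<\tfrac12,\quad \beta_3>0,$$ and suppose that for all $0\le t_0<t_1<t_2<t_3\le T$ $$\|\mathbb E[\delta A_{t_1,t_2,t_3}\mid\mathcal F_{t_0}]\|_{L_m}\le \Gamma_1\, t_1^{-\gamma_1}(t_1-t_0)^{-\alpha}(t_3-t_1)^{\beta_1}\quad\text{if } M(t_3-t_1)\le t_1-t_0,$$ and that for all $0\le t_0<t_1<t_2\le T$ $$\|\delta A_{t_0,t_1,t_2}\|_{L_m}\le \Gamma_2\, t_0^{-\gamma_2}(t_2-t_0)^{\beta_2}\quad\text{if } t_0>0,\qquad \|\delta A_{t_0,t_1,t_2}\|_{L_m}\le \Gamma_3\,(t_2-t_0)^{\beta_3}.$$ Then there exists a unique, up to modifications, $\mathbb R^d$-valued process $(\mathcal A_t)_{t\in[0,T]}$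 with the following properties: * $\mathcal A_0=0$ almost surely, $\mathcal A_t$ is $\mathcal F_t$-measurable and $\mathcal A_t\in L_m(\mathbb P)$ for every $t\in[0,T]$; * there are constants $C_1,\dots,C_6\ge0$ such that $$\|\mathbb E[\mathcal A_{t_2}-\mathcal A_{t_1}-A_{t_1,t_2}\mid\mathcal F_{t_0}]\|_{L_m}\le C_1\,t_1^{-\gamma_1}(t_1-t_0)^{-\alpha}(t_2-t_1)^{\beta_1}$$ for all $0\le t_0<t_1<t_2\le T$ with $M(t_2-t_1)\le t_1-t_0$, $$\|\mathcal A_{t_2}-\mathcal A_{t_1}-A_{t_1,t_2}\|_{L_m}\le C_2\,t_1^{-\gamma_1}(t_2-t_1)^{\beta_1-\alpha}+C_3\,t_1^{-\gamma_2}(t_2-t_1)^{\beta_2}$$ for all $0<t_1<t_2\le T$, and $$\|\mathcal A_{t_2}-\mathcal A_{t_1}-A_{t_1,t_2}\|_{L_m}\le C_4\,(t_2-t_1)^{\beta_1-\alpha-\gamma_1}+C_5\,(t_2-t_1)^{\beta_2-\gamma_2}+C_6\,(t_2-t_1)^{\beta_3}$$ for all $0\le t_1<t_2\le T$. Moreover,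 $C_1,\dots,C_6$ can be chosen such that $$C_1\lesssim_{\beta_1}\Gamma_1,\quad C_2\lesssim_{\alpha,\beta_1,\beta_2,M}\kappa_{m,d}\Gamma_1,\quad C_3\lesssim_{\alpha,\beta_1,\beta_2,M}\kappa_{m,d}\Gamma_2,$$ $$C_4\lesssim_{\alpha,\beta_1,\gamma_1,M}\kappa_{m,d}\Gamma_1,\quad C_5\lesssim_{\beta_2,\gamma_2,M}\kappa_{m,d}\Gamma_2,\quad C_6\lesssim_{\beta_3,M}\kappa_{m,d}\Gamma_3 .$$ Finally, for every $\tau\in[0,T]$, the sums $A^\pi_\tau=\sum_{[s,t]\in\pi}A_{s,t}$ over partitions $\pi$ of $[0,\tau]$ converge to $\mathcal A_\tau$ in $L_m(\mathbb P)$ as $|\pi|\to0$. -/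

import Mathlib

open MeasureTheory Filter Topology
open scoped NNReal ENNReal

universe u

/-- `K` is a constant for the discrete Burkholder-Davis-Gundy inequality in `L_m` for `ℝ^d`-valued
martingale differences `X 0, X 1, …` (the first one need not be centred), over all probability
spaces. It is stated for all finite partial sums, which is equivalent to the version for infinite
series. If some `X n` were not in `L_m`, the right-hand side would be infinite. -/
def IsBDGConstant (m : ℝ) (d : ℕ) (K : ℝ) : Prop :=
  0 ≤ K ∧
  ∀ (Ω : Type u) (mΩ : MeasurableSpace Ω) (P : Measure Ω) (_ : IsProbabilityMeasure P)
    (𝓖 : Filtration ℕ mΩ) (X : ℕ → Ω → EuclideanSpace ℝ (Fin d)),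
    (∀ n, StronglyMeasurable[𝓖 n] (X n)) →
    (∀ n, MemLp (X n) (ENNReal.ofReal m) P) →
    (∀ n, P[X (n + 1) | 𝓖 n] =ᵐ[P] 0) →
    ∀ N : ℕ,
      eLpNorm (fun ω => ∑ n ∈ Finset.range N, X n ω) (ENNReal.ofReal m) P ≤
        ENNReal.ofReal K *
          (eLpNorm (fun ω => ∑ n ∈ Finset.range N, ‖X n ω‖ ^ 2) (ENNReal.ofReal (m / 2)) P)
            ^ (1 / 2 : ℝ)

/-- `κ_{m,d}`: the best constant of the discrete Burkholder-Davis-Gundy inequality. -/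
noncomputable def bdgConst (m : ℝ) (d : ℕ) : ℝ :=
  sInf {K : ℝ | IsBDGConstant.{u} m d K}

theorem bdgConst_nonneg (m : ℝ) (d : ℕ) : 0 ≤ bdgConst.{u} m d :=
  Real.sInf_nonneg fun _ hK => hK.1

/-- `δA_{s,u,t} = A_{s,t} - A_{s,u} - A_{u,t}`. -/
def germDelta {Ω E : Type*} [AddCommGroup E] (A : ℝ → ℝ → Ω → E) (s u t : ℝ) : Ω → E :=
  fun ω => A s t ω - A s u ω - A u t ω

/-- A partition `a = pt 0 < pt 1 < ⋯ < pt n = b` of `[a, b]`. -/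
structure IntervalPartition (a b : ℝ) where
  n : ℕ
  pt : Fin (n + 1) → ℝ
  strictMono : StrictMono pt
  left : pt 0 = a
  right : pt (Fin.last n) = b

/-- `|π|`, the maximal length of an interval of the partition (`0` if there is none, i.e. `a = b`). -/
noncomputable def IntervalPartition.mesh {a b : ℝ} (π : IntervalPartition a b) : ℝ :=
  ⨆ i : Fin π.n, (π.pt i.succ - π.pt i.castSucc)

/-- `A^π = ∑_{[s,t] ∈ π} A_{s,t}`. -/
def riemannSum {Ω E : Type*} [AddCommGroup E] (A : ℝ → ℝ → Ω → E) {a b : ℝ}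
    (π : IntervalPartition a b) : Ω → E :=
  fun ω => ∑ i : Fin π.n, A (π.pt i.castSucc) (π.pt i.succ) ω

/-- The properties that characterize the process `𝒜` associated with the germ `A`, with given
constants `C₁, …, C₆`. Only the times in `[0, T]` matter. -/
structure IsSingularSewing {Ω : Type*} {mΩ : MeasurableSpace Ω} (P : Measure Ω)
    (𝓕 : Filtration ℝ mΩ) {d : ℕ} (T m M α β₁ β₂ β₃ γ₁ γ₂ : ℝ)
    (A : ℝ → ℝ → Ω → EuclideanSpace ℝ (Fin d)) (C₁ C₂ C₃ C₄ C₅ C₆ : ℝ)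
    (𝒜 : ℝ → Ω → EuclideanSpace ℝ (Fin d)) : Prop where
  zero : 𝒜 0 =ᵐ[P] 0
  adapted : ∀ t, 0 ≤ t → t ≤ T → StronglyMeasurable[𝓕 t] (𝒜 t)
  memLp : ∀ t, 0 ≤ t → t ≤ T → MemLp (𝒜 t) (ENNReal.ofReal m) P
  condExp_bound : ∀ t₀ t₁ t₂, 0 ≤ t₀ → t₀ < t₁ → t₁ < t₂ → t₂ ≤ T → M * (t₂ - t₁) ≤ t₁ - t₀ →
    eLpNorm (P[fun ω => 𝒜 t₂ ω - 𝒜 t₁ ω - A t₁ t₂ ω | 𝓕 t₀]) (ENNReal.ofReal m) P ≤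
      ENNReal.ofReal (C₁ * t₁ ^ (-γ₁) * (t₁ - t₀) ^ (-α) * (t₂ - t₁) ^ β₁)
  weighted_bound : ∀ t₁ t₂, 0 < t₁ → t₁ < t₂ → t₂ ≤ T →
    eLpNorm (fun ω => 𝒜 t₂ ω - 𝒜 t₁ ω - A t₁ t₂ ω) (ENNReal.ofReal m) P ≤
      ENNReal.ofReal (C₂ * t₁ ^ (-γ₁) * (t₂ - t₁) ^ (β₁ - α)
        + C₃ * t₁ ^ (-γ₂) * (t₂ - t₁) ^ β₂)
  continuity_bound : ∀ t₁ t₂, 0 ≤ t₁ → t₁ < t₂ → t₂ ≤ T →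
    eLpNorm (fun ω => 𝒜 t₂ ω - 𝒜 t₁ ω - A t₁ t₂ ω) (ENNReal.ofReal m) P ≤
      ENNReal.ofReal (C₄ * (t₂ - t₁) ^ (β₁ - α - γ₁) + C₅ * (t₂ - t₁) ^ (β₂ - γ₂)
        + C₆ * (t₂ - t₁) ^ β₃)

/-!
The process is the `L_m`-limit of the Riemann sums of `A` over the dyadic grids `H 2⁻ⁿ ℕ`. The
difference of two consecutive levels is a sum of terms `δA` over the cells of the grid. Grouped into
blocks of `O(1 + M)` cells, they have conditional expectations that decay with the time lag; pairs
of blocks are repeatedly replaced by their conditional expectations, while the errors are martingale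
differences, estimated by the Burkholder-Davis-Gundy inequality. As `γ₁, γ₂ < 1 / 2`, the squares of
the weights `t₁ ^ (-γᵢ)` are summable up to the singularity at `0`.

For a general partition and any process with the asserted bounds, the errors `𝒜 t - 𝒜 s - A s t`
are sorted by the dyadic scale of `t - s`, and each scale is estimated in the same way. This gives
the convergence of the Riemann sums, hence also uniqueness.
-/

section PathwiseBDG

lemma rpow_sub_rpow_le_mul_sub {c x y : ℝ} (hc : 1 ≤ c) (hx : 0 ≤ x) (hy : 0 ≤ y) :
    y ^ c - x ^ c ≤ c * y ^ (c - 1) * (y - x) := by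
  have hconvex := convexOn_rpow hc
  have hderiv : HasDerivAt (fun z : ℝ => z ^ c) (c * y ^ (c - 1)) y :=
    Real.hasDerivAt_rpow_const (Or.inr hc)
  rcases lt_trichotomy x y with hxy | rfl | hxy
  · have h := hconvex.slope_le_of_hasDerivAt hx hy hxy hderiv
    rwa [slope_def_field, div_le_iff₀ (sub_pos.2 hxy)] at h
  · simp
  · have h := hconvex.le_slope_of_hasDerivAt hy hx hxy hderiv
    rw [slope_def_field, le_div_iff₀ (sub_pos.2 hxy)] at h
    linarith

lemma exists_rpow_mul_rpow_le {q r ε : ℝ} (hq : 0 ≤ q) (hr : 0 < r) (hε : 0 < ε) :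
    ∃ C : ℝ, 0 ≤ C ∧ ∀ u v : ℝ, 0 ≤ u → 0 ≤ v →
      u ^ q * v ^ r ≤ ε * u ^ (q + r) + C * v ^ (q + r) := by
  have hδ : 0 < ε ^ r⁻¹ := Real.rpow_pos_of_pos hε _
  refine ⟨((ε ^ r⁻¹)⁻¹) ^ q, by positivity, fun u v hu hv => ?_⟩
  rw [Real.rpow_add_of_nonneg hu hq hr.le, Real.rpow_add_of_nonneg hv hq hr.le]
  rcases le_total v (ε ^ r⁻¹ * u) with hvu | huv
  · calc u ^ q * v ^ r ≤ u ^ q * (ε ^ r⁻¹ * u) ^ r := by gcongr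
      _ = ε * (u ^ q * u ^ r) := by
          rw [Real.mul_rpow hδ.le hu, Real.rpow_inv_rpow hε.le hr.ne']; ring
      _ ≤ _ := le_add_of_nonneg_right (by positivity)
  · calc u ^ q * v ^ r ≤ ((ε ^ r⁻¹)⁻¹ * v) ^ q * v ^ r := by
          gcongr
          rwa [inv_mul_eq_div, le_div_iff₀' hδ]
      _ = ((ε ^ r⁻¹)⁻¹) ^ q * (v ^ q * v ^ r) := by
          rw [Real.mul_rpow (by positivity) hv]; ring
      _ ≤ _ := le_add_of_nonneg_left (by positivity)

lemma rpow_sub_rpow_mul_sq_sub_sq_le {q x y : ℝ} (hq : 0 ≤ q) (hx : 0 ≤ x) (hy : 0 ≤ y) :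
    (y ^ q - x ^ q) * (y ^ 2 - x ^ 2) ≤ 2 * (q + 1) * max x y ^ q * (y - x) ^ 2 := by
  wlog hxy : x ≤ y generalizing x y
  · rw [max_comm]
    linarith [this hy hx (le_of_not_ge hxy)]
  have hpow : 0 ≤ y ^ q - x ^ q := sub_nonneg.2 (Real.rpow_le_rpow hx hxy hq)
  have htangent : y * (y ^ q - x ^ q) ≤ (q + 1) * y ^ q * (y - x) := by
    have h := rpow_sub_rpow_le_mul_sub (c := q + 1) (by linarith) hx hy
    rw [add_sub_cancel_right, Real.rpow_add_one' hy (by linarith),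
      Real.rpow_add_one' hx (by linarith)] at h
    nlinarith [Real.rpow_nonneg hx q]
  calc (y ^ q - x ^ q) * (y ^ 2 - x ^ 2)
      = (y + x) * (y ^ q - x ^ q) * (y - x) := by ring
    _ ≤ (y + y) * (y ^ q - x ^ q) * (y - x) := by gcongr
    _ = 2 * (y * (y ^ q - x ^ q)) * (y - x) := by ring
    _ ≤ 2 * ((q + 1) * y ^ q * (y - x)) * (y - x) := by gcongr
    _ = 2 * (q + 1) * max x y ^ q * (y - x) ^ 2 := by rw [max_eq_right hxy]; ring

lemma rpow_add_two_sub_rpow_le {q x y : ℝ} (hq : 0 ≤ q) (hx : 0 ≤ x) (hy : 0 ≤ y) :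
    y ^ (q + 2) - x ^ (q + 2) ≤ (q + 2) / 2 * x ^ q * (y ^ 2 - x ^ 2)
      + (q + 2) * (q + 1) * max x y ^ q * (y - x) ^ 2 := by
  have sq_rpow (z : ℝ) (hz : 0 ≤ z) (e : ℝ) : (z ^ 2) ^ (e / 2) = z ^ e := by
    rw [← Real.rpow_natCast_mul hz, Nat.cast_ofNat, mul_div_cancel₀ e two_ne_zero]
  have htangent := rpow_sub_rpow_le_mul_sub (c := (q + 2) / 2) (x := x ^ 2) (y := y ^ 2)
    (by linarith) (by positivity) (by positivity)
  rw [show (q + 2) / 2 - 1 = q / 2 by ring, sq_rpow y hy, sq_rpow x hx, sq_rpow y hy] at htangent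
  have hsecond := mul_le_mul_of_nonneg_left (rpow_sub_rpow_mul_sq_sub_sq_le hq hx hy)
    (by positivity : 0 ≤ (q + 2) / 2)
  linarith

variable {V : Type*} [NormedAddCommGroup V]

/-- The running maximum `max_{k ≤ n} ‖S k‖` of a sequence in a normed group. -/
noncomputable def runMax (S : ℕ → V) (n : ℕ) : ℝ := partialSups (fun k => ‖S k‖) n

lemma norm_le_runMax (S : ℕ → V) {k n : ℕ} (hkn : k ≤ n) : ‖S k‖ ≤ runMax S n :=
  le_partialSups_of_le (fun k => ‖S k‖) hkn

lemma runMax_nonneg (S : ℕ → V) (n : ℕ) : 0 ≤ runMax S n :=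
  (norm_nonneg _).trans (norm_le_runMax S le_rfl)

lemma runMax_zero (S : ℕ → V) : runMax S 0 = ‖S 0‖ := partialSups_zero _

lemma runMax_succ (S : ℕ → V) (n : ℕ) : runMax S (n + 1) = max (runMax S n) ‖S (n + 1)‖ :=
  partialSups_succ _ n

lemma runMax_le {S : ℕ → V} {n : ℕ} {a : ℝ} (h : ∀ k ≤ n, ‖S k‖ ≤ a) : runMax S n ≤ a :=
  partialSups_le _ n a h

/-- The pathwise form, due to Acciaio, Beiglböck, Penkner, Schachermayer and Temme, of Doob's
`L^p` maximal inequality: for a nonnegative submartingale `‖S n‖` the last sum has nonnegative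
expectation. -/
lemma runMax_rpow_le {p : ℝ} (hp : 1 < p) (S : ℕ → V) (N : ℕ) :
    (p - 1) * runMax S N ^ p ≤ p * (runMax S N ^ (p - 1) * ‖S N‖)
      - p * ∑ i ∈ Finset.range N, runMax S i ^ (p - 1) * (‖S (i + 1)‖ - ‖S i‖) := by
  have rpow_sub_one_mul {x : ℝ} (hx : 0 ≤ x) : x ^ (p - 1) * x = x ^ p := by
    rw [← Real.rpow_add_one' hx (by linarith), sub_add_cancel]
  induction N with
  | zero =>
    have : 0 ≤ ‖S 0‖ ^ p := by positivity
    simp only [runMax_zero, Finset.range_zero, Finset.sum_empty, mul_zero, sub_zero,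
      rpow_sub_one_mul (norm_nonneg (S 0))]
    linarith
  | succ n ih =>
    rw [Finset.sum_range_succ, runMax_succ]
    rcases le_total ‖S (n + 1)‖ (runMax S n) with h | h
    · rw [max_eq_left h]
      linarith
    · have htangent := rpow_sub_rpow_le_mul_sub hp.le (norm_nonneg (S (n + 1))) (runMax_nonneg S n)
      have hmax := rpow_sub_one_mul (runMax_nonneg S n)
      rw [max_eq_right h, rpow_sub_one_mul (norm_nonneg _)]
      linear_combination ih + htangent + p * hmax

variable [InnerProductSpace ℝ V]

lemma norm_rpow_sub_norm_rpow_le {p : ℝ} (hp : 2 ≤ p) (x y : V) :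
    ‖y‖ ^ p - ‖x‖ ^ p ≤ p * (‖x‖ ^ (p - 2) * inner ℝ x (y - x))
      + p ^ 2 * max ‖x‖ ‖y‖ ^ (p - 2) * ‖y - x‖ ^ 2 := by
  have htaylor := rpow_add_two_sub_rpow_le (sub_nonneg.2 hp) (norm_nonneg x) (norm_nonneg y)
  rw [sub_add_cancel, show p - 2 + 1 = p - 1 by ring] at htaylor
  have hsq : ‖y‖ ^ 2 - ‖x‖ ^ 2 = 2 * inner ℝ x (y - x) + ‖y - x‖ ^ 2 := by
    have h := norm_add_sq_real x (y - x)
    rw [add_sub_cancel] at h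
    rw [h]; ring
  rw [hsq] at htaylor
  have hdist : (‖y‖ - ‖x‖) ^ 2 ≤ ‖y - x‖ ^ 2 :=
    sq_le_sq.2 ((abs_norm_sub_norm_le y x).trans_eq (abs_norm _).symm)
  have hpow : ‖x‖ ^ (p - 2) ≤ max ‖x‖ ‖y‖ ^ (p - 2) := by
    gcongr
    exact le_max_left _ _
  calc ‖y‖ ^ p - ‖x‖ ^ p
      ≤ p / 2 * ‖x‖ ^ (p - 2) * (2 * inner ℝ x (y - x) + ‖y - x‖ ^ 2)
        + p * (p - 1) * max ‖x‖ ‖y‖ ^ (p - 2) * (‖y‖ - ‖x‖) ^ 2 := htaylor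
    _ = p * (‖x‖ ^ (p - 2) * inner ℝ x (y - x)) + (p / 2 * ‖x‖ ^ (p - 2) * ‖y - x‖ ^ 2
        + p * (p - 1) * max ‖x‖ ‖y‖ ^ (p - 2) * (‖y‖ - ‖x‖) ^ 2) := by ring
    _ ≤ p * (‖x‖ ^ (p - 2) * inner ℝ x (y - x))
        + (p / 2 * max ‖x‖ ‖y‖ ^ (p - 2) * ‖y - x‖ ^ 2
          + p * (p - 1) * max ‖x‖ ‖y‖ ^ (p - 2) * ‖y - x‖ ^ 2) := by
        have : 0 ≤ p - 1 := by linarith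
        gcongr
    _ ≤ _ := by
        have : 0 ≤ p * (max ‖x‖ ‖y‖ ^ (p - 2) * ‖y - x‖ ^ 2) := by positivity
        linarith

lemma inv_norm_mul_inner_sub_le (x y : V) : ‖x‖⁻¹ * inner ℝ x (y - x) ≤ ‖y‖ - ‖x‖ := by
  rcases eq_or_ne x 0 with rfl | hx
  · simp
  rw [inv_mul_le_iff₀ (norm_pos_iff.2 hx), inner_sub_right, real_inner_self_eq_norm_mul_norm,
    mul_sub]
  exact sub_le_sub_right (real_inner_le_norm x y) _

lemma norm_rpow_le_sum_inner {p : ℝ} (hp : 2 ≤ p) {S : ℕ → V} (hS : S 0 = 0) (N : ℕ) :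
    ‖S N‖ ^ p ≤ p * ∑ i ∈ Finset.range N, ‖S i‖ ^ (p - 2) * inner ℝ (S i) (S (i + 1) - S i)
      + p ^ 2 * (runMax S N ^ (p - 2) * ∑ i ∈ Finset.range N, ‖S (i + 1) - S i‖ ^ 2) := by
  calc ‖S N‖ ^ p = ∑ i ∈ Finset.range N, (‖S (i + 1)‖ ^ p - ‖S i‖ ^ p) := by
        rw [Finset.sum_range_sub (fun i => ‖S i‖ ^ p), hS, norm_zero,
          Real.zero_rpow (by linarith), sub_zero]
    _ ≤ ∑ i ∈ Finset.range N, (p * (‖S i‖ ^ (p - 2) * inner ℝ (S i) (S (i + 1) - S i))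
        + p ^ 2 * runMax S N ^ (p - 2) * ‖S (i + 1) - S i‖ ^ 2) := by
        refine Finset.sum_le_sum fun i hi => ?_
        have hiN := Finset.mem_range.1 hi
        refine (norm_rpow_sub_norm_rpow_le hp (S i) (S (i + 1))).trans ?_
        gcongr
        exact max_le (norm_le_runMax S hiN.le) (norm_le_runMax S hiN)
    _ = _ := by rw [Finset.sum_add_distrib, ← Finset.mul_sum, ← Finset.mul_sum, mul_assoc]

/-- The predictable integrand in the pathwise Burkholder-Davis-Gundy inequality. The first summand
comes from the Taylor expansion of `‖·‖ ^ p`, the second from the pathwise Doob inequality. -/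
noncomputable def bdgIntegrand (p a b : ℝ) (S : ℕ → V) (i : ℕ) : V :=
  (a * ‖S i‖ ^ (p - 2) - b * (runMax S i ^ (p - 1) * ‖S i‖⁻¹)) • S i

lemma norm_bdgIntegrand_le {p a b : ℝ} (hp : 2 ≤ p) (ha : 0 ≤ a) (hb : 0 ≤ b) (S : ℕ → V)
    (i : ℕ) : ‖bdgIntegrand p a b S i‖ ≤ (a + b) * runMax S i ^ (p - 1) := by
  have hmax : 0 ≤ runMax S i := runMax_nonneg S i
  have hpow : ‖S i‖ ^ (p - 2) * ‖S i‖ ≤ runMax S i ^ (p - 1) := by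
    rw [← Real.rpow_add_one' (norm_nonneg _) (by linarith), show p - 2 + 1 = p - 1 by ring]
    exact Real.rpow_le_rpow (norm_nonneg _) (norm_le_runMax S le_rfl) (by linarith)
  calc ‖bdgIntegrand p a b S i‖
      ≤ (a * ‖S i‖ ^ (p - 2) + b * (runMax S i ^ (p - 1) * ‖S i‖⁻¹)) * ‖S i‖ := by
        rw [bdgIntegrand, norm_smul]
        gcongr
        refine (norm_sub_le _ _).trans_eq ?_
        rw [Real.norm_of_nonneg (by positivity), Real.norm_of_nonneg (by positivity)]
    _ = a * (‖S i‖ ^ (p - 2) * ‖S i‖) + b * (runMax S i ^ (p - 1) * (‖S i‖⁻¹ * ‖S i‖)) := by ring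
    _ ≤ a * runMax S i ^ (p - 1) + b * (runMax S i ^ (p - 1) * 1) := by
        gcongr
        exact inv_mul_le_one
    _ = (a + b) * runMax S i ^ (p - 1) := by ring

lemma sum_inner_bdgIntegrand (p a b : ℝ) (S : ℕ → V) (N : ℕ) :
    ∑ i ∈ Finset.range N, inner ℝ (bdgIntegrand p a b S i) (S (i + 1) - S i) =
      a * ∑ i ∈ Finset.range N, ‖S i‖ ^ (p - 2) * inner ℝ (S i) (S (i + 1) - S i)
        - b * ∑ i ∈ Finset.range N,
          runMax S i ^ (p - 1) * (‖S i‖⁻¹ * inner ℝ (S i) (S (i + 1) - S i)) := by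
  rw [Finset.mul_sum, Finset.mul_sum, ← Finset.sum_sub_distrib]
  refine Finset.sum_congr rfl fun i _ => ?_
  rw [bdgIntegrand, real_inner_smul_left]
  ring

lemma exists_rpow_le_of_le_of_le {p : ℝ} (hp : 2 ≤ p) : ∃ C a b : ℝ, 0 ≤ C ∧ 0 ≤ a ∧ 0 ≤ b ∧
    ∀ R s Q D E : ℝ, 0 ≤ R → 0 ≤ s → 0 ≤ Q →
      (p - 1) * R ^ p ≤ p * (R ^ (p - 1) * s) - p * D →
      s ^ p ≤ p * E + p ^ 2 * (R ^ (p - 2) * Q) →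
      R ^ p ≤ C * Q ^ (p / 2) + (a * E - b * D) := by
  obtain ⟨C₁, hC₁, hyoung₁⟩ := exists_rpow_mul_rpow_le (q := p - 1) (r := 1) (ε := 1 / (2 * p))
    (by linarith) one_pos (by positivity)
  obtain ⟨C₂, hC₂, hyoung₂⟩ := exists_rpow_mul_rpow_le (q := p - 2) (r := 2)
    (ε := 1 / (4 * (p ^ 3 * C₁ + 1))) (by linarith) two_pos (by positivity)
  refine ⟨4 * (p ^ 3 * C₁) * C₂, 4 * p ^ 2 * C₁, 4 * p, by positivity, by positivity,
    by positivity, fun R s Q D E hR hs hQ hD hE => ?_⟩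
  have hcross : p * (R ^ (p - 1) * s) ≤ 1 / 2 * R ^ p + p * C₁ * s ^ p := by
    have h := hyoung₁ R s hR hs
    rw [Real.rpow_one, sub_add_cancel] at h
    calc p * (R ^ (p - 1) * s) ≤ p * (1 / (2 * p) * R ^ p + C₁ * s ^ p) := by gcongr
      _ = _ := by field_simp
  have hquad : p ^ 3 * C₁ * (R ^ (p - 2) * Q) ≤
      1 / 4 * R ^ p + p ^ 3 * C₁ * C₂ * Q ^ (p / 2) := by
    have h := hyoung₂ R √Q hR (Real.sqrt_nonneg _)
    rw [sub_add_cancel, Real.rpow_two, Real.sq_sqrt hQ, Real.sqrt_eq_rpow,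
      ← Real.rpow_mul hQ, show 1 / 2 * p = p / 2 by ring] at h
    calc p ^ 3 * C₁ * (R ^ (p - 2) * Q)
        ≤ p ^ 3 * C₁ * (1 / (4 * (p ^ 3 * C₁ + 1)) * R ^ p + C₂ * Q ^ (p / 2)) := by gcongr
      _ = p ^ 3 * C₁ / (p ^ 3 * C₁ + 1) * (1 / 4 * R ^ p) + p ^ 3 * C₁ * C₂ * Q ^ (p / 2) := by
          field_simp
      _ ≤ 1 * (1 / 4 * R ^ p) + p ^ 3 * C₁ * C₂ * Q ^ (p / 2) := by
          gcongr
          exact div_le_one_of_le₀ (by linarith) (by positivity)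
      _ = _ := by ring
  have hE' := mul_le_mul_of_nonneg_left hE (by positivity : 0 ≤ p * C₁)
  have hR' : R ^ p ≤ (p - 1) * R ^ p := le_mul_of_one_le_left (by positivity) (by linarith)
  linarith

/-- A pathwise Burkholder-Davis-Gundy inequality in the spirit of Beiglböck and Siorpaes: both the
pathwise Doob inequality and the Taylor expansion contain a power of the running maximum, which
Young's inequality absorbs into the left-hand side. -/
theorem exists_runMax_rpow_le_bdg {p : ℝ} (hp : 2 ≤ p) : ∃ C a b : ℝ, 0 ≤ C ∧ 0 ≤ a ∧ 0 ≤ b ∧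
    ∀ (S : ℕ → V) (N : ℕ), S 0 = 0 →
      runMax S N ^ p ≤ C * (∑ i ∈ Finset.range N, ‖S (i + 1) - S i‖ ^ 2) ^ (p / 2)
        + ∑ i ∈ Finset.range N, inner ℝ (bdgIntegrand p a b S i) (S (i + 1) - S i) := by
  obtain ⟨C, a, b, hC, ha, hb, habsorb⟩ := exists_rpow_le_of_le_of_le hp
  refine ⟨C, a, b, hC, ha, hb, fun S N hS => ?_⟩
  rw [sum_inner_bdgIntegrand]
  refine habsorb _ _ _ _ _ (runMax_nonneg S N) (norm_nonneg (S N))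
    (Finset.sum_nonneg fun _ _ => by positivity) ?_ (norm_rpow_le_sum_inner hp hS N)
  refine (runMax_rpow_le (by linarith) S N).trans ?_
  gcongr with i
  · exact Real.rpow_nonneg (runMax_nonneg S i) _
  · exact inv_norm_mul_inner_sub_le (S i) (S (i + 1))

end PathwiseBDG

section BDG

lemma ofReal_ne_zero_of_two_le {m : ℝ} (hm : 2 ≤ m) : ENNReal.ofReal m ≠ 0 :=
  (ENNReal.ofReal_pos.2 (by linarith)).ne'

lemma one_le_ofReal_of_two_le {m : ℝ} (hm : 2 ≤ m) : 1 ≤ ENNReal.ofReal m :=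
  ENNReal.one_le_ofReal.2 (by linarith)

variable {Ω V : Type*} {mΩ : MeasurableSpace Ω} [NormedAddCommGroup V]

lemma stronglyMeasurable_runMax {S : ℕ → Ω → V} {n : ℕ}
    (hS : ∀ k ≤ n, StronglyMeasurable (S k)) :
    StronglyMeasurable fun ω => runMax (fun k => S k ω) n := by
  induction n with
  | zero => simpa only [runMax_zero] using (hS 0 le_rfl).norm
  | succ n ih =>
    simp only [runMax_succ]
    exact (ih fun k hk => hS k (hk.trans n.le_succ)).sup (hS (n + 1) le_rfl).norm

lemma stronglyMeasurable_bdgIntegrand [InnerProductSpace ℝ V] (p a b : ℝ) {S : ℕ → Ω → V} {n : ℕ}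
    (hS : ∀ k ≤ n, StronglyMeasurable (S k)) :
    StronglyMeasurable fun ω => bdgIntegrand p a b (fun k => S k ω) n := by
  have hmax := (stronglyMeasurable_runMax hS).measurable
  have hnorm := (hS n le_rfl).norm.measurable
  exact (((hnorm.pow_const _).const_mul a).sub
    (((hmax.pow_const _).mul hnorm.inv).const_mul b)).stronglyMeasurable.smul (hS n le_rfl)

variable {P : Measure Ω}

lemma eLpNorm_norm_sq {m : ℝ} (f : Ω → V) :
    eLpNorm (fun ω => ‖f ω‖ ^ 2) (ENNReal.ofReal (m / 2)) P =
      eLpNorm f (ENNReal.ofReal m) P ^ 2 := by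
  have h := eLpNorm_norm_rpow (p := ENNReal.ofReal (m / 2)) (μ := P) f (q := 2) two_pos
  rw [← ENNReal.ofReal_mul' zero_le_two, div_mul_cancel₀ _ two_ne_zero] at h
  simpa using h

lemma memLp_norm_sq {m : ℝ} {f : Ω → V} (hf : MemLp f (ENNReal.ofReal m) P) :
    MemLp (fun ω => ‖f ω‖ ^ 2) (ENNReal.ofReal (m / 2)) P := by
  refine ⟨hf.1.norm.pow 2, ?_⟩
  rw [eLpNorm_norm_sq]
  exact ENNReal.pow_lt_top hf.2

lemma memLp_sum_norm_sq {m : ℝ} {X : ℕ → Ω → V} (hX : ∀ n, MemLp (X n) (ENNReal.ofReal m) P)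
    (N : ℕ) :
    MemLp (fun ω => ∑ n ∈ Finset.range N, ‖X n ω‖ ^ 2) (ENNReal.ofReal (m / 2)) P :=
  memLp_finsetSum _ fun n _ => memLp_norm_sq (hX n)

lemma integrable_norm_rpow_of_memLp {m : ℝ} (hm : 0 < m) {f : Ω → V}
    (hf : MemLp f (ENNReal.ofReal m) P) : Integrable (fun ω => ‖f ω‖ ^ m) P := by
  have h := hf.integrable_norm_rpow (ENNReal.ofReal_pos.2 hm).ne' ENNReal.ofReal_ne_top
  rwa [ENNReal.toReal_ofReal hm.le] at h

lemma eLpNorm_ofReal_eq_integral {m : ℝ} (hm : 0 < m) {f : Ω → V}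
    (hf : MemLp f (ENNReal.ofReal m) P) :
    eLpNorm f (ENNReal.ofReal m) P = ENNReal.ofReal ((∫ ω, ‖f ω‖ ^ m ∂P) ^ m⁻¹) := by
  rw [hf.eLpNorm_eq_integral_rpow_norm (ENNReal.ofReal_pos.2 hm).ne' ENNReal.ofReal_ne_top,
    ENNReal.toReal_ofReal hm.le]

variable [InnerProductSpace ℝ V]

lemma integral_inner_eq_zero_of_condExp_eq_zero [IsFiniteMeasure P] [CompleteSpace V]
    {𝓗 : MeasurableSpace Ω} (h𝓗 : 𝓗 ≤ mΩ) {H X : Ω → V} (hH : StronglyMeasurable[𝓗] H)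
    (hX : Integrable X P) (hHX : Integrable (fun ω => inner ℝ (H ω) (X ω)) P)
    (hX0 : P[X | 𝓗] =ᵐ[P] 0) : ∫ ω, inner ℝ (H ω) (X ω) ∂P = 0 := by
  have hpull : P[fun ω => inner ℝ (H ω) (X ω) | 𝓗] =ᵐ[P] fun ω => inner ℝ (H ω) (P[X | 𝓗] ω) :=
    condExp_bilin_of_stronglyMeasurable_left (innerSL ℝ (E := V)) hH hHX hX
  rw [← integral_condExp h𝓗, integral_congr_ae hpull, integral_eq_zero_of_ae]
  filter_upwards [hX0] with ω hω
  rw [hω, Pi.zero_apply, inner_zero_right, Pi.zero_apply]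

lemma norm_inner_bdgIntegrand_le {p a b : ℝ} (hp : 2 ≤ p) (ha : 0 ≤ a) (hb : 0 ≤ b) {S : ℕ → V}
    (hS : S 0 = 0) {i N : ℕ} (hi : i < N) :
    ‖inner ℝ (bdgIntegrand p a b S i) (S (i + 1) - S i)‖ ≤
      (a + b) * (∑ j ∈ Finset.range N, ‖S (j + 1) - S j‖) ^ p := by
  set B := ∑ j ∈ Finset.range N, ‖S (j + 1) - S j‖
  have hB : 0 ≤ B := Finset.sum_nonneg fun _ _ => norm_nonneg _
  have hmax : runMax S i ≤ B := runMax_le fun k hk => by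
    calc ‖S k‖ = ‖∑ j ∈ Finset.range k, (S (j + 1) - S j)‖ := by
          rw [Finset.sum_range_sub, hS, sub_zero]
      _ ≤ ∑ j ∈ Finset.range k, ‖S (j + 1) - S j‖ := norm_sum_le _ _
      _ ≤ B := Finset.sum_le_sum_of_subset_of_nonneg
          (Finset.range_subset_range.2 (hk.trans hi.le)) fun _ _ _ => norm_nonneg _
  have hincr : ‖S (i + 1) - S i‖ ≤ B :=
    Finset.single_le_sum (f := fun j => ‖S (j + 1) - S j‖) (fun _ _ => norm_nonneg _)
      (Finset.mem_range.2 hi)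
  calc ‖inner ℝ (bdgIntegrand p a b S i) (S (i + 1) - S i)‖
      ≤ ‖bdgIntegrand p a b S i‖ * ‖S (i + 1) - S i‖ := norm_inner_le_norm _ _
    _ ≤ ((a + b) * B ^ (p - 1)) * B := by
        gcongr
        refine (norm_bdgIntegrand_le hp ha hb S i).trans ?_
        gcongr
        · exact runMax_nonneg S i
        · linarith
    _ = (a + b) * B ^ p := by
        rw [mul_assoc, ← Real.rpow_add_one' hB (by linarith), sub_add_cancel]

lemma integrable_inner_bdgIntegrand {m a b : ℝ} (hm : 2 ≤ m) (ha : 0 ≤ a) (hb : 0 ≤ b)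
    {S : ℕ → Ω → V} (hS : ∀ n, StronglyMeasurable (S n))
    (hSm : ∀ n, MemLp (S n) (ENNReal.ofReal m) P) (hS0 : ∀ ω, S 0 ω = 0) (i : ℕ) :
    Integrable (fun ω => inner ℝ (bdgIntegrand m a b (fun n => S n ω) i) (S (i + 1) ω - S i ω))
      P := by
  have hdom : MemLp (fun ω => ∑ j ∈ Finset.range (i + 1), ‖S (j + 1) ω - S j ω‖)
      (ENNReal.ofReal m) P :=
    memLp_finsetSum _ fun j _ => ((hSm (j + 1)).sub (hSm j)).norm
  refine ((integrable_norm_rpow_of_memLp (by linarith) hdom).const_mul (a + b)).mono'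
    (((stronglyMeasurable_bdgIntegrand m a b fun k _ => hS k).inner
      ((hS (i + 1)).sub (hS i))).aestronglyMeasurable) (ae_of_all _ fun ω => ?_)
  rw [Real.norm_of_nonneg (Finset.sum_nonneg fun _ _ => norm_nonneg _)]
  exact norm_inner_bdgIntegrand_le hm ha hb (hS0 ω) i.lt_succ_self

lemma exists_integral_norm_rpow_le_bdg [CompleteSpace V] {m : ℝ} (hm : 2 ≤ m) : ∃ C : ℝ, 0 ≤ C ∧
    ∀ {Ω : Type u} {mΩ : MeasurableSpace Ω} {P : Measure Ω} [IsProbabilityMeasure P]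
      (𝓖 : Filtration ℕ mΩ) (S : ℕ → Ω → V), (∀ ω, S 0 ω = 0) →
      (∀ n, StronglyMeasurable[𝓖 n] (S (n + 1))) →
      (∀ n, MemLp (S n) (ENNReal.ofReal m) P) →
      (∀ n, P[fun ω => S (n + 2) ω - S (n + 1) ω | 𝓖 n] =ᵐ[P] 0) →
      ∀ N, ∫ ω, ‖S N ω‖ ^ m ∂P ≤
        C * ∫ ω, (∑ n ∈ Finset.range N, ‖S (n + 1) ω - S n ω‖ ^ 2) ^ (m / 2) ∂P := by
  obtain ⟨C, a, b, hC, ha, hb, hpath⟩ := exists_runMax_rpow_le_bdg (V := V) hm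
  refine ⟨C, hC, fun {Ω mΩ P _} 𝓖 S hS0 hS hSm hcentred N => ?_⟩
  have hadapted (n k : ℕ) (hk : k ≤ n + 1) : StronglyMeasurable[𝓖 n] (S k) := by
    cases k with
    | zero => simpa only [funext hS0] using stronglyMeasurable_const
    | succ k => exact (hS k).mono (𝓖.mono (Nat.le_of_succ_le_succ hk))
  have hmeas (n : ℕ) : StronglyMeasurable (S n) := (hadapted n n n.le_succ).mono (𝓖.le n)
  have hInt (i : ℕ) := integrable_inner_bdgIntegrand hm ha hb hmeas hSm hS0 i
  have hzero (i : ℕ) : ∫ ω, inner ℝ (bdgIntegrand m a b (fun n => S n ω) i)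
      (S (i + 1) ω - S i ω) ∂P = 0 := by
    cases i with
    | zero => simp only [bdgIntegrand, hS0, smul_zero, inner_zero_left, integral_zero]
    | succ i =>
      exact integral_inner_eq_zero_of_condExp_eq_zero (𝓖.le i)
        (@stronglyMeasurable_bdgIntegrand Ω V (𝓖 i) _ _ m a b S (i + 1) (hadapted i))
        (((hSm (i + 2)).sub (hSm (i + 1))).integrable (one_le_ofReal_of_two_le hm))
        (hInt (i + 1)) (hcentred i)
  have hsquare : Integrable
      (fun ω => (∑ n ∈ Finset.range N, ‖S (n + 1) ω - S n ω‖ ^ 2) ^ (m / 2)) P := by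
    have h := integrable_norm_rpow_of_memLp (by linarith)
      (memLp_sum_norm_sq (fun n => (hSm (n + 1)).sub (hSm n)) N)
    simpa only [Pi.sub_apply, Real.norm_of_nonneg (Finset.sum_nonneg fun _ _ => sq_nonneg _)]
      using h
  calc ∫ ω, ‖S N ω‖ ^ m ∂P
      ≤ ∫ ω, (C * (∑ n ∈ Finset.range N, ‖S (n + 1) ω - S n ω‖ ^ 2) ^ (m / 2)
          + ∑ i ∈ Finset.range N,
            inner ℝ (bdgIntegrand m a b (fun n => S n ω) i) (S (i + 1) ω - S i ω)) ∂P :=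
        integral_mono (integrable_norm_rpow_of_memLp (by linarith) (hSm N))
          ((hsquare.const_mul C).add (integrable_finsetSum _ fun i _ => hInt i))
          fun ω => (Real.rpow_le_rpow (norm_nonneg _) (norm_le_runMax (fun n => S n ω) le_rfl)
            (by linarith)).trans (hpath (fun n => S n ω) N (hS0 ω))
    _ = C * ∫ ω, (∑ n ∈ Finset.range N, ‖S (n + 1) ω - S n ω‖ ^ 2) ^ (m / 2) ∂P := by
        rw [integral_add (hsquare.const_mul C) (integrable_finsetSum _ fun i _ => hInt i),
          integral_finsetSum _ fun i _ => hInt i, Finset.sum_eq_zero fun i _ => hzero i, add_zero,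
          integral_const_mul]

theorem exists_isBDGConstant {m : ℝ} (hm : 2 ≤ m) (d : ℕ) : ∃ K, IsBDGConstant.{u} m d K := by
  obtain ⟨C, hC, hbdg⟩ :=
    exists_integral_norm_rpow_le_bdg.{u} (V := EuclideanSpace ℝ (Fin d)) hm
  have hm0 : 0 < m := by linarith
  refine ⟨C ^ (1 / m), by positivity, fun Ω mΩ P _ 𝓖 X hX hXm hcentred N => ?_⟩
  have hsquare := memLp_sum_norm_sq hXm N
  have hadapted (n : ℕ) :
      StronglyMeasurable[𝓖 n] fun ω => ∑ i ∈ Finset.range (n + 1), X i ω :=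
    Finset.stronglyMeasurable_fun_sum _ fun i hi =>
      (hX i).mono (𝓖.mono (Nat.le_of_lt_succ (Finset.mem_range.1 hi)))
  have hsum (n : ℕ) : MemLp (fun ω => ∑ i ∈ Finset.range n, X i ω) (ENNReal.ofReal m) P :=
    memLp_finsetSum _ fun i _ => hXm i
  have hmoment : ∫ ω, ‖∑ i ∈ Finset.range N, X i ω‖ ^ m ∂P ≤
      C * ∫ ω, (∑ n ∈ Finset.range N, ‖X n ω‖ ^ 2) ^ (m / 2) ∂P := by
    have h := hbdg (P := P) 𝓖 (fun n ω => ∑ i ∈ Finset.range n, X i ω)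
      (fun _ => Finset.sum_range_zero _) hadapted hsum
    simp only [Finset.sum_range_succ_sub_sum] at h
    exact h hcentred N
  rw [eLpNorm_ofReal_eq_integral hm0 (hsum N),
    eLpNorm_ofReal_eq_integral (by linarith) hsquare,
    ENNReal.ofReal_rpow_of_nonneg (by positivity) (by norm_num),
    ← ENNReal.ofReal_mul (by positivity)]
  simp only [Real.norm_of_nonneg (Finset.sum_nonneg fun _ _ => sq_nonneg _)]
  have hI : 0 ≤ ∫ ω, (∑ n ∈ Finset.range N, ‖X n ω‖ ^ 2) ^ (m / 2) ∂P := by positivity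
  rw [← Real.rpow_mul hI, show (m / 2)⁻¹ * (1 / 2) = 1 / m by field_simp, ← Real.mul_rpow hC hI,
    ← one_div]
  gcongr

theorem isBDGConstant_bdgConst {m : ℝ} (hm : 2 ≤ m) (d : ℕ) :
    IsBDGConstant.{u} m d (bdgConst.{u} m d) := by
  refine ⟨bdgConst_nonneg m d, fun Ω mΩ P hP 𝓖 X hX hXm hcentred N => ?_⟩
  obtain ⟨K, -, hK, hKmem⟩ := exists_seq_tendsto_sInf (S := {K : ℝ | IsBDGConstant.{u} m d K})
    (exists_isBDGConstant hm d) ⟨0, fun K hK => hK.1⟩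
  refine ge_of_tendsto' (ENNReal.Tendsto.mul_const (ENNReal.tendsto_ofReal hK) (Or.inr ?_))
    fun n => (hKmem n).2 Ω mΩ P hP 𝓖 X hX hXm hcentred N
  exact ENNReal.rpow_ne_top_of_nonneg (by norm_num) (memLp_sum_norm_sq hXm N).2.ne

/-- Tested with a single constant unit vector, the inequality forces `1 ≤ κ`. -/
theorem one_le_bdgConst {m : ℝ} (hm : 2 ≤ m) {d : ℕ} (hd : d ≠ 0) {Ω : Type u}
    {mΩ : MeasurableSpace Ω} (P : Measure Ω) [IsProbabilityMeasure P] :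
    1 ≤ bdgConst.{u} m d := by
  have : Nonempty (Fin d) := Fin.pos_iff_nonempty.1 (Nat.pos_of_ne_zero hd)
  obtain ⟨e, he⟩ := exists_norm_eq (EuclideanSpace ℝ (Fin d)) zero_le_one
  have h := (isBDGConstant_bdgConst hm d).2 Ω mΩ P inferInstance
    (Filtration.const ℕ mΩ le_rfl) (fun n _ => if n = 0 then e else 0)
    (fun _ => stronglyMeasurable_const) (fun _ => memLp_const _)
    (fun n => by
      simp only [n.succ_ne_zero, if_false]
      exact (condExp_zero (E := EuclideanSpace ℝ (Fin d))).eventuallyEq) 1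
  have he' : ‖e‖ₑ = 1 := by rw [← ofReal_norm, he, ENNReal.ofReal_one]
  simp only [Finset.range_one, Finset.sum_singleton, if_true] at h
  rw [eLpNorm_const _ (ofReal_ne_zero_of_two_le hm) (IsProbabilityMeasure.ne_zero P),
    eLpNorm_const _ (ENNReal.ofReal_pos.2 (by linarith)).ne' (IsProbabilityMeasure.ne_zero P),
    he', he] at h
  simpa using h

end BDG

/-- `‖f‖_{L_m} ≤ a`, for an a.e. strongly measurable function `f` and a real number `a ≥ 0`. -/
structure LpBound {Ω V : Type*} {mΩ : MeasurableSpace Ω} [NormedAddCommGroup V] (P : Measure Ω)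
    (m : ℝ) (f : Ω → V) (a : ℝ) : Prop where
  aestronglyMeasurable : AEStronglyMeasurable f P
  nonneg : 0 ≤ a
  le : eLpNorm f (ENNReal.ofReal m) P ≤ ENNReal.ofReal a

namespace LpBound

variable {Ω V : Type*} {mΩ : MeasurableSpace Ω} [NormedAddCommGroup V] {P : Measure Ω} {m : ℝ}
  {f g : Ω → V} {a b : ℝ}

lemma memLp (hf : LpBound P m f a) : MemLp f (ENNReal.ofReal m) P :=
  ⟨hf.aestronglyMeasurable, hf.le.trans_lt ENNReal.ofReal_lt_top⟩

lemma integrable [IsFiniteMeasure P] (hm : 1 ≤ m) (hf : LpBound P m f a) : Integrable f P :=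
  hf.memLp.integrable (ENNReal.one_le_ofReal.2 hm)

lemma mono (hf : LpBound P m f a) (hab : a ≤ b) : LpBound P m f b :=
  ⟨hf.aestronglyMeasurable, hf.nonneg.trans hab, hf.le.trans (ENNReal.ofReal_le_ofReal hab)⟩

lemma congr (hf : LpBound P m f a) (hfg : f =ᵐ[P] g) : LpBound P m g a :=
  ⟨hf.aestronglyMeasurable.congr hfg, hf.nonneg, (eLpNorm_congr_ae hfg).symm.le.trans hf.le⟩

lemma of_ae_eq_zero (hf : f =ᵐ[P] 0) (ha : 0 ≤ a) : LpBound P m f a :=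
  LpBound.congr (f := 0) ⟨aestronglyMeasurable_zero, ha, by simp⟩ hf.symm

lemma add (hm : 1 ≤ m) (hf : LpBound P m f a) (hg : LpBound P m g b) :
    LpBound P m (fun ω => f ω + g ω) (a + b) where
  aestronglyMeasurable := hf.aestronglyMeasurable.add hg.aestronglyMeasurable
  nonneg := add_nonneg hf.nonneg hg.nonneg
  le := by
    rw [ENNReal.ofReal_add hf.nonneg hg.nonneg]
    exact (eLpNorm_add_le hf.aestronglyMeasurable hg.aestronglyMeasurable
      (ENNReal.one_le_ofReal.2 hm)).trans (add_le_add hf.le hg.le)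

lemma neg (hf : LpBound P m f a) : LpBound P m (fun ω => -f ω) a :=
  ⟨hf.aestronglyMeasurable.neg, hf.nonneg, (eLpNorm_neg f _ P).le.trans hf.le⟩

lemma sub (hm : 1 ≤ m) (hf : LpBound P m f a) (hg : LpBound P m g b) :
    LpBound P m (fun ω => f ω - g ω) (a + b) := by
  simpa only [sub_eq_add_neg] using hf.add hm hg.neg

lemma sum (hm : 1 ≤ m) {ι : Type*} {s : Finset ι} {F : ι → Ω → V} {c : ι → ℝ}
    (hF : ∀ i ∈ s, LpBound P m (F i) (c i)) :
    LpBound P m (fun ω => ∑ i ∈ s, F i ω) (∑ i ∈ s, c i) := by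
  classical
  induction s using Finset.induction_on with
  | empty => exact of_ae_eq_zero (ae_of_all _ fun ω => Finset.sum_empty) le_rfl
  | insert i s hi ih =>
    simp only [Finset.sum_insert hi]
    exact (hF i (s.mem_insert_self i)).add hm (ih fun j hj => hF j (Finset.mem_insert_of_mem hj))

lemma condExp (hm : 1 ≤ m) [NormedSpace ℝ V] [CompleteSpace V] {𝓗 : MeasurableSpace Ω}
    (hf : LpBound P m f a) : LpBound P m (P[f | 𝓗]) a :=
  ⟨integrable_condExp.aestronglyMeasurable, hf.nonneg,
    (eLpNorm_condExp_le_eLpNorm f (ENNReal.one_le_ofReal.2 hm)).trans hf.le⟩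

lemma sum_norm_sq {X : ℕ → Ω → V} {v : ℕ → ℝ} (hm : 2 ≤ m) (hX : ∀ n, LpBound P m (X n) (v n))
    (N : ℕ) : LpBound P (m / 2) (fun ω => ∑ n ∈ Finset.range N, ‖X n ω‖ ^ 2)
      (∑ n ∈ Finset.range N, v n ^ 2) :=
  LpBound.sum (by linarith) fun n _ =>
    ⟨(memLp_norm_sq (hX n).memLp).aestronglyMeasurable, sq_nonneg _, by
      rw [eLpNorm_norm_sq, ENNReal.ofReal_pow (hX n).nonneg]
      exact pow_le_pow_left' (hX n).le 2⟩

end LpBound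

/-- The filtration `i ↦ 𝓖 (f i)`. -/
def reindexFiltration {Ω ι ι' : Type*} [Preorder ι] [Preorder ι'] {mΩ : MeasurableSpace Ω}
    (𝓖 : Filtration ι mΩ) (f : ι' → ι) (hf : Monotone f) : Filtration ι' mΩ where
  seq i := 𝓖 (f i)
  mono' _ _ hij := 𝓖.mono (hf hij)
  le' _ := 𝓖.le _

section BlockWeight

lemma sum_rpow_neg_le {c : ℝ} (hc₀ : 0 ≤ c) (hc : c < 1) (N : ℕ) :
    ∑ i ∈ Finset.range N, ((i : ℝ) + 1) ^ (-c) ≤ (N : ℝ) ^ (1 - c) / (1 - c) := by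
  have hc₁ : 0 < 1 - c := by linarith
  induction N with
  | zero => simp [Real.zero_rpow hc₁.ne']
  | succ n ih =>
    have hn : (0 : ℝ) < n + 1 := by positivity
    have hincr : (n : ℝ) ^ (1 - c) ≤ (n + 1) ^ (1 - c) - (1 - c) * (n + 1) ^ (-c) := by
      have hbernoulli := rpow_one_add_le_one_add_mul_self (s := -1 / ((n : ℝ) + 1)) (p := 1 - c)
        (by rw [le_div_iff₀ hn]; linarith [n.cast_nonneg (α := ℝ)]) hc₁.le (by linarith)
      rw [show 1 + -1 / ((n : ℝ) + 1) = n / (n + 1) by field_simp; ring,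
        Real.div_rpow n.cast_nonneg hn.le, div_le_iff₀ (by positivity)] at hbernoulli
      refine hbernoulli.trans_eq ?_
      rw [sub_eq_add_neg 1 c, Real.rpow_add hn, Real.rpow_one]
      field_simp
      ring
    rw [le_div_iff₀ hc₁] at ih ⊢
    rw [Finset.sum_range_succ]
    push_cast
    linarith

/-- A bound for the square root of `∑_{i < 2^K} (i + 1)^{-2γ}`. -/
noncomputable def blockWeight (γ : ℝ) (K : ℕ) : ℝ := ((2 : ℝ) ^ (1 / 2 - γ)) ^ K / √(1 - 2 * γ)

lemma blockWeight_nonneg (γ : ℝ) (K : ℕ) : 0 ≤ blockWeight γ K := by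
  unfold blockWeight; positivity

lemma sqrt_sum_mul_rpow_sq_le {γ x : ℝ} (hγ₀ : 0 ≤ γ) (hγ : γ < 1 / 2) (hx : 0 ≤ x) {N K : ℕ}
    (hN : N ≤ 2 ^ K) :
    √(∑ i ∈ Finset.range N, (x * ((i : ℝ) + 1) ^ (-γ)) ^ 2) ≤ x * blockWeight γ K := by
  have hpos : 0 < 1 - 2 * γ := by linarith
  have hweight := blockWeight_nonneg γ K
  have hsq (i : ℕ) : (x * ((i : ℝ) + 1) ^ (-γ)) ^ 2 = x ^ 2 * ((i : ℝ) + 1) ^ (-(2 * γ)) := by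
    rw [mul_pow, ← Real.rpow_mul_natCast (by positivity)]
    congr 2
    push_cast
    ring
  have hN' : (N : ℝ) ^ (1 - 2 * γ) ≤ (((2 : ℝ) ^ (1 / 2 - γ)) ^ K) ^ 2 := by
    calc (N : ℝ) ^ (1 - 2 * γ) ≤ ((2 : ℝ) ^ K) ^ (1 - 2 * γ) := by
          gcongr
          exact_mod_cast hN
      _ = (((2 : ℝ) ^ (1 / 2 - γ)) ^ K) ^ 2 := by
          rw [← pow_mul, ← Real.rpow_natCast, ← Real.rpow_natCast, ← Real.rpow_mul two_pos.le,
            ← Real.rpow_mul two_pos.le]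
          congr 1
          push_cast
          ring
  refine Real.sqrt_le_iff.2 ⟨by positivity, ?_⟩
  simp only [hsq, ← Finset.mul_sum]
  rw [mul_pow, blockWeight, div_pow, Real.sq_sqrt hpos.le]
  gcongr
  refine (sum_rpow_neg_le (c := 2 * γ) (by linarith) (by linarith) N).trans ?_
  gcongr

/-- The constants in `lpBound_sum_of_condExpDecay`: merging the terms in pairs contributes
`4 * blockWeight γ K` and turns the problem into one on half the length, with constant multiplied
by `2 ^ (1 - γ - α)`. -/
noncomputable def blockGrowth (α γ : ℝ) : ℕ → ℝ
  | 0 => 0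
  | K + 1 => 1 + 4 * blockWeight γ K + 2 ^ (1 - γ - α) * blockGrowth α γ K

lemma blockGrowth_nonneg (α γ : ℝ) (K : ℕ) : 0 ≤ blockGrowth α γ K := by
  induction K with
  | zero => exact le_rfl
  | succ K ih =>
    have := blockWeight_nonneg γ K
    rw [blockGrowth]; positivity

end BlockWeight

section CondExpDecay

variable {Ω : Type u} {mΩ : MeasurableSpace Ω} {P : Measure Ω} {m : ℝ}

lemma condExp_condExp_sub_condExp {V : Type*} [NormedAddCommGroup V] [NormedSpace ℝ V]
    [CompleteSpace V] [IsFiniteMeasure P] {𝓗 𝓖 : MeasurableSpace Ω} (h𝓗𝓖 : 𝓗 ≤ 𝓖) (h𝓖 : 𝓖 ≤ mΩ)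
    (f : Ω → V) : P[fun ω => P[f | 𝓖] ω - P[f | 𝓗] ω | 𝓗] =ᵐ[P] 0 := by
  filter_upwards [condExp_sub (m := 𝓗) (integrable_condExp (μ := P) (f := f) (m := 𝓖))
    (integrable_condExp (m := 𝓗)), condExp_condExp_of_le (μ := P) (f := f) h𝓗𝓖 h𝓖,
    condExp_condExp_of_le (μ := P) (f := f) le_rfl (h𝓗𝓖.trans h𝓖)] with ω hsub h𝓖ω h𝓗ω
  exact hsub.trans (by rw [Pi.sub_apply, h𝓖ω, h𝓗ω, sub_self, Pi.zero_apply])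

variable [IsProbabilityMeasure P] {d : ℕ} {κ : ℝ}

lemma lpBound_sum_of_isBDGConstant (hm : 2 ≤ m) (hκ : IsBDGConstant.{u} m d κ)
    {𝓖 : Filtration ℕ mΩ} {X : ℕ → Ω → EuclideanSpace ℝ (Fin d)} {v : ℕ → ℝ}
    (hX : ∀ n, StronglyMeasurable[𝓖 n] (X n)) (hXv : ∀ n, LpBound P m (X n) (v n))
    (hcentred : ∀ n, P[X (n + 1) | 𝓖 n] =ᵐ[P] 0) (N : ℕ) :
    LpBound P m (fun ω => ∑ n ∈ Finset.range N, X n ω)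
      (κ * √(∑ n ∈ Finset.range N, v n ^ 2)) := by
  have hsq := LpBound.sum_norm_sq hm hXv N
  refine ⟨(memLp_finsetSum _ fun n _ => (hXv n).memLp).aestronglyMeasurable,
    mul_nonneg hκ.1 (Real.sqrt_nonneg _),
    (hκ.2 Ω mΩ P inferInstance 𝓖 X hX (fun n => (hXv n).memLp) hcentred N).trans ?_⟩
  rw [ENNReal.ofReal_mul hκ.1, Real.sqrt_eq_rpow,
    ← ENNReal.ofReal_rpow_of_nonneg hsq.nonneg (by norm_num)]
  gcongr
  exact hsq.le

lemma lpBound_sum_condExp_sub (hm : 2 ≤ m) (hκ : IsBDGConstant.{u} m d κ) (𝓖 : Filtration ℕ mΩ)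
    {U : ℕ → Ω → EuclideanSpace ℝ (Fin d)} {v : ℕ → ℝ} (hU : ∀ j, LpBound P m (U j) (v j))
    (N : ℕ) :
    LpBound P m (fun ω => ∑ j ∈ Finset.range N, (P[U j | 𝓖 (j + 1)] ω - P[U j | 𝓖 j] ω))
      (2 * κ * √(∑ j ∈ Finset.range N, v j ^ 2)) := by
  have hm₁ : 1 ≤ m := one_le_two.trans hm
  refine (lpBound_sum_of_isBDGConstant hm hκ (v := fun j => 2 * v j)
    (𝓖 := reindexFiltration 𝓖 (fun j => j + 1) fun _ _ h => Nat.add_le_add_right h 1)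
    (fun j => stronglyMeasurable_condExp.sub
      (stronglyMeasurable_condExp.mono (𝓖.mono j.le_succ)))
    (fun j => (((hU j).condExp hm₁).sub hm₁ ((hU j).condExp hm₁)).mono (two_mul _).ge)
    (fun j => condExp_condExp_sub_condExp (𝓖.mono (j + 1).le_succ) (𝓖.le _) _) N).mono ?_
  simp only [mul_pow, ← Finset.mul_sum]
  rw [Real.sqrt_mul (by positivity), Real.sqrt_sq two_pos.le]
  linarith

lemma sum_range_two_mul_add_one {V : Type*} [AddCommMonoid V] (f : ℕ → V) (n : ℕ) :
    ∑ i ∈ Finset.range (2 * n + 1), f i =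
      f 0 + ∑ i ∈ Finset.range n, (f (2 * i + 1) + f (2 * i + 2)) := by
  induction n with
  | zero => simp
  | succ n ih =>
    rw [Nat.mul_succ, Finset.sum_range_succ, Finset.sum_range_succ, ih, Finset.sum_range_succ]
    simp only [add_assoc]

lemma rpow_neg_mul_rpow_neg_add_le {α γ x y : ℝ} (hα : 0 ≤ α) (hγ : 0 ≤ γ) (hx : 0 < x)
    (hy : 0 < y) :
    (2 * x) ^ (-γ) * (2 * y) ^ (-α) + (2 * x + 1) ^ (-γ) * (2 * y + 1) ^ (-α) ≤
      2 ^ (1 - γ - α) * (x ^ (-γ) * y ^ (-α)) := by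
  have hγ_anti : (2 * x + 1) ^ (-γ) ≤ (2 * x) ^ (-γ) :=
    Real.rpow_le_rpow_of_nonpos (by positivity) (by linarith) (by linarith)
  have hα_anti : (2 * y + 1) ^ (-α) ≤ (2 * y) ^ (-α) :=
    Real.rpow_le_rpow_of_nonpos (by positivity) (by linarith) (by linarith)
  calc (2 * x) ^ (-γ) * (2 * y) ^ (-α) + (2 * x + 1) ^ (-γ) * (2 * y + 1) ^ (-α)
      ≤ (2 * x) ^ (-γ) * (2 * y) ^ (-α) + (2 * x) ^ (-γ) * (2 * y) ^ (-α) := by gcongr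
    _ = 2 ^ (1 - γ - α) * (x ^ (-γ) * y ^ (-α)) := by
        rw [show 1 - γ - α = 1 + (-γ + -α) by ring, Real.rpow_add two_pos, Real.rpow_add two_pos,
          Real.rpow_one, Real.mul_rpow two_pos.le hx.le, Real.mul_rpow two_pos.le hy.le]
        ring

/-- The conditional expectations of the `Y i` decay with the time lag `i + 1 - p`, and with the
distance of `i` from the singularity. -/
def CondExpDecay (P : Measure Ω) (m : ℝ) (𝓖 : Filtration ℕ mΩ)
    (Y : ℕ → Ω → EuclideanSpace ℝ (Fin d)) (a α γ : ℝ) : Prop :=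
  ∀ i p : ℕ, p ≤ i → LpBound P m (P[Y i | 𝓖 p])
    (a * ((i : ℝ) + 1) ^ (-γ) * ((i : ℝ) + 1 - p) ^ (-α))

namespace CondExpDecay

variable {𝓖 : Filtration ℕ mΩ} {Y : ℕ → Ω → EuclideanSpace ℝ (Fin d)} {a α γ : ℝ}

lemma lpBound (hY : CondExpDecay P m 𝓖 Y a α γ) (hmeas : ∀ i, StronglyMeasurable[𝓖 i] (Y i))
    (hInt : ∀ i, Integrable (Y i) P) (i : ℕ) : LpBound P m (Y i) (a * ((i : ℝ) + 1) ^ (-γ)) := by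
  have h := hY i i le_rfl
  rwa [condExp_of_stronglyMeasurable (𝓖.le i) (hmeas i) (hInt i), add_sub_cancel_left,
    Real.one_rpow, mul_one] at h

lemma pair (hm : 1 ≤ m) (hα : 0 ≤ α) (hγ : 0 ≤ γ) (ha : 0 ≤ a)
    (hInt : ∀ i, Integrable (Y i) P) (hY : CondExpDecay P m 𝓖 Y a α γ) :
    CondExpDecay P m (reindexFiltration 𝓖 (2 * ·) fun _ _ h => Nat.mul_le_mul_left 2 h)
      (fun i => P[Y (2 * i + 1) + Y (2 * i + 2) | 𝓖 (2 * i)]) (a * 2 ^ (1 - γ - α)) α γ := by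
  intro i p hpi
  have hpi' : (p : ℝ) ≤ i := by exact_mod_cast hpi
  have hodd := hY (2 * i + 1) (2 * p) (by omega)
  have heven := hY (2 * i + 2) (2 * p) (by omega)
  refine ((hodd.add hm heven).congr ?_).mono ?_
  · exact ((condExp_condExp_of_le (𝓖.mono (Nat.mul_le_mul_left 2 hpi)) (𝓖.le _)).trans
      (condExp_add (hInt _) (hInt _) _)).symm
  · have hpair := mul_le_mul_of_nonneg_left (rpow_neg_mul_rpow_neg_add_le hα hγ
      (x := (i : ℝ) + 1) (y := (i : ℝ) + 1 - p) (by positivity) (by linarith)) ha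
    refine le_of_eq_of_le ?_ (hpair.trans_eq ?_)
    · push_cast
      ring_nf
    · ring

end CondExpDecay

/-- Merge the terms `Y (2 i + 1)` and `Y (2 i + 2)` and replace the pair by its conditional
expectation given `𝓖 (2 i)`. The error is a sum of martingale differences, and the time lag has
doubled, so that one can iterate. -/
theorem lpBound_sum_of_condExpDecay (hm : 2 ≤ m) (hκ : IsBDGConstant.{u} m d κ) (hκ₁ : 1 ≤ κ)
    {α γ a : ℝ} (hα : 0 ≤ α) (hγ₀ : 0 ≤ γ) (hγ : γ < 1 / 2) (ha : 0 ≤ a) (K : ℕ)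
    {𝓖 : Filtration ℕ mΩ} {Y : ℕ → Ω → EuclideanSpace ℝ (Fin d)}
    (hmeas : ∀ i, StronglyMeasurable[𝓖 i] (Y i)) (hInt : ∀ i, Integrable (Y i) P)
    (hY : CondExpDecay P m 𝓖 Y a α γ) :
    LpBound P m (fun ω => ∑ i ∈ Finset.range (2 ^ K - 1), Y i ω) (a * κ * blockGrowth α γ K) := by
  have hm₁ : 1 ≤ m := one_le_two.trans hm
  induction K generalizing 𝓖 Y a with
  | zero => exact .of_ae_eq_zero (ae_of_all _ fun ω => Finset.sum_empty) (by simp [blockGrowth])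
  | succ K ih =>
    set U : ℕ → Ω → EuclideanSpace ℝ (Fin d) := fun i => Y (2 * i + 1) + Y (2 * i + 2)
    set 𝓖₂ := reindexFiltration 𝓖 (2 * ·) fun _ _ h => Nat.mul_le_mul_left 2 h
    have hYb := hY.lpBound hmeas hInt
    have hUb (i : ℕ) : LpBound P m (U i) (2 * a * ((i : ℝ) + 1) ^ (-γ)) := by
      have hanti (k : ℕ) (hik : i ≤ k) : a * ((k : ℝ) + 1) ^ (-γ) ≤ a * ((i : ℝ) + 1) ^ (-γ) := by
        refine mul_le_mul_of_nonneg_left ?_ ha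
        exact Real.rpow_le_rpow_of_nonpos (by positivity) (by gcongr) (by linarith)
      refine ((hYb (2 * i + 1)).add hm₁ (hYb (2 * i + 2))).mono ?_
      linarith [hanti (2 * i + 1) (by omega), hanti (2 * i + 2) (by omega)]
    have hU (i : ℕ) : P[U i | 𝓖₂ (i + 1)] = U i :=
      condExp_of_stronglyMeasurable (𝓖₂.le _)
        (((hmeas (2 * i + 1)).mono (𝓖.mono (by dsimp only; omega))).add (hmeas (2 * i + 2)))
        ((hInt _).add (hInt _))
    have hmart : LpBound P m
        (fun ω => ∑ i ∈ Finset.range (2 ^ K - 1), (U i ω - P[U i | 𝓖₂ i] ω))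
        (2 * κ * (2 * a * blockWeight γ K)) := by
      have h := lpBound_sum_condExp_sub hm hκ 𝓖₂ hUb (2 ^ K - 1)
      simp only [hU] at h
      exact h.mono (mul_le_mul_of_nonneg_left
        (sqrt_sum_mul_rpow_sq_le hγ₀ hγ (by positivity) (Nat.sub_le _ _)) (by positivity))
    have hpred := ih (a := a * 2 ^ (1 - γ - α)) (by positivity)
      (fun i => stronglyMeasurable_condExp) (fun i => integrable_condExp)
      (hY.pair hm₁ hα hγ₀ ha hInt)
    refine ((((hYb 0).add hm₁ hmart).add hm₁ hpred).congr (ae_of_all _ fun ω => ?_)).mono ?_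
    · dsimp only
      rw [show 2 ^ (K + 1) - 1 = 2 * (2 ^ K - 1) + 1 by
        have := Nat.one_le_two_pow (n := K); rw [pow_succ]; omega,
        sum_range_two_mul_add_one, add_assoc, ← Finset.sum_add_distrib]
      exact congrArg _ (Finset.sum_congr rfl fun i _ => sub_add_cancel _ _)
    · rw [Nat.cast_zero, zero_add, Real.one_rpow, blockGrowth]
      linarith [mul_le_mul_of_nonneg_left hκ₁ ha]

lemma sqrt_sum_add_sq_le {N : ℕ} {p q : ℕ → ℝ} (hp : ∀ i, 0 ≤ p i) (hq : ∀ i, 0 ≤ q i) :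
    √(∑ i ∈ Finset.range N, (p i + q i) ^ 2) ≤
      √(∑ i ∈ Finset.range N, p i ^ 2) + √(∑ i ∈ Finset.range N, q i ^ 2) := by
  simpa only [Real.rpow_two, ← Real.sqrt_eq_rpow] using
    Real.Lp_add_le_of_nonneg (s := Finset.range N) one_le_two (fun i _ => hp i) fun i _ => hq i

lemma LpBound.sum_shifted_condExp_sub (hm : 2 ≤ m) (hκ : IsBDGConstant.{u} m d κ)
    (𝓖 : Filtration ℕ mΩ) {Y : ℕ → Ω → EuclideanSpace ℝ (Fin d)} {v : ℕ → ℝ}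
    (hY : ∀ i, LpBound P m (Y i) (v i)) (r N : ℕ) :
    LpBound P m
      (fun ω => ∑ i ∈ Finset.range N, (P[Y i | 𝓖 (i + r + 1)] ω - P[Y i | 𝓖 (i + r)] ω))
      (2 * κ * √(∑ i ∈ Finset.range N, v i ^ 2)) := by
  have hidx (i : ℕ) : i + r + 1 = i + 1 + r := by omega
  simp only [hidx]
  exact lpBound_sum_condExp_sub hm hκ
    (reindexFiltration 𝓖 (· + r) fun _ _ h => Nat.add_le_add_right h r) hY N

theorem lpBound_sum_of_condExpDecay_of_bound (hm : 2 ≤ m) (hκ : IsBDGConstant.{u} m d κ)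
    (hκ₁ : 1 ≤ κ) {α γ γ' a x y : ℝ} (hα : 0 ≤ α) (hγ₀ : 0 ≤ γ) (hγ : γ < 1 / 2) (hγ'₀ : 0 ≤ γ')
    (hγ' : γ' < 1 / 2) (ha : 0 ≤ a) (hx : 0 ≤ x) (hy : 0 ≤ y) (K : ℕ)
    {𝓖 : Filtration ℕ mΩ} {Y : ℕ → Ω → EuclideanSpace ℝ (Fin d)}
    (hmeas : ∀ i, StronglyMeasurable[𝓖 (i + 3)] (Y i))
    (hYb : ∀ i : ℕ, LpBound P m (Y i) (x * ((i : ℝ) + 1) ^ (-γ) + y * ((i : ℝ) + 1) ^ (-γ')))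
    (hY : CondExpDecay P m 𝓖 Y a α γ) :
    LpBound P m (fun ω => ∑ i ∈ Finset.range (2 ^ K - 1), Y i ω)
      (κ * (6 * (x * blockWeight γ K + y * blockWeight γ' K) + a * blockGrowth α γ K)) := by
  have hm₁ : 1 ≤ m := one_le_two.trans hm
  have hweight : √(∑ i ∈ Finset.range (2 ^ K - 1),
      (x * ((i : ℝ) + 1) ^ (-γ) + y * ((i : ℝ) + 1) ^ (-γ')) ^ 2) ≤
        x * blockWeight γ K + y * blockWeight γ' K :=
    (sqrt_sum_add_sq_le (fun _ => by positivity) fun _ => by positivity).trans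
      (add_le_add (sqrt_sum_mul_rpow_sq_le hγ₀ hγ hx (Nat.sub_le _ _))
        (sqrt_sum_mul_rpow_sq_le hγ'₀ hγ' hy (Nat.sub_le _ _)))
  have hmart (r : ℕ) := (LpBound.sum_shifted_condExp_sub hm hκ 𝓖 hYb r (2 ^ K - 1)).mono
    (mul_le_mul_of_nonneg_left hweight (mul_nonneg two_pos.le hκ.1))
  have hpred := lpBound_sum_of_condExpDecay hm hκ hκ₁ hα hγ₀ hγ ha K (𝓖 := 𝓖)
    (Y := fun i => P[Y i | 𝓖 i]) (fun i => stronglyMeasurable_condExp)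
    (fun i => integrable_condExp) fun i p hpi =>
      (hY i p hpi).congr (condExp_condExp_of_le (𝓖.mono hpi) (𝓖.le i)).symm
  have hlast (i : ℕ) : P[Y i | 𝓖 (i + 3)] = Y i :=
    condExp_of_stronglyMeasurable (𝓖.le _) (hmeas i) ((hYb i).integrable hm₁)
  refine (((((hmart 2).add hm₁ (hmart 1)).add hm₁ (hmart 0)).add hm₁ hpred).congr
    (ae_of_all _ fun ω => ?_)).mono (by linarith)
  simp only [← Finset.sum_add_distrib]
  refine Finset.sum_congr rfl fun i _ => ?_
  simp only [add_zero, add_assoc i, Nat.reduceAdd, hlast]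
  abel

end CondExpDecay

section Cells

lemma LpBound.sum_card_le {Ω V : Type*} {mΩ : MeasurableSpace Ω} [NormedAddCommGroup V]
    {P : Measure Ω} {m : ℝ} (hm : 1 ≤ m) {ι : Type*} {s : Finset ι} {F : ι → Ω → V} {a : ℝ} {B : ℕ}
    (ha : 0 ≤ a) (hB : s.card ≤ B) (hF : ∀ i ∈ s, LpBound P m (F i) a) :
    LpBound P m (fun ω => ∑ i ∈ s, F i ω) (B * a) := by
  refine (LpBound.sum hm hF).mono ?_
  rw [Finset.sum_const, nsmul_eq_mul]
  gcongr

lemma sum_condExp_ae_eq {Ω : Type*} {mΩ : MeasurableSpace Ω} {P : Measure Ω} {ι V : Type*}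
    [NormedAddCommGroup V] [NormedSpace ℝ V] [CompleteSpace V] {𝓗 : MeasurableSpace Ω}
    {s : Finset ι} {F : ι → Ω → V} (hF : ∀ i ∈ s, Integrable (F i) P) :
    (fun ω => ∑ i ∈ s, (P[F i | 𝓗]) ω) =ᵐ[P] P[fun ω => ∑ i ∈ s, F i ω | 𝓗] := by
  have h := condExp_finsetSum hF 𝓗
  rw [Finset.sum_fn, Finset.sum_fn] at h
  exact h.symm

lemma rpow_neg_le_of_mul_le {h r t e : ℝ} (hh : 0 < h) (hr : 0 < r) (he : 0 ≤ e)
    (ht : r * h ≤ t) : t ^ (-e) ≤ h ^ (-e) * r ^ (-e) := by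
  rw [← Real.mul_rpow hh.le hr.le, mul_comm h]
  exact Real.rpow_le_rpow_of_nonpos (by positivity) ht (by linarith)

/-- The points `l i` with `blk i = j` lie in the `j`-th block `[c + j lam, c + (j + 1) lam)`. There
are at most `2 ^ K` blocks with at most `B` points each. -/
structure BlockCover {ι : Type*} (I : Finset ι) (l : ι → ℝ) (blk : ι → ℕ) (c lam : ℝ) (B K : ℕ) :
    Prop where
  left_le : ∀ i ∈ I, c + blk i * lam ≤ l i
  lt_right : ∀ i ∈ I, l i < c + (blk i + 1) * lam
  lt_two_pow : ∀ i ∈ I, blk i < 2 ^ K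
  card_le : ∀ j, (I.filter fun i => blk i = j).card ≤ B

/-- The bounds for a random variable `Z` that belongs to a cell `[l, l + h]`: `z` is uniform in `l`,
while `x`, `y` and `g` are constants of bounds that are singular at `l = 0`. -/
structure CellBound {Ω V : Type*} {mΩ : MeasurableSpace Ω} [NormedAddCommGroup V]
    [NormedSpace ℝ V] [CompleteSpace V] (P : Measure Ω) (𝓕 : Filtration ℝ mΩ)
    (m M α γ γ' g x y z h l : ℝ) (Z : Ω → V) : Prop where
  stronglyMeasurable : StronglyMeasurable[𝓕 (l + h)] Z
  plain : LpBound P m Z z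
  weighted : 0 < l → LpBound P m Z (x * l ^ (-γ) + y * l ^ (-γ'))
  cond : ∀ v, 0 ≤ v → v < l → M * h ≤ l - v →
    LpBound P m (P[Z | 𝓕 v]) (g * l ^ (-γ) * (l - v) ^ (-α))

/-- The sum of the `Z i` over the points of the `j`-th block. -/
def blockSum {Ω V ι : Type*} [AddCommMonoid V] (I : Finset ι) (blk : ι → ℕ) (Z : ι → Ω → V)
    (j : ℕ) : Ω → V :=
  fun ω => ∑ i ∈ I.filter fun i => blk i = j, Z i ω

/-- The filtration `j ↦ 𝓕 (c + j lam)` of the left endpoints of the blocks. -/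
def blockFiltration {Ω : Type*} {mΩ : MeasurableSpace Ω} (𝓕 : Filtration ℝ mΩ) (c : ℝ) {lam : ℝ}
    (hlam : 0 ≤ lam) : Filtration ℕ mΩ :=
  reindexFiltration 𝓕 (fun j : ℕ => c + j * lam) fun i j hij => by
    have : (i : ℝ) ≤ j := by exact_mod_cast hij
    dsimp only
    gcongr

namespace BlockCover

variable {ι : Type*} {I : Finset ι} {l : ι → ℝ} {blk : ι → ℕ} {c h lam : ℝ} {B K : ℕ}

lemma lag_le (hcov : BlockCover I l blk c lam B K) {i : ι} (hi : i ∈ I) {j : ℕ}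
    (hij : blk i = j + 1) (p : ℕ) : ((j : ℝ) + 1 - p) * lam ≤ l i - (c + p * lam) := by
  have hleft := hcov.left_le i hi
  rw [hij] at hleft
  push_cast at hleft
  linarith

lemma succ_mul_le (hcov : BlockCover I l blk c lam B K) (hc : 0 ≤ c) (hlam : h ≤ lam) {i : ι}
    (hi : i ∈ I) {j : ℕ} (hij : blk i = j + 1) : ((j : ℝ) + 1) * h ≤ l i := by
  have hlag := hcov.lag_le hi hij 0
  have hmul : ((j : ℝ) + 1) * h ≤ ((j : ℝ) + 1) * lam := by gcongr
  simp only [Nat.cast_zero, zero_mul] at hlag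
  linarith

lemma blockSum_zero_add_sum {Ω V : Type*} [AddCommMonoid V]
    (hcov : BlockCover I l blk c lam B K) (Z : ι → Ω → V) (ω : Ω) :
    blockSum I blk Z 0 ω + ∑ j ∈ Finset.range (2 ^ K - 1), blockSum I blk Z (j + 1) ω =
      ∑ i ∈ I, Z i ω := by
  rw [← Finset.sum_fiberwise_of_maps_to (t := Finset.range (2 ^ K)) (g := blk)
    (fun i hi => Finset.mem_range.2 (hcov.lt_two_pow i hi)) (fun i => Z i ω),
    ← Nat.sub_add_cancel (Nat.one_le_two_pow (n := K)), Finset.sum_range_succ', add_comm]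
  rfl

variable {Ω : Type u} {mΩ : MeasurableSpace Ω} {P : Measure Ω} {𝓕 : Filtration ℝ mΩ}
  {m M α γ γ' g x y z : ℝ} {d : ℕ} {Z : ι → Ω → EuclideanSpace ℝ (Fin d)}

lemma stronglyMeasurable_blockSum (hcov : BlockCover I l blk c lam B K)
    (hZ : ∀ i ∈ I, CellBound P 𝓕 m M α γ γ' g x y z h (l i) (Z i)) (hlam₀ : 0 ≤ lam)
    (hlam : h ≤ lam) (j : ℕ) :
    StronglyMeasurable[blockFiltration 𝓕 c hlam₀ (j + 2)] (blockSum I blk Z j) :=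
  Finset.stronglyMeasurable_fun_sum _ fun i hi => by
    obtain ⟨hiI, rfl⟩ := Finset.mem_filter.1 hi
    refine (hZ i hiI).stronglyMeasurable.mono (𝓕.mono ?_)
    have hright := hcov.lt_right i hiI
    push_cast
    linarith

lemma lpBound_blockSum_succ (hm : 1 ≤ m) (hcov : BlockCover I l blk c lam B K)
    (hZ : ∀ i ∈ I, CellBound P 𝓕 m M α γ γ' g x y z h (l i) (Z i)) (hγ : 0 ≤ γ) (hγ' : 0 ≤ γ')
    (hx : 0 ≤ x) (hy : 0 ≤ y) (hc : 0 ≤ c) (hh : 0 < h) (hlam : h ≤ lam) (j : ℕ) :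
    LpBound P m (blockSum I blk Z (j + 1))
      (B * (x * h ^ (-γ)) * ((j : ℝ) + 1) ^ (-γ)
        + B * (y * h ^ (-γ')) * ((j : ℝ) + 1) ^ (-γ')) := by
  refine (LpBound.sum_card_le hm (a := x * (h ^ (-γ) * ((j : ℝ) + 1) ^ (-γ))
    + y * (h ^ (-γ') * ((j : ℝ) + 1) ^ (-γ'))) (by positivity) (hcov.card_le (j + 1))
    fun i hi => ?_).mono (le_of_eq (by ring))
  obtain ⟨hi, hij⟩ := Finset.mem_filter.1 hi
  have hli : ((j : ℝ) + 1) * h ≤ l i := hcov.succ_mul_le hc hlam hi hij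
  refine ((hZ i hi).weighted (lt_of_lt_of_le (by positivity) hli)).mono ?_
  gcongr
  · exact rpow_neg_le_of_mul_le hh (by positivity) hγ hli
  · exact rpow_neg_le_of_mul_le hh (by positivity) hγ' hli

variable [IsProbabilityMeasure P]

lemma condExpDecay_blockSum_succ (hm : 1 ≤ m) (hcov : BlockCover I l blk c lam B K)
    (hZ : ∀ i ∈ I, CellBound P 𝓕 m M α γ γ' g x y z h (l i) (Z i)) (hα : 0 ≤ α) (hγ : 0 ≤ γ)
    (hg : 0 ≤ g) (hc : 0 ≤ c) (hh : 0 < h) (hlam₀ : 0 ≤ lam) (hlam : h ≤ lam)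
    (hMlam : M * h ≤ lam) :
    CondExpDecay P m (blockFiltration 𝓕 c hlam₀) (fun j => blockSum I blk Z (j + 1))
      (B * (g * h ^ (-γ) * h ^ (-α))) α γ := by
  intro j p hp
  have hpj : (p : ℝ) ≤ j := by exact_mod_cast hp
  have hpos : (0 : ℝ) < j + 1 - p := by linarith
  refine ((LpBound.sum_card_le hm (a := g * (h ^ (-γ) * ((j : ℝ) + 1) ^ (-γ)) *
    (h ^ (-α) * ((j : ℝ) + 1 - p) ^ (-α))) (by positivity) (hcov.card_le (j + 1))
    fun i hi => ?_).congr (sum_condExp_ae_eq fun i hi =>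
      (hZ i (Finset.mem_filter.1 hi).1).plain.integrable hm)).mono (le_of_eq (by ring))
  obtain ⟨hi, hij⟩ := Finset.mem_filter.1 hi
  have hli : ((j : ℝ) + 1) * h ≤ l i := hcov.succ_mul_le hc hlam hi hij
  have hlag := hcov.lag_le hi hij p
  have hlam_le : lam ≤ ((j : ℝ) + 1 - p) * lam := le_mul_of_one_le_left hlam₀ (by linarith)
  have hlag_h : ((j : ℝ) + 1 - p) * h ≤ l i - (c + p * lam) := le_trans (by gcongr) hlag
  refine ((hZ i hi).cond (c + p * lam) (by positivity) (by linarith) (by linarith)).mono ?_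
  have : 0 ≤ l i := le_trans (by positivity) hli
  have hlag₀ : 0 ≤ l i - (c + p * lam) := hlam₀.trans (hlam_le.trans hlag)
  gcongr
  · exact rpow_neg_le_of_mul_le hh (by positivity) hγ hli
  · exact rpow_neg_le_of_mul_le hh hpos hα hlag_h

/-- The first block may touch the singularity, so it is estimated by `z`. The others form a sequence
with decaying conditional expectations. -/
theorem lpBound_sum (hm : 2 ≤ m) {κ : ℝ} (hκ : IsBDGConstant.{u} m d κ) (hκ₁ : 1 ≤ κ)
    (hcov : BlockCover I l blk c lam B K)
    (hZ : ∀ i ∈ I, CellBound P 𝓕 m M α γ γ' g x y z h (l i) (Z i)) (hα : 0 ≤ α) (hγ₀ : 0 ≤ γ)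
    (hγ : γ < 1 / 2) (hγ'₀ : 0 ≤ γ') (hγ' : γ' < 1 / 2) (hg : 0 ≤ g) (hx : 0 ≤ x) (hy : 0 ≤ y)
    (hz : 0 ≤ z) (hc : 0 ≤ c) (hh : 0 < h) (hlam : h ≤ lam) (hMlam : M * h ≤ lam) :
    LpBound P m (fun ω => ∑ i ∈ I, Z i ω)
      (B * z + κ * (B * (6 * (x * h ^ (-γ) * blockWeight γ K + y * h ^ (-γ') * blockWeight γ' K)
        + g * h ^ (-γ) * h ^ (-α) * blockGrowth α γ K))) := by
  have hm₁ : 1 ≤ m := one_le_two.trans hm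
  have hlam₀ : 0 ≤ lam := hh.le.trans hlam
  have hfirst : LpBound P m (blockSum I blk Z 0) (B * z) :=
    LpBound.sum_card_le hm₁ hz (hcov.card_le 0) fun i hi =>
      (hZ i (Finset.mem_filter.1 hi).1).plain
  have hrest := lpBound_sum_of_condExpDecay_of_bound hm hκ hκ₁ hα hγ₀ hγ hγ'₀ hγ'
    (by positivity) (by positivity) (by positivity) K
    (fun j => hcov.stronglyMeasurable_blockSum hZ hlam₀ hlam (j + 1))
    (hcov.lpBound_blockSum_succ hm₁ hZ hγ₀ hγ'₀ hx hy hc hh hlam)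
    (hcov.condExpDecay_blockSum_succ hm₁ hZ hα hγ₀ hg hc hh hlam₀ hlam hMlam)
  exact ((hfirst.add hm₁ hrest).congr (ae_of_all _ (hcov.blockSum_zero_add_sum Z))).mono
    (le_of_eq (by ring))

end BlockCover

end Cells

section Constants

lemma summable_of_succ_eq_add_mul {a s : ℕ → ℝ} {q : ℝ} (ha : ∀ n, 0 ≤ a n) (hs : ∀ n, 0 ≤ s n)
    (hsum : Summable s) (hq : q < 1) (hrec : ∀ n, a (n + 1) = s n + q * a n) :
    Summable a := by
  refine summable_of_sum_range_le (c := (a 0 + ∑' n, s n) / (1 - q)) ha fun n => ?_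
  rw [le_div_iff₀ (by linarith)]
  suffices ∑ i ∈ Finset.range (n + 1), a i ≤ a 0 + ∑' n, s n + q * ∑ i ∈ Finset.range n, a i by
    linarith [Finset.sum_range_succ a n, ha n]
  rw [Finset.sum_range_succ']
  simp only [hrec, Finset.sum_add_distrib, ← Finset.mul_sum]
  linarith [hsum.sum_le_tsum (Finset.range n) fun i _ => hs i]

lemma summable_pow_mul_add {r : ℝ} (hr : r ≠ 0) {F : ℕ → ℝ} (hF : Summable fun n => r ^ n * F n)
    (k : ℕ) : Summable fun n => r ^ n * F (n + k) :=
  (((summable_nat_add_iff k).2 hF).mul_left (r ^ k)⁻¹).congr fun n => by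
    rw [pow_add]; field_simp

lemma two_rpow_neg_lt_one {e : ℝ} (he : 0 < e) : (2 : ℝ) ^ (-e) < 1 :=
  Real.rpow_lt_one_of_one_lt_of_neg one_lt_two (neg_neg_of_pos he)

lemma summable_two_rpow_neg_pow {e : ℝ} (he : 0 < e) : Summable fun n : ℕ => ((2 : ℝ) ^ (-e)) ^ n :=
  summable_geometric_of_lt_one (by positivity) (two_rpow_neg_lt_one he)

lemma summable_blockWeight {β γ : ℝ} (hβ : 1 / 2 < β) :
    Summable fun n => ((2 : ℝ) ^ (-(β - γ))) ^ n * blockWeight γ n := by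
  refine ((summable_two_rpow_neg_pow (sub_pos.2 hβ)).mul_right (√(1 - 2 * γ))⁻¹).congr fun n => ?_
  rw [blockWeight, ← mul_div_assoc, ← mul_pow, ← Real.rpow_add two_pos, div_eq_mul_inv]
  congr 3
  ring

lemma summable_blockGrowth {α β γ : ℝ} (hβ : 1 < β) (hαβ : 1 / 2 < β - α) (hγ : γ < 1 / 2) :
    Summable fun n => ((2 : ℝ) ^ (-(β - α - γ))) ^ n * blockGrowth α γ n := by
  set r : ℝ := (2 : ℝ) ^ (-(β - α - γ))
  have : 0 < r := by positivity
  have hq : r * 2 ^ (1 - γ - α) < 1 := by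
    rw [← Real.rpow_add two_pos, show -(β - α - γ) + (1 - γ - α) = -(β - 1) by ring]
    exact two_rpow_neg_lt_one (by linarith)
  refine summable_of_succ_eq_add_mul (s := fun n => r * (r ^ n * 1 + 4 * (r ^ n * blockWeight γ n)))
    (q := r * 2 ^ (1 - γ - α)) (fun n => mul_nonneg (by positivity) (blockGrowth_nonneg _ _ _))
    (fun n => ?_) ?_ hq fun n => ?_
  · have := blockWeight_nonneg γ n
    positivity
  · exact (((summable_two_rpow_neg_pow (by linarith)).mul_right 1).add
      ((summable_blockWeight hαβ).mul_left 4)).mul_left r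
  · rw [blockGrowth, pow_succ]
    ring

/-- The series in the constant of the conditional part of the sewing bound. -/
noncomputable def growthSum (α β γ : ℝ) : ℝ :=
  ∑' n, ((2 : ℝ) ^ (-(β - α - γ))) ^ n * blockGrowth α γ (n + 1)

/-- The series in the constant of the martingale part of the sewing bound. -/
noncomputable def weightSum (β γ : ℝ) : ℝ :=
  ∑' n, ((2 : ℝ) ^ (-(β - γ))) ^ n * blockWeight γ (n + 1)

/-- The geometric series `∑ 2^{-nβ}`. -/
noncomputable def geomSum (β : ℝ) : ℝ := ∑' n : ℕ, ((2 : ℝ) ^ (-β)) ^ n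

lemma growthSum_nonneg (α β γ : ℝ) : 0 ≤ growthSum α β γ :=
  tsum_nonneg fun _ => mul_nonneg (by positivity) (blockGrowth_nonneg _ _ _)

lemma weightSum_nonneg (β γ : ℝ) : 0 ≤ weightSum β γ :=
  tsum_nonneg fun _ => mul_nonneg (by positivity) (blockWeight_nonneg _ _)

lemma geomSum_nonneg (β : ℝ) : 0 ≤ geomSum β := tsum_nonneg fun _ => by positivity

lemma div_two_pow_rpow {h : ℝ} (hh : 0 ≤ h) (n : ℕ) (e : ℝ) :
    (h / 2 ^ n) ^ e = h ^ e * ((2 : ℝ) ^ (-e)) ^ n := by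
  rw [Real.div_rpow hh (by positivity), div_eq_mul_inv, Real.rpow_neg two_pos.le, inv_pow,
    ← Real.rpow_natCast_mul two_pos.le, ← Real.rpow_mul_natCast two_pos.le, mul_comm e]

end Constants

section Limits

variable {Ω V : Type*} [NormedAddCommGroup V] {m : ℝ}

lemma LpBound.of_tendsto {mΩ : MeasurableSpace Ω} {P : Measure Ω} {a : ℝ} (hm : 1 ≤ m)
    {F : ℕ → Ω → V} {f : Ω → V} (hF : ∀ᶠ n in atTop, LpBound P m (F n) a)
    (hf : AEStronglyMeasurable f P)
    (hlim : Tendsto (fun n => eLpNorm (fun ω => F n ω - f ω) (ENNReal.ofReal m) P) atTop (𝓝 0)) :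
    LpBound P m f a := by
  obtain ⟨n, hn⟩ := hF.exists
  refine ⟨hf, hn.nonneg, ?_⟩
  have hbound := hlim.const_add (ENNReal.ofReal a)
  rw [add_zero] at hbound
  refine ge_of_tendsto hbound (hF.mono fun n hn => ?_)
  calc eLpNorm f (ENNReal.ofReal m) P
      = eLpNorm (F n - fun ω => F n ω - f ω) (ENNReal.ofReal m) P := by
        congr 1
        ext1 ω
        exact (sub_sub_cancel _ _).symm
    _ ≤ eLpNorm (F n) (ENNReal.ofReal m) P
          + eLpNorm (fun ω => F n ω - f ω) (ENNReal.ofReal m) P :=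
        eLpNorm_sub_le hn.aestronglyMeasurable (hn.aestronglyMeasurable.sub hf)
          (ENNReal.one_le_ofReal.2 hm)
    _ ≤ _ := by gcongr; exact hn.le

lemma exists_stronglyMeasurable_lp_limit {𝓗 mΩ : MeasurableSpace Ω} [CompleteSpace V]
    {P : Measure Ω} (hm : 1 ≤ m) (h𝓗 : 𝓗 ≤ mΩ) {F : ℕ → Ω → V}
    (hmeas : ∀ n, StronglyMeasurable[𝓗] (F n)) (hmem : ∀ n, MemLp (F n) (ENNReal.ofReal m) P)
    {b : ℕ → ℝ} (hb : Summable b) (hF : ∀ n, LpBound P m (fun ω => F (n + 1) ω - F n ω) (b n)) :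
    ∃ f : Ω → V, StronglyMeasurable[𝓗] f ∧ MemLp f (ENNReal.ofReal m) P ∧
      Tendsto (fun n => eLpNorm (fun ω => F n ω - f ω) (ENNReal.ofReal m) P) atTop (𝓝 0) := by
  have : Fact (1 ≤ ENNReal.ofReal m) := ⟨ENNReal.one_le_ofReal.2 hm⟩
  set G : ℕ → Lp V (ENNReal.ofReal m) P := fun n => (hmem n).toLp
  have hcauchy : CauchySeq G := by
    refine cauchySeq_of_dist_le_of_summable b (fun n => ?_) hb
    rw [dist_comm, ← ENNReal.ofReal_le_ofReal_iff (hF n).nonneg, ← edist_dist, Lp.edist_toLp_toLp]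
    exact (hF n).le
  obtain ⟨g, hg⟩ := cauchySeq_tendsto_of_complete hcauchy
  have hg_meas : AEStronglyMeasurable[𝓗] g P :=
    (isClosed_aestronglyMeasurable (F := V) (p := ENNReal.ofReal m) (μ := P) h𝓗).mem_of_tendsto hg
      (Eventually.of_forall fun n =>
        (hmeas n).aestronglyMeasurable.congr (hmem n).coeFn_toLp.symm)
  refine ⟨hg_meas.mk g, hg_meas.stronglyMeasurable_mk,
    (memLp_congr_ae hg_meas.ae_eq_mk).1 (Lp.memLp g), ?_⟩
  refine ((Lp.tendsto_Lp_iff_tendsto_eLpNorm' G g).1 hg).congr fun n => eLpNorm_congr_ae ?_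
  filter_upwards [(hmem n).coeFn_toLp, hg_meas.ae_eq_mk] with ω hGω hgω
  rw [Pi.sub_apply, hGω, hgω]

end Limits

section Grid

lemma floor_div_mul_le {s h : ℝ} (hh : 0 < h) (hs : 0 ≤ s) : ⌊s / h⌋₊ * h ≤ s := by
  rw [← le_div_iff₀ hh]
  exact Nat.floor_le (div_nonneg hs hh.le)

lemma lt_floor_div_add_one_mul {s h : ℝ} (hh : 0 < h) : s < (⌊s / h⌋₊ + 1) * h := by
  rw [← div_lt_iff₀ hh]
  exact Nat.lt_floor_add_one _

lemma succ_mul_le_of_lt_floor_div {s h : ℝ} (hh : 0 < h) (hs : 0 ≤ s) {i : ℕ}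
    (hi : i < ⌊s / h⌋₊) : ((i + 1 : ℕ) : ℝ) * h ≤ s := by
  rw [← le_div_iff₀ hh, ← Nat.le_floor_iff (div_nonneg hs hh.le)]
  exact hi

lemma le_mul_of_floor_div_lt {s h : ℝ} (hh : 0 < h) {i : ℕ} (hi : ⌊s / h⌋₊ < i) : s ≤ i * h := by
  rw [← div_le_iff₀ hh]
  exact Nat.lt_of_floor_lt hi |>.le

/-- The projection of `x` to `[s, t]`. -/
noncomputable def clip (s t x : ℝ) : ℝ := max s (min t x)

lemma le_clip (s t x : ℝ) : s ≤ clip s t x := le_max_left _ _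

lemma clip_le {s t : ℝ} (hst : s ≤ t) (x : ℝ) : clip s t x ≤ t := max_le hst (min_le_left _ _)

lemma clip_of_le_left {s t x : ℝ} (hx : x ≤ s) : clip s t x = s :=
  max_eq_left ((min_le_right _ _).trans hx)

lemma clip_of_right_le {s t x : ℝ} (hst : s ≤ t) (hx : t ≤ x) : clip s t x = t := by
  rw [clip, min_eq_left hx, max_eq_right hst]

lemma clip_of_mem {s t x : ℝ} (hs : s ≤ x) (ht : x ≤ t) : clip s t x = x := by
  rw [clip, min_eq_right ht, max_eq_right hs]

lemma clip_mono (s t : ℝ) : Monotone (clip s t) := fun _ _ h => by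
  unfold clip; gcongr

lemma clip_eq_clip_of_le_left {r s t x : ℝ} (hrs : r ≤ s) (hst : s ≤ t) (hx : s ≤ x) :
    clip r t x = clip s t x := by
  have hmin : s ≤ min t x := le_min hst hx
  rw [clip, clip, max_eq_right hmin, max_eq_right (hrs.trans hmin)]

lemma clip_succ_le {h : ℝ} (hh : 0 ≤ h) (s t : ℝ) (i : ℕ) :
    clip s t ((i + 1 : ℕ) * h) ≤ clip s t (i * h) + h := by
  refine max_le ((le_clip s t _).trans (le_add_of_nonneg_right hh)) ?_
  calc min t ((i + 1 : ℕ) * h) ≤ min (t + h) (i * h + h) := by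
        refine min_le_min (le_add_of_nonneg_right hh) (le_of_eq ?_)
        push_cast
        ring
    _ = min t (i * h) + h := min_add_add_right _ _ _
    _ ≤ clip s t (i * h) + h := by gcongr; exact le_max_right _ _

/-- The term of a Riemann sum over `[s, t]` that belongs to the cell `[i h, (i + 1) h]`. -/
noncomputable def gridTerm {Ω E : Type*} (A : ℝ → ℝ → Ω → E) (h s t : ℝ) (i : ℕ) : Ω → E :=
  A (clip s t (i * h)) (clip s t ((i + 1 : ℕ) * h))

/-- The Riemann sum of `A` over the partition of `[s, t]` induced by the grid `h ℕ`. All cells with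
index at least `N` are neglected, so that `t ≤ N * h` is needed for the whole sum. -/
noncomputable def gridSum {Ω E : Type*} [AddCommMonoid E] (A : ℝ → ℝ → Ω → E) (h : ℝ) (N : ℕ)
    (s t : ℝ) : Ω → E :=
  fun ω => ∑ i ∈ Finset.range N, gridTerm A h s t i ω

/-- Minus the `i`-th term in the difference of the Riemann sums over the grids `(h / 2) ℕ` and
`h ℕ`. -/
noncomputable def cellDelta {Ω E : Type*} [AddCommGroup E] (A : ℝ → ℝ → Ω → E) (h s t : ℝ)
    (i : ℕ) : Ω → E :=
  germDelta A (clip s t (i * h)) (clip s t ((2 * i + 1 : ℕ) * (h / 2))) (clip s t ((i + 1 : ℕ) * h))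

section Deterministic

variable {Ω E : Type*} {A : ℝ → ℝ → Ω → E} {h s t : ℝ} {ω : Ω}

lemma gridTerm_of_succ_mul_le (hh : 0 ≤ h) {i : ℕ} (hi : ((i + 1 : ℕ) : ℝ) * h ≤ s) :
    gridTerm A h s t i = A s s := by
  rw [gridTerm, clip_of_le_left hi, clip_of_le_left (by push_cast at hi; linarith)]

lemma gridTerm_of_le_mul (hh : 0 ≤ h) (hst : s ≤ t) {i : ℕ} (hi : t ≤ i * h) :
    gridTerm A h s t i = A t t := by
  rw [gridTerm, clip_of_right_le hst hi, clip_of_right_le hst (by push_cast; linarith)]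

variable [AddCommGroup E]

lemma sum_range_two_mul {V : Type*} [AddCommMonoid V] (f : ℕ → V) (n : ℕ) :
    ∑ i ∈ Finset.range (2 * n), f i = ∑ i ∈ Finset.range n, (f (2 * i) + f (2 * i + 1)) := by
  induction n with
  | zero => simp
  | succ n ih =>
    rw [Nat.mul_succ, Finset.sum_range_succ, Finset.sum_range_succ, ih, Finset.sum_range_succ,
      add_assoc]

lemma gridSum_half_sub (N : ℕ) :
    gridSum A (h / 2) (2 * N) s t ω - gridSum A h N s t ω =
      -∑ i ∈ Finset.range N, cellDelta A h s t i ω := by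
  rw [gridSum, gridSum, sum_range_two_mul, ← Finset.sum_sub_distrib, ← Finset.sum_neg_distrib]
  refine Finset.sum_congr rfl fun i _ => ?_
  have hleft : ((2 * i : ℕ) : ℝ) * (h / 2) = i * h := by push_cast; ring
  have hright : ((2 * i + 1 + 1 : ℕ) : ℝ) * (h / 2) = (i + 1 : ℕ) * h := by push_cast; ring
  rw [cellDelta, germDelta, gridTerm, gridTerm, gridTerm, hleft, hright]
  abel

/-- There is at most one grid point inside `[s, t]`. -/
lemma gridSum_eq_sub_germDelta (hss : A s s ω = 0) (htt : A t t ω = 0) (hh : 0 < h) {N : ℕ}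
    (hs : 0 ≤ s) (hst : s ≤ t) (hN : t ≤ N * h) (hth : t - s ≤ h) :
    gridSum A h N s t ω =
      A s t ω - germDelta A s (clip s t ((⌊s / h⌋₊ + 1 : ℕ) * h)) t ω := by
  set i₀ := ⌊s / h⌋₊
  have hlo : i₀ * h ≤ s := floor_div_mul_le hh hs
  have hhi : t ≤ (i₀ + 1 + 1 : ℕ) * h := by
    have := lt_floor_div_add_one_mul (s := s) hh
    push_cast
    linarith
  have hright {i j : ℕ} (hj : t ≤ j * h) (hji : j ≤ i) : gridTerm A h s t i ω = 0 := by
    rw [gridTerm_of_le_mul hh.le hst (hj.trans (by gcongr)), htt]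
  have hpair : gridSum A h N s t ω = ∑ i ∈ {i₀, i₀ + 1}, gridTerm A h s t i ω := by
    refine Finset.sum_congr_of_eq_on_inter (fun i _ hi => ?_) (fun i _ hi => ?_) fun _ _ _ => rfl
    · simp only [Finset.mem_insert, Finset.mem_singleton, not_or] at hi
      rcases Nat.lt_or_ge i i₀ with hlt | hge
      · rw [gridTerm_of_succ_mul_le hh.le (succ_mul_le_of_lt_floor_div hh hs hlt), hss]
      · exact hright hhi (by omega)
    · exact hright hN (by simpa only [Finset.mem_range, not_lt] using hi)
  rw [hpair, Finset.sum_pair (by omega), gridTerm, gridTerm, clip_of_le_left hlo,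
    clip_of_right_le hst hhi, germDelta]
  abel

lemma gridSum_sub_sub_eq_germDelta (hss : A s s ω = 0) (hh : 0 < h) {N : ℕ}
    (hs : 0 ≤ s) (hst : s ≤ t) (hN : t < N * h) :
    gridSum A h N 0 t ω - gridSum A h N 0 s ω - gridSum A h N s t ω =
      germDelta A (⌊s / h⌋₊ * h) s (clip s t ((⌊s / h⌋₊ + 1 : ℕ) * h)) ω := by
  set i₀ := ⌊s / h⌋₊
  have hlo : i₀ * h ≤ s := floor_div_mul_le hh hs
  have hhi : s ≤ (i₀ + 1 : ℕ) * h := le_mul_of_floor_div_lt hh i₀.lt_succ_self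
  have hlo₀ : 0 ≤ i₀ * h := by positivity
  have hi₀ : i₀ ∈ Finset.range N := Finset.mem_range.2 <| by
    have : (i₀ : ℝ) < N := lt_of_mul_lt_mul_right (by linarith) hh.le
    exact_mod_cast this
  rw [gridSum, gridSum, gridSum, ← Finset.sum_sub_distrib, ← Finset.sum_sub_distrib,
    Finset.sum_eq_single_of_mem i₀ hi₀ fun i _ hi => ?_]
  · rw [gridTerm, gridTerm, gridTerm, clip_of_mem hlo₀ (hlo.trans hst), clip_of_mem hlo₀ hlo,
      clip_of_le_left hlo, clip_of_right_le hs hhi, clip_eq_clip_of_le_left hs hst hhi, germDelta]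
  rcases hi.lt_or_gt with hlt | hgt
  · have hi₁ : ((i + 1 : ℕ) : ℝ) * h ≤ s := succ_mul_le_of_lt_floor_div hh hs hlt
    have hi₂ : (i : ℝ) * h ≤ s := le_trans (by gcongr; omega) hi₁
    rw [gridTerm_of_succ_mul_le hh.le hi₁, hss, gridTerm, gridTerm,
      clip_of_mem (by positivity) (hi₂.trans hst), clip_of_mem (by positivity) (hi₁.trans hst),
      clip_of_mem (by positivity) hi₂, clip_of_mem (by positivity) hi₁, sub_self, sub_zero]
  · have hi₂ : s ≤ (i : ℝ) * h := le_mul_of_floor_div_lt hh hgt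
    have hi₁ : s ≤ ((i + 1 : ℕ) : ℝ) * h := hi₂.trans (by gcongr; omega)
    rw [gridTerm_of_le_mul hh.le hs hi₂, hss, gridTerm, gridTerm,
      clip_eq_clip_of_le_left hs hst hi₂, clip_eq_clip_of_le_left hs hst hi₁, sub_zero, sub_self]

end Deterministic

/-- The standing assumptions on a germ `A` on `[0, T]`: it vanishes on the diagonal, is adapted, and
takes values in `L_m`. -/
structure IsAdaptedGerm {Ω V : Type*} {mΩ : MeasurableSpace Ω} [NormedAddCommGroup V]
    (P : Measure Ω) (𝓕 : Filtration ℝ mΩ) (T m : ℝ) (A : ℝ → ℝ → Ω → V) : Prop where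
  diag : ∀ s, 0 ≤ s → s ≤ T → A s s =ᵐ[P] 0
  adapted : ∀ s t, 0 ≤ s → s ≤ t → t ≤ T → StronglyMeasurable[𝓕 t] (A s t)
  memLp : ∀ s t, 0 ≤ s → s ≤ t → t ≤ T → MemLp (A s t) (ENNReal.ofReal m) P

namespace IsAdaptedGerm

variable {Ω V : Type*} {mΩ : MeasurableSpace Ω} [NormedAddCommGroup V] {P : Measure Ω}
  {𝓕 : Filtration ℝ mΩ} {T m : ℝ} {A : ℝ → ℝ → Ω → V} {h s t : ℝ}

lemma stronglyMeasurable_germDelta (hA : IsAdaptedGerm P 𝓕 T m A) {a b c : ℝ} (ha : 0 ≤ a)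
    (hab : a ≤ b) (hbc : b ≤ c) (hc : c ≤ T) : StronglyMeasurable[𝓕 c] (germDelta A a b c) :=
  ((hA.adapted a c ha (hab.trans hbc) hc).sub
    ((hA.adapted a b ha hab (hbc.trans hc)).mono (𝓕.mono hbc))).sub
    (hA.adapted b c (ha.trans hab) hbc hc)

lemma memLp_germDelta (hA : IsAdaptedGerm P 𝓕 T m A) {a b c : ℝ} (ha : 0 ≤ a)
    (hab : a ≤ b) (hbc : b ≤ c) (hc : c ≤ T) : MemLp (germDelta A a b c) (ENNReal.ofReal m) P :=
  ((hA.memLp a c ha (hab.trans hbc) hc).sub (hA.memLp a b ha hab (hbc.trans hc))).sub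
    (hA.memLp b c (ha.trans hab) hbc hc)

lemma germDelta_left (hA : IsAdaptedGerm P 𝓕 T m A) {a : ℝ} (ha : 0 ≤ a) (haT : a ≤ T) (c : ℝ) :
    germDelta A a a c =ᵐ[P] 0 := by
  filter_upwards [hA.diag a ha haT] with ω hω
  rw [germDelta, hω, Pi.zero_apply, sub_zero, sub_self]

lemma germDelta_right (hA : IsAdaptedGerm P 𝓕 T m A) (a : ℝ) {c : ℝ} (hc : 0 ≤ c) (hcT : c ≤ T) :
    germDelta A a c c =ᵐ[P] 0 := by
  filter_upwards [hA.diag c hc hcT] with ω hω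
  rw [germDelta, hω, Pi.zero_apply, sub_zero, sub_self]

lemma stronglyMeasurable_gridSum (hA : IsAdaptedGerm P 𝓕 T m A) (hh : 0 ≤ h) (N : ℕ)
    (hs : 0 ≤ s) (hst : s ≤ t) (ht : t ≤ T) :
    StronglyMeasurable[𝓕 t] (gridSum A h N s t) :=
  Finset.stronglyMeasurable_fun_sum _ fun i _ =>
    (hA.adapted _ _ (hs.trans (le_clip _ _ _)) (clip_mono s t (by gcongr; omega))
      ((clip_le hst _).trans ht)).mono (𝓕.mono (clip_le hst _))

lemma memLp_gridSum (hA : IsAdaptedGerm P 𝓕 T m A) (hh : 0 ≤ h) (N : ℕ)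
    (hs : 0 ≤ s) (hst : s ≤ t) (ht : t ≤ T) :
    MemLp (gridSum A h N s t) (ENNReal.ofReal m) P :=
  memLp_finsetSum _ fun i _ => hA.memLp _ _ (hs.trans (le_clip _ _ _))
    (clip_mono s t (by gcongr; omega)) ((clip_le hst _).trans ht)

end IsAdaptedGerm

end Grid

section Levels

/-- The indices `i < N` of the cells `[i h, (i + 1) h]` of the grid `h ℕ` that meet `[s, t)`. -/
noncomputable def activeCells (h : ℝ) (N : ℕ) (s t : ℝ) : Finset ℕ :=
  (Finset.range N).filter fun i => ⌊s / h⌋₊ ≤ i ∧ (i : ℝ) * h < t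

section ActiveCells

variable {h s t : ℝ} {N n i : ℕ}

lemma floor_le_of_mem_activeCells (hi : i ∈ activeCells h N s t) : ⌊s / h⌋₊ ≤ i :=
  (Finset.mem_filter.1 hi).2.1

lemma mul_lt_of_mem_activeCells (hi : i ∈ activeCells h N s t) : i * h < t :=
  (Finset.mem_filter.1 hi).2.2

lemma sub_floor_le_of_mem_activeCells (hh : 0 < h) (hn : t - s ≤ 2 ^ n * h)
    (hi : i ∈ activeCells h N s t) : i - ⌊s / h⌋₊ ≤ 2 ^ n := by
  have hit := mul_lt_of_mem_activeCells hi
  have hs := lt_floor_div_add_one_mul (s := s) hh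
  have hlt : (i : ℝ) < ⌊s / h⌋₊ + 1 + 2 ^ n := lt_of_mul_lt_mul_right (by linarith) hh.le
  have : i < ⌊s / h⌋₊ + 1 + 2 ^ n := by exact_mod_cast hlt
  have := Nat.one_le_two_pow (n := n)
  omega

lemma card_activeCells_le (hh : 0 < h) (hn : t - s ≤ 2 ^ n * h) :
    (activeCells h N s t).card ≤ 2 ^ (n + 1) := by
  have hsub : activeCells h N s t ⊆ Finset.Ico ⌊s / h⌋₊ (⌊s / h⌋₊ + (2 ^ n + 1)) := fun i hi => by
    have hlo := floor_le_of_mem_activeCells hi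
    have hhi := sub_floor_le_of_mem_activeCells hh hn hi
    rw [Finset.mem_Ico]
    omega
  have hcard := Finset.card_le_card hsub
  have hone := Nat.one_le_two_pow (n := n)
  rw [Nat.card_Ico] at hcard
  rw [pow_succ]
  omega

lemma blockCover_activeCells (hh : 0 < h) (hn : t - s ≤ 2 ^ n * h) (N : ℕ) {Λ : ℕ} (hΛ : 0 < Λ) :
    BlockCover (activeCells h N s t) (fun i => clip s t (i * h)) (fun i => (i - ⌊s / h⌋₊) / Λ)
      (⌊s / h⌋₊ * h) (Λ * h) Λ (n + 1) where
  left_le i hi := by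
    have hlo := floor_le_of_mem_activeCells hi
    have hdiv : ⌊s / h⌋₊ + (i - ⌊s / h⌋₊) / Λ * Λ ≤ i := by
      have := Nat.div_mul_le_self (i - ⌊s / h⌋₊) Λ
      omega
    calc (⌊s / h⌋₊ * h + ((i - ⌊s / h⌋₊) / Λ : ℕ) * (Λ * h) : ℝ)
        = (⌊s / h⌋₊ + (i - ⌊s / h⌋₊) / Λ * Λ : ℕ) * h := by push_cast; ring
      _ ≤ i * h := by gcongr
      _ ≤ clip s t (i * h) := (le_min (mul_lt_of_mem_activeCells hi).le le_rfl).trans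
          (le_max_right _ _)
  lt_right i _ := by
    have hΛr : (1 : ℝ) ≤ Λ := by exact_mod_cast hΛ
    have hdiv : i < ⌊s / h⌋₊ + ((i - ⌊s / h⌋₊) / Λ + 1) * Λ := by
      have := Nat.lt_mul_div_succ (i - ⌊s / h⌋₊) hΛ
      rw [mul_comm] at this
      omega
    refine max_lt ?_ ((min_le_right _ _).trans_lt ?_)
    · calc s < ⌊s / h⌋₊ * h + (0 + 1) * (1 * h) := by
            linarith [lt_floor_div_add_one_mul (s := s) hh]
        _ ≤ _ := by gcongr; positivity
    · calc (i : ℝ) * h < (⌊s / h⌋₊ + ((i - ⌊s / h⌋₊) / Λ + 1) * Λ : ℕ) * h := by gcongr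
        _ = _ := by push_cast; ring
  lt_two_pow i hi :=
    calc (i - ⌊s / h⌋₊) / Λ ≤ 2 ^ n :=
          (Nat.div_le_self _ _).trans (sub_floor_le_of_mem_activeCells hh hn hi)
      _ < 2 ^ (n + 1) := Nat.pow_lt_pow_succ one_lt_two
  card_le j := by
    have hsub : ((activeCells h N s t).filter fun i => (i - ⌊s / h⌋₊) / Λ = j) ⊆
        Finset.Ico (⌊s / h⌋₊ + j * Λ) (⌊s / h⌋₊ + j * Λ + Λ) := fun i hi => by
      obtain ⟨hi, hij⟩ := Finset.mem_filter.1 hi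
      have hlo := floor_le_of_mem_activeCells hi
      have hblk := (Nat.div_eq_iff hΛ).1 hij
      rw [Finset.mem_Ico]
      omega
    exact (Finset.card_le_card hsub).trans_eq (by rw [Nat.card_Ico, Nat.add_sub_cancel_left])

lemma clip_left_le_mid (hh : 0 ≤ h) (s t : ℝ) (i : ℕ) :
    clip s t (i * h) ≤ clip s t ((2 * i + 1 : ℕ) * (h / 2)) :=
  clip_mono s t (by push_cast; linarith)

lemma clip_mid_le_right (hh : 0 ≤ h) (s t : ℝ) (i : ℕ) :
    clip s t ((2 * i + 1 : ℕ) * (h / 2)) ≤ clip s t ((i + 1 : ℕ) * h) :=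
  clip_mono s t (by push_cast; linarith)

end ActiveCells

lemma IsAdaptedGerm.gridSum_half_sub_ae_eq {Ω V : Type*} {mΩ : MeasurableSpace Ω}
    [NormedAddCommGroup V] {P : Measure Ω} {𝓕 : Filtration ℝ mΩ} {T m : ℝ} {A : ℝ → ℝ → Ω → V}
    (hA : IsAdaptedGerm P 𝓕 T m A) {h : ℝ} (hh : 0 < h) (N : ℕ) {s t : ℝ} (hs : 0 ≤ s)
    (hst : s ≤ t) (ht : t ≤ T) :
    (fun ω => -∑ i ∈ activeCells h N s t, cellDelta A h s t i ω) =ᵐ[P]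
      fun ω => gridSum A (h / 2) (2 * N) s t ω - gridSum A h N s t ω := by
  filter_upwards [hA.germDelta_left hs (hst.trans ht) s,
    hA.germDelta_left (hs.trans hst) ht t] with ω hleft hright
  rw [gridSum_half_sub]
  refine congrArg Neg.neg (Finset.sum_subset (Finset.filter_subset _ _) fun i hi hi' => ?_)
  have hmid := clip_left_le_mid hh.le s t i
  have hmid' := clip_mid_le_right hh.le s t i
  rcases Nat.lt_or_ge i ⌊s / h⌋₊ with hlt | hge
  · have hr := clip_of_le_left (t := t) (succ_mul_le_of_lt_floor_div hh hs hlt)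
    rw [hr] at hmid'
    have hm := le_antisymm hmid' (le_clip _ _ _)
    rw [hm] at hmid
    rw [cellDelta, hr, hm, le_antisymm hmid (le_clip _ _ _)]
    exact hleft
  · have hti : t ≤ i * h := not_lt.1 fun hit => hi' (Finset.mem_filter.2 ⟨hi, hge, hit⟩)
    have hl := clip_of_right_le hst hti
    rw [hl] at hmid
    have hm := le_antisymm (clip_le hst _) hmid
    rw [hm] at hmid'
    rw [cellDelta, hl, hm, le_antisymm (clip_le hst _) hmid']
    exact hright

/-- The standing assumptions on the increments `δA` over intervals in `[s, T]`, with constants `g₁`,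
`g₂`, `g₃`. -/
structure HasGermBound {Ω V : Type*} {mΩ : MeasurableSpace Ω} [NormedAddCommGroup V]
    [NormedSpace ℝ V] [CompleteSpace V] (P : Measure Ω) (𝓕 : Filtration ℝ mΩ)
    (T m M α β₁ β₂ β₃ γ γ' : ℝ) (A : ℝ → ℝ → Ω → V) (s g₁ g₂ g₃ : ℝ) : Prop where
  lag_nonneg : 0 ≤ M
  g₁_nonneg : 0 ≤ g₁
  g₂_nonneg : 0 ≤ g₂
  g₃_nonneg : 0 ≤ g₃
  cond : ∀ t₀ t₁ t₂ t₃, 0 ≤ t₀ → t₀ < t₁ → s ≤ t₁ → t₁ ≤ t₂ → t₂ ≤ t₃ → t₃ ≤ T →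
    M * (t₃ - t₁) ≤ t₁ - t₀ → LpBound P m (P[germDelta A t₁ t₂ t₃ | 𝓕 t₀])
      (g₁ * t₁ ^ (-γ) * (t₁ - t₀) ^ (-α) * (t₃ - t₁) ^ β₁)
  weighted : ∀ t₁ t₂ t₃, 0 < t₁ → s ≤ t₁ → t₁ ≤ t₂ → t₂ ≤ t₃ → t₃ ≤ T →
    LpBound P m (germDelta A t₁ t₂ t₃) (g₂ * t₁ ^ (-γ') * (t₃ - t₁) ^ β₂)
  plain : ∀ t₁ t₂ t₃, s ≤ t₁ → t₁ ≤ t₂ → t₂ ≤ t₃ → t₃ ≤ T →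
    LpBound P m (germDelta A t₁ t₂ t₃) (g₃ * (t₃ - t₁) ^ β₃)

/-- The conditions on the exponents in the singular stochastic sewing lemma. -/
structure SewingExponents (α β₁ β₂ β₃ γ γ' : ℝ) : Prop where
  α_nonneg : 0 ≤ α
  one_lt_β₁ : 1 < β₁
  half_lt_β₂ : 1 / 2 < β₂
  half_lt_β₁_sub_α : 1 / 2 < β₁ - α
  β₃_pos : 0 < β₃
  γ_nonneg : 0 ≤ γ
  γ_lt_half : γ < 1 / 2
  γ'_nonneg : 0 ≤ γ'
  γ'_lt_half : γ' < 1 / 2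

namespace HasGermBound

variable {Ω : Type u} {mΩ : MeasurableSpace Ω} {P : Measure Ω} {𝓕 : Filtration ℝ mΩ}
  {T m M α β₁ β₂ β₃ γ γ' s g₁ g₂ g₃ h t : ℝ}

section General

variable {V : Type*} [NormedAddCommGroup V] [NormedSpace ℝ V] [CompleteSpace V]
  {A : ℝ → ℝ → Ω → V}

lemma cellBound_germDelta (hA : IsAdaptedGerm P 𝓕 T m A)
    (hB : HasGermBound P 𝓕 T m M α β₁ β₂ β₃ γ γ' A s g₁ g₂ g₃) (hβ₁ : 0 ≤ β₁) (hβ₂ : 0 ≤ β₂)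
    (hβ₃ : 0 ≤ β₃) (hs : 0 ≤ s) {l c r : ℝ} (hsl : s ≤ l) (hlc : l ≤ c) (hcr : c ≤ r)
    (hr : r ≤ T) (hrh : r ≤ l + h) :
    CellBound P 𝓕 m M α γ γ' (g₁ * h ^ β₁) 0 (g₂ * h ^ β₂) (g₃ * h ^ β₃) h l
      (germDelta A l c r) := by
  have hw : r - l ≤ h := by linarith
  have hw₀ : 0 ≤ r - l := by linarith
  have := hB.g₁_nonneg
  have := hB.g₂_nonneg
  have := hB.g₃_nonneg
  refine ⟨(hA.stronglyMeasurable_germDelta (hs.trans hsl) hlc hcr hr).mono (𝓕.mono hrh),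
    (hB.plain l c r hsl hlc hcr hr).mono (by gcongr), fun hl => ?_, fun v hv hvl hlag => ?_⟩
  · refine (hB.weighted l c r hl hsl hlc hcr hr).mono ?_
    calc g₂ * l ^ (-γ') * (r - l) ^ β₂ ≤ g₂ * l ^ (-γ') * h ^ β₂ := by gcongr
      _ = _ := by ring
  · have hlag' : M * (r - l) ≤ l - v := (mul_le_mul_of_nonneg_left hw hB.lag_nonneg).trans hlag
    refine (hB.cond v l c r hv hvl hsl hlc hcr hr hlag').mono ?_
    have : 0 ≤ l := hv.trans hvl.le
    have : 0 ≤ l - v := sub_nonneg.2 hvl.le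
    calc g₁ * l ^ (-γ) * (l - v) ^ (-α) * (r - l) ^ β₁
        ≤ g₁ * l ^ (-γ) * (l - v) ^ (-α) * h ^ β₁ := by gcongr
      _ = _ := by ring

lemma lpBound_condExp_cellDelta (hB : HasGermBound P 𝓕 T m M α β₁ β₂ β₃ γ γ' A s g₁ g₂ g₃)
    (hα : 0 ≤ α) (hγ : 0 ≤ γ) (hβ₁ : 0 ≤ β₁) (hh : 0 < h) {t₀ : ℝ} (ht₀ : 0 ≤ t₀) (hts : t₀ < s)
    (hst : s ≤ t) (ht : t ≤ T) (hlag : M * (t - s) ≤ s - t₀) (i : ℕ) :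
    LpBound P m (P[cellDelta A h s t i | 𝓕 t₀])
      (g₁ * s ^ (-γ) * (s - t₀) ^ (-α) * h ^ β₁) := by
  have hs : 0 < s := ht₀.trans_lt hts
  have hst₀ : 0 < s - t₀ := sub_pos.2 hts
  have hlm := clip_left_le_mid hh.le s t i
  have hmr := clip_mid_le_right hh.le s t i
  have hwidth := clip_succ_le hh.le s t i
  unfold cellDelta
  set l := clip s t (i * h)
  set r := clip s t ((i + 1 : ℕ) * h)
  have hsl : s ≤ l := le_clip _ _ _
  have hrt : r ≤ t := clip_le hst _
  have hlag' : M * (r - l) ≤ l - t₀ := by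
    have := mul_le_mul_of_nonneg_left (by linarith : r - l ≤ t - s) hB.lag_nonneg
    linarith
  refine (hB.cond t₀ l _ r ht₀ (hts.trans_le hsl) hsl hlm hmr (hrt.trans ht) hlag').mono ?_
  have hlγ : l ^ (-γ) ≤ s ^ (-γ) := Real.rpow_le_rpow_of_nonpos hs hsl (by linarith)
  have hlα : (l - t₀) ^ (-α) ≤ (s - t₀) ^ (-α) :=
    Real.rpow_le_rpow_of_nonpos hst₀ (by linarith) (by linarith)
  have hrl : (r - l) ^ β₁ ≤ h ^ β₁ :=
    Real.rpow_le_rpow (by linarith) (by linarith) hβ₁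
  have := hB.g₁_nonneg
  have : 0 ≤ r - l := by linarith
  have : 0 ≤ l - t₀ := by linarith
  gcongr

lemma lpBound_condExp_gridSum_sub [IsFiniteMeasure P] (hm : 1 ≤ m) (hA : IsAdaptedGerm P 𝓕 T m A)
    (hB : HasGermBound P 𝓕 T m M α β₁ β₂ β₃ γ γ' A s g₁ g₂ g₃)
    (hα : 0 ≤ α) (hγ : 0 ≤ γ) (hβ₁ : 0 ≤ β₁) (hh : 0 < h) (N : ℕ) {n : ℕ} {t₀ : ℝ} (ht₀ : 0 ≤ t₀)
    (hts : t₀ < s) (hst : s ≤ t) (ht : t ≤ T) (hn : t - s ≤ 2 ^ n * h)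
    (hlag : M * (t - s) ≤ s - t₀) :
    LpBound P m (P[fun ω => gridSum A (h / 2) (2 * N) s t ω - gridSum A h N s t ω | 𝓕 t₀])
      (2 ^ (n + 1) * (g₁ * s ^ (-γ) * (s - t₀) ^ (-α) * h ^ β₁)) := by
  have hs : 0 < s := ht₀.trans_lt hts
  have hcell := hB.lpBound_condExp_cellDelta hα hγ hβ₁ hh ht₀ hts hst ht hlag
  have hInt (i : ℕ) : Integrable (cellDelta A h s t i) P :=
    (hA.memLp_germDelta (hs.le.trans (le_clip _ _ _)) (clip_left_le_mid hh.le s t i)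
      (clip_mid_le_right hh.le s t i) ((clip_le hst _).trans ht)).integrable
        (ENNReal.one_le_ofReal.2 hm)
  have hsum := LpBound.sum_card_le hm (hcell 0).nonneg (card_activeCells_le (N := N) hh hn)
    fun i _ => hcell i
  refine (hsum.neg.congr ?_).mono (le_of_eq (by push_cast; rfl))
  filter_upwards [sum_condExp_ae_eq (𝓗 := 𝓕 t₀) fun i (_ : i ∈ activeCells h N s t) => hInt i,
    condExp_neg (μ := P) (fun ω => ∑ i ∈ activeCells h N s t, cellDelta A h s t i ω) (𝓕 t₀),
    condExp_congr_ae (m := 𝓕 t₀) (hA.gridSum_half_sub_ae_eq hh N hs.le hst ht)]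
    with ω hsum hneg hcongr
  rw [hsum, ← hcongr]
  exact hneg.symm

end General

lemma lpBound_gridSum_sub [IsProbabilityMeasure P] {d : ℕ}
    {A : ℝ → ℝ → Ω → EuclideanSpace ℝ (Fin d)} {κ : ℝ} (hm : 2 ≤ m)
    (hκ : IsBDGConstant.{u} m d κ) (hκ₁ : 1 ≤ κ) (hA : IsAdaptedGerm P 𝓕 T m A)
    (hB : HasGermBound P 𝓕 T m M α β₁ β₂ β₃ γ γ' A s g₁ g₂ g₃)
    (hexp : SewingExponents α β₁ β₂ β₃ γ γ') {Λ : ℕ} (hΛ₀ : 0 < Λ) (hΛ : M ≤ Λ) (hh : 0 < h)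
    (N : ℕ) {n : ℕ} (hs : 0 ≤ s) (hst : s ≤ t) (ht : t ≤ T) (hn : t - s ≤ 2 ^ n * h) :
    LpBound P m (fun ω => gridSum A (h / 2) (2 * N) s t ω - gridSum A h N s t ω)
      (Λ * (g₃ * h ^ β₃) + κ * (Λ * (6 * (g₂ * h ^ β₂ * h ^ (-γ') * blockWeight γ' (n + 1))
        + g₁ * h ^ β₁ * h ^ (-γ) * h ^ (-α) * blockGrowth α γ (n + 1)))) := by
  have hβ₁ : 0 ≤ β₁ := zero_le_one.trans hexp.one_lt_β₁.le
  have hβ₂ : 0 ≤ β₂ := one_half_pos.le.trans hexp.half_lt_β₂.le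
  have hcell : ∀ i ∈ activeCells h N s t, CellBound P 𝓕 m M α γ γ' (g₁ * h ^ β₁) 0 (g₂ * h ^ β₂)
      (g₃ * h ^ β₃) h (clip s t (i * h)) (cellDelta A h s t i) := fun i _ =>
    hB.cellBound_germDelta hA hβ₁ hβ₂ hexp.β₃_pos.le hs (le_clip _ _ _)
      (clip_left_le_mid hh.le s t i) (clip_mid_le_right hh.le s t i) ((clip_le hst _).trans ht)
      (clip_succ_le hh.le s t i)
  have hΛr : (1 : ℝ) ≤ Λ := by exact_mod_cast hΛ₀
  have := hB.g₁_nonneg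
  have := hB.g₂_nonneg
  have := hB.g₃_nonneg
  have hsum := (blockCover_activeCells hh hn N hΛ₀).lpBound_sum hm hκ hκ₁ hcell
    hexp.α_nonneg hexp.γ_nonneg hexp.γ_lt_half hexp.γ'_nonneg hexp.γ'_lt_half (by positivity) le_rfl
    (by positivity) (by positivity) (by positivity) hh (le_mul_of_one_le_left hh.le hΛr)
    (mul_le_mul_of_nonneg_right hΛ hh.le)
  exact (hsum.neg.congr (hA.gridSum_half_sub_ae_eq hh N hs hst ht)).mono (le_of_eq (by ring))

end HasGermBound

end Levels

section Existence

section LevelBound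

variable {α β₁ β₂ β₃ γ γ' : ℝ}

/-- The bound for the difference of the Riemann sums over the grids of widths `h / 2 ^ (k + 1)` and
`h / 2 ^ k`. -/
noncomputable def levelBound (κ : ℝ) (Λ : ℕ) (α β₁ β₂ β₃ γ γ' g₁ g₂ g₃ h : ℝ) (k : ℕ) : ℝ :=
  Λ * (g₃ * h ^ β₃) * ((2 : ℝ) ^ (-β₃)) ^ k
  + (κ * (6 * Λ * (g₂ * h ^ (β₂ - γ'))) *
      (((2 : ℝ) ^ (-(β₂ - γ'))) ^ k * blockWeight γ' (k + 1))
    + κ * (Λ * (g₁ * h ^ (β₁ - α - γ))) *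
      (((2 : ℝ) ^ (-(β₁ - α - γ))) ^ k * blockGrowth α γ (k + 1)))

lemma hasSum_levelBound (κ : ℝ) (Λ : ℕ) (hexp : SewingExponents α β₁ β₂ β₃ γ γ')
    (g₁ g₂ g₃ h : ℝ) :
    HasSum (levelBound κ Λ α β₁ β₂ β₃ γ γ' g₁ g₂ g₃ h)
      (Λ * (g₃ * h ^ β₃) * geomSum β₃
        + (κ * (6 * Λ * (g₂ * h ^ (β₂ - γ'))) * weightSum β₂ γ'
          + κ * (Λ * (g₁ * h ^ (β₁ - α - γ))) * growthSum α β₁ γ)) := by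
  have hplain := (summable_two_rpow_neg_pow hexp.β₃_pos).hasSum
  have hmart := (summable_pow_mul_add (by positivity)
    (summable_blockWeight (γ := γ') hexp.half_lt_β₂) 1).hasSum
  have hcond := (summable_pow_mul_add (by positivity)
    (summable_blockGrowth hexp.one_lt_β₁ hexp.half_lt_β₁_sub_α hexp.γ_lt_half) 1).hasSum
  exact (hplain.mul_left _).add ((hmart.mul_left _).add (hcond.mul_left _))

/-- The constant for the conditional expectation part of the sewing bound. -/
noncomputable def condConst (Λ : ℕ) (α β γ : ℝ) : ℝ :=
  Λ * 2 ^ (β - α - γ) * growthSum α β γ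

/-- The constant for the martingale part of the sewing bound. -/
noncomputable def martConst (Λ : ℕ) (β γ : ℝ) : ℝ := 6 * Λ * 2 ^ (β - γ) * weightSum β γ

/-- The constant for the unweighted part of the sewing bound. -/
noncomputable def plainConst (Λ : ℕ) (β : ℝ) : ℝ := 1 + Λ * 2 ^ β * geomSum β

/-- The constant in the bound of the conditional expectation. -/
noncomputable def pastConst (β : ℝ) : ℝ := 1 + 2 * 2 ^ β * geomSum (β - 1)

lemma condConst_nonneg (Λ : ℕ) (α β γ : ℝ) : 0 ≤ condConst Λ α β γ := by
  have := growthSum_nonneg α β γ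
  unfold condConst
  positivity

lemma martConst_nonneg (Λ : ℕ) (β γ : ℝ) : 0 ≤ martConst Λ β γ := by
  have := weightSum_nonneg β γ
  unfold martConst
  positivity

lemma plainConst_nonneg (Λ : ℕ) (β : ℝ) : 0 ≤ plainConst Λ β := by
  have := geomSum_nonneg β
  unfold plainConst
  positivity

lemma pastConst_nonneg (β : ℝ) : 0 ≤ pastConst β := by
  have := geomSum_nonneg (β - 1)
  unfold pastConst
  positivity

/-- The bound for the difference of the sewing and the germ over an interval of length `δ`. -/
noncomputable def sewingBound (κ : ℝ) (Λ : ℕ) (α β₁ β₂ β₃ γ γ' g₁ g₂ g₃ δ : ℝ) : ℝ :=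
  κ * (condConst Λ α β₁ γ * g₁ * δ ^ (β₁ - α - γ) + martConst Λ β₂ γ' * g₂ * δ ^ (β₂ - γ')
    + plainConst Λ β₃ * g₃ * δ ^ β₃)

lemma sum_levelBound_le {κ : ℝ} (hκ : 1 ≤ κ) (Λ : ℕ) (hexp : SewingExponents α β₁ β₂ β₃ γ γ')
    {g₁ g₂ g₃ h δ : ℝ} (hg₁ : 0 ≤ g₁) (hg₂ : 0 ≤ g₂) (hg₃ : 0 ≤ g₃) (hh : 0 < h) (hδ : 0 < δ)
    (hhδ : h ≤ 2 * δ) (hlev : ∀ k, 0 ≤ levelBound κ Λ α β₁ β₂ β₃ γ γ' g₁ g₂ g₃ h k) (k : ℕ) :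
    g₃ * δ ^ β₃ + ∑ i ∈ Finset.range k, levelBound κ Λ α β₁ β₂ β₃ γ γ' g₁ g₂ g₃ h i ≤
      sewingBound κ Λ α β₁ β₂ β₃ γ γ' g₁ g₂ g₃ δ := by
  have := hexp.half_lt_β₁_sub_α
  have := hexp.half_lt_β₂
  have := hexp.γ_lt_half
  have := hexp.γ'_lt_half
  have hsum := sum_le_hasSum (Finset.range k) (fun i _ => hlev i)
    (hasSum_levelBound κ Λ hexp g₁ g₂ g₃ h)
  have hpow (e : ℝ) (he : 0 ≤ e) : h ^ e ≤ 2 ^ e * δ ^ e := by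
    rw [← Real.mul_rpow two_pos.le hδ.le]
    exact Real.rpow_le_rpow hh.le hhδ he
  have hpow₁ := hpow (β₁ - α - γ) (by linarith)
  have hpow₂ := hpow (β₂ - γ') (by linarith)
  have hpow₃ := hpow β₃ hexp.β₃_pos.le
  have := growthSum_nonneg α β₁ γ
  have := weightSum_nonneg β₂ γ'
  have := geomSum_nonneg β₃
  have := plainConst_nonneg Λ β₃
  calc _ ≤ g₃ * δ ^ β₃ + (Λ * (g₃ * (2 ^ β₃ * δ ^ β₃)) * geomSum β₃
        + (κ * (6 * Λ * (g₂ * (2 ^ (β₂ - γ') * δ ^ (β₂ - γ')))) * weightSum β₂ γ'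
          + κ * (Λ * (g₁ * (2 ^ (β₁ - α - γ) * δ ^ (β₁ - α - γ)))) * growthSum α β₁ γ)) := by
        grw [hsum]
        gcongr
    _ = κ * (condConst Λ α β₁ γ * g₁ * δ ^ (β₁ - α - γ)
        + martConst Λ β₂ γ' * g₂ * δ ^ (β₂ - γ')) + 1 * (plainConst Λ β₃ * g₃ * δ ^ β₃) := by
        simp only [condConst, martConst, plainConst]
        ring
    _ ≤ κ * (condConst Λ α β₁ γ * g₁ * δ ^ (β₁ - α - γ)
        + martConst Λ β₂ γ' * g₂ * δ ^ (β₂ - γ')) + κ * (plainConst Λ β₃ * g₃ * δ ^ β₃) := by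
        gcongr
    _ = _ := by rw [sewingBound]; ring

lemma exists_two_pow_scale {H x : ℝ} (hx : 0 < x) (hxH : x ≤ H) :
    ∃ n : ℕ, x ≤ H / 2 ^ n ∧ H / 2 ^ n ≤ 2 * x := by
  obtain ⟨n, hle, hlt⟩ := exists_nat_pow_near ((one_le_div hx).2 hxH) (one_lt_two (α := ℝ))
  refine ⟨n, ?_, ?_⟩
  · rw [le_div_iff₀ (by positivity)]
    rw [le_div_iff₀ hx] at hle
    linarith
  · rw [div_le_iff₀ (by positivity)]
    rw [div_lt_iff₀ hx, pow_succ] at hlt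
    linarith

end LevelBound

lemma LpBound.sub_of_succ_sub {Ω V : Type*} {mΩ : MeasurableSpace Ω} [NormedAddCommGroup V]
    {P : Measure Ω} {m a : ℝ} (hm : 1 ≤ m) {F : ℕ → Ω → V} {f : Ω → V} {b : ℕ → ℝ}
    (hzero : LpBound P m (fun ω => F 0 ω - f ω) a)
    (hsucc : ∀ k, LpBound P m (fun ω => F (k + 1) ω - F k ω) (b k)) (k : ℕ) :
    LpBound P m (fun ω => F k ω - f ω) (a + ∑ i ∈ Finset.range k, b i) := by
  induction k with
  | zero => simpa only [Finset.range_zero, Finset.sum_empty, add_zero] using hzero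
  | succ k ih =>
    refine ((ih.add hm (hsucc k)).congr (ae_of_all _ fun ω => ?_)).mono (le_of_eq ?_)
    · exact sub_add_sub_cancel' _ _ _
    · rw [Finset.sum_range_succ, add_assoc]

lemma condExp_fun_sub {Ω V : Type*} {_ : MeasurableSpace Ω} {P : Measure Ω}
    {𝓗 : MeasurableSpace Ω} [NormedAddCommGroup V] [NormedSpace ℝ V] [CompleteSpace V]
    {f g : Ω → V} (hf : Integrable f P) (hg : Integrable g P) :
    P[fun ω => f ω - g ω | 𝓗] =ᵐ[P] fun ω => (P[f | 𝓗]) ω - (P[g | 𝓗]) ω :=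
  condExp_sub hf hg 𝓗

/-- The Riemann sum over the partition of `[s, t]` induced by the dyadic grid `H 2⁻ⁿ ℕ`, where
`t ≤ H`. -/
noncomputable def dyadicSum {Ω E : Type*} [AddCommMonoid E] (A : ℝ → ℝ → Ω → E) (H : ℝ) (n : ℕ)
    (s t : ℝ) : Ω → E :=
  gridSum A (H / 2 ^ n) (2 ^ n) s t

lemma dyadicSum_succ {Ω E : Type*} [AddCommMonoid E] (A : ℝ → ℝ → Ω → E) (H : ℝ) (n : ℕ)
    (s t : ℝ) : dyadicSum A H (n + 1) s t = gridSum A (H / 2 ^ n / 2) (2 * 2 ^ n) s t := by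
  rw [dyadicSum, pow_succ, pow_succ, div_div, mul_comm (2 ^ n : ℝ) 2, mul_comm (2 ^ n : ℕ) 2]

namespace IsAdaptedGerm

variable {Ω V : Type*} {mΩ : MeasurableSpace Ω} [NormedAddCommGroup V] {P : Measure Ω}
  {𝓕 : Filtration ℝ mΩ} {T m H s t : ℝ} {A : ℝ → ℝ → Ω → V}

lemma memLp_dyadicSum (hA : IsAdaptedGerm P 𝓕 T m A) (hH : 0 ≤ H) (n : ℕ) (hs : 0 ≤ s)
    (hst : s ≤ t) (ht : t ≤ T) : MemLp (dyadicSum A H n s t) (ENNReal.ofReal m) P :=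
  hA.memLp_gridSum (by positivity) _ hs hst ht

lemma stronglyMeasurable_dyadicSum (hA : IsAdaptedGerm P 𝓕 T m A) (hH : 0 ≤ H) (n : ℕ)
    (hs : 0 ≤ s) (hst : s ≤ t) (ht : t ≤ T) : StronglyMeasurable[𝓕 t] (dyadicSum A H n s t) :=
  hA.stronglyMeasurable_gridSum (by positivity) _ hs hst ht

lemma exists_dyadicSum_sub_ae_eq (hA : IsAdaptedGerm P 𝓕 T m A) (hH : 0 < H) {n : ℕ} (hs : 0 ≤ s)
    (hst : s ≤ t) (ht : t ≤ T) (hTH : T ≤ H) (hn : t - s ≤ H / 2 ^ n) :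
    ∃ r, s ≤ r ∧ r ≤ t ∧
      (fun ω => dyadicSum A H n s t ω - A s t ω) =ᵐ[P] fun ω => -germDelta A s r t ω := by
  refine ⟨_, le_clip s t _, clip_le hst ((⌊s / (H / 2 ^ n)⌋₊ + 1 : ℕ) * (H / 2 ^ n)), ?_⟩
  have hN : t ≤ (2 ^ n : ℕ) * (H / 2 ^ n) := by
    push_cast
    rw [mul_div_cancel₀ _ (by positivity)]
    linarith
  filter_upwards [hA.diag s hs (hst.trans ht), hA.diag t (hs.trans hst) ht] with ω hss htt
  rw [dyadicSum, gridSum_eq_sub_germDelta hss htt (by positivity) hs hst hN hn, sub_sub_cancel_left]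

end IsAdaptedGerm

namespace HasGermBound

variable {Ω : Type u} {mΩ : MeasurableSpace Ω} {P : Measure Ω} {𝓕 : Filtration ℝ mΩ}
  {T m M α β₁ β₂ β₃ γ γ' s g₁ g₂ g₃ H t : ℝ}

section General

variable {V : Type*} [NormedAddCommGroup V] [NormedSpace ℝ V] [CompleteSpace V]
  {A : ℝ → ℝ → Ω → V}

lemma lpBound_condExp_dyadicSum_succ_sub [IsFiniteMeasure P] (hm : 1 ≤ m)
    (hA : IsAdaptedGerm P 𝓕 T m A) (hB : HasGermBound P 𝓕 T m M α β₁ β₂ β₃ γ γ' A s g₁ g₂ g₃)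
    (hα : 0 ≤ α) (hγ : 0 ≤ γ) (hβ₁ : 0 ≤ β₁) (hH : 0 < H) (n k : ℕ) {t₀ : ℝ}
    (ht₀ : 0 ≤ t₀) (hts : t₀ < s) (hst : s ≤ t) (ht : t ≤ T) (hn : t - s ≤ H / 2 ^ n)
    (hlag : M * (t - s) ≤ s - t₀) :
    LpBound P m (P[fun ω => dyadicSum A H (n + k + 1) s t ω - dyadicSum A H (n + k) s t ω | 𝓕 t₀])
      (g₁ * s ^ (-γ) * (s - t₀) ^ (-α) * (H / 2 ^ n) ^ β₁
        * (2 * ((2 : ℝ) ^ (-(β₁ - 1))) ^ k)) := by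
  have hscale : H / 2 ^ (n + k) = H / 2 ^ n / 2 ^ k := by rw [pow_add, div_div]
  have htwo : (2 : ℝ) ^ (-(β₁ - 1)) = 2 * 2 ^ (-β₁) := by
    rw [show -(β₁ - 1) = 1 + -β₁ by ring, Real.rpow_add two_pos, Real.rpow_one]
  rw [dyadicSum_succ]
  refine (hB.lpBound_condExp_gridSum_sub hm hA hα hγ hβ₁ (by positivity) (2 ^ (n + k)) (n := k)
    ht₀ hts hst ht (hn.trans_eq ?_) hlag).mono (le_of_eq ?_)
  · rw [hscale, mul_div_cancel₀ _ (by positivity)]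
  · rw [hscale, div_two_pow_rpow (by positivity), htwo, mul_pow, pow_succ]
    ring

theorem eventually_lpBound_condExp_dyadicSum [IsFiniteMeasure P] (hm : 1 ≤ m)
    (hA : IsAdaptedGerm P 𝓕 T m A) (hB : HasGermBound P 𝓕 T m M α β₁ β₂ β₃ γ γ' A s g₁ g₂ g₃)
    (hα : 0 ≤ α) (hγ : 0 ≤ γ) (hβ₁ : 1 < β₁) (hTH : T ≤ H) {t₀ : ℝ} (ht₀ : 0 ≤ t₀) (hts₀ : t₀ < s)
    (hst : s < t) (ht : t ≤ T) (hlag : M * (t - s) ≤ s - t₀) :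
    ∀ᶠ n in atTop, LpBound P m (P[fun ω => dyadicSum A H n s t ω - A s t ω | 𝓕 t₀])
      (pastConst β₁ * g₁ * s ^ (-γ) * (s - t₀) ^ (-α) * (t - s) ^ β₁) := by
  have hs : 0 < s := ht₀.trans_lt hts₀
  have hts : 0 < t - s := sub_pos.2 hst
  have : 0 < s - t₀ := sub_pos.2 hts₀
  have hH : 0 < H := by linarith
  obtain ⟨n₀, hlo, hhi⟩ := exists_two_pow_scale (H := H) hts (by linarith)
  set w : ℝ := g₁ * s ^ (-γ) * (s - t₀) ^ (-α)
  have hw : 0 ≤ w := mul_nonneg (mul_nonneg hB.g₁_nonneg (by positivity)) (by positivity)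
  have hp : 1 ≤ ENNReal.ofReal m := ENNReal.one_le_ofReal.2 hm
  have hInt (n : ℕ) : Integrable (dyadicSum A H n s t) P :=
    (hA.memLp_dyadicSum hH.le n hs.le hst.le ht).integrable hp
  have hAint : Integrable (A s t) P := (hA.memLp s t hs.le hst.le ht).integrable hp
  have hzero : LpBound P m (P[fun ω => dyadicSum A H n₀ s t ω - A s t ω | 𝓕 t₀])
      (w * (t - s) ^ β₁) := by
    obtain ⟨r, hsr, hrt, hr⟩ := hA.exists_dyadicSum_sub_ae_eq hH hs.le hst.le ht hTH hlo
    exact (hB.cond t₀ s r t ht₀ hts₀ le_rfl hsr hrt ht hlag).neg.congr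
      ((condExp_neg _ _).symm.trans (condExp_congr_ae hr.symm))
  have hstep := LpBound.sub_of_succ_sub hm (F := fun k => P[dyadicSum A H (n₀ + k) s t | 𝓕 t₀])
    (hzero.congr (condExp_fun_sub (hInt n₀) hAint)) fun k =>
      (hB.lpBound_condExp_dyadicSum_succ_sub hm hA hα hγ (zero_le_one.trans hβ₁.le) hH n₀ k ht₀
        hts₀ hst.le ht hlo hlag).congr (condExp_fun_sub (hInt _) (hInt _))
  refine eventually_atTop.2 ⟨n₀, fun n hn => ?_⟩
  obtain ⟨k, rfl⟩ := Nat.exists_eq_add_of_le hn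
  refine ((hstep k).congr (condExp_fun_sub (hInt _) hAint).symm).mono ?_
  have hgeom : ∑ i ∈ Finset.range k, ((2 : ℝ) ^ (-(β₁ - 1))) ^ i ≤ geomSum (β₁ - 1) :=
    (summable_two_rpow_neg_pow (sub_pos.2 hβ₁)).sum_le_tsum _ fun i _ => by positivity
  have hpow : (H / 2 ^ n₀) ^ β₁ ≤ 2 ^ β₁ * (t - s) ^ β₁ := by
    rw [← Real.mul_rpow two_pos.le hts.le]
    exact Real.rpow_le_rpow (by positivity) hhi (by linarith)
  have := geomSum_nonneg (β₁ - 1)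
  rw [← Finset.mul_sum, ← Finset.mul_sum]
  calc _ ≤ w * (t - s) ^ β₁ + w * (2 ^ β₁ * (t - s) ^ β₁) * (2 * geomSum (β₁ - 1)) := by gcongr
    _ = pastConst β₁ * w * (t - s) ^ β₁ := by rw [pastConst]; ring
    _ = _ := by ring

end General

variable [IsProbabilityMeasure P] {d : ℕ} {A : ℝ → ℝ → Ω → EuclideanSpace ℝ (Fin d)} {κ : ℝ}

lemma lpBound_dyadicSum_succ_sub (hm : 2 ≤ m) (hκ : IsBDGConstant.{u} m d κ) (hκ₁ : 1 ≤ κ)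
    (hA : IsAdaptedGerm P 𝓕 T m A) (hB : HasGermBound P 𝓕 T m M α β₁ β₂ β₃ γ γ' A s g₁ g₂ g₃)
    (hexp : SewingExponents α β₁ β₂ β₃ γ γ') {Λ : ℕ} (hΛ₀ : 0 < Λ) (hΛ : M ≤ Λ) (hH : 0 < H)
    (n k : ℕ) (hs : 0 ≤ s) (hst : s ≤ t) (ht : t ≤ T) (hn : t - s ≤ H / 2 ^ n) :
    LpBound P m (fun ω => dyadicSum A H (n + k + 1) s t ω - dyadicSum A H (n + k) s t ω)
      (levelBound κ Λ α β₁ β₂ β₃ γ γ' g₁ g₂ g₃ (H / 2 ^ n) k) := by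
  have hh : 0 < H / 2 ^ n := by positivity
  have hscale : H / 2 ^ (n + k) = H / 2 ^ n / 2 ^ k := by rw [pow_add, div_div]
  rw [dyadicSum_succ]
  refine (hB.lpBound_gridSum_sub hm hκ hκ₁ hA hexp hΛ₀ hΛ (by positivity) (2 ^ (n + k)) (n := k)
    hs hst ht (hn.trans_eq ?_)).mono (le_of_eq ?_)
  · rw [hscale, mul_div_cancel₀ _ (by positivity)]
  rw [hscale]
  set h := H / 2 ^ n
  have hk : 0 < h / 2 ^ k := by positivity
  have hmart : (h / 2 ^ k) ^ β₂ * (h / 2 ^ k) ^ (-γ') =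
      h ^ (β₂ - γ') * ((2 : ℝ) ^ (-(β₂ - γ'))) ^ k := by
    rw [← Real.rpow_add hk, ← div_two_pow_rpow hh.le, sub_eq_add_neg]
  have hcond : (h / 2 ^ k) ^ β₁ * (h / 2 ^ k) ^ (-γ) * (h / 2 ^ k) ^ (-α) =
      h ^ (β₁ - α - γ) * ((2 : ℝ) ^ (-(β₁ - α - γ))) ^ k := by
    rw [← Real.rpow_add hk, ← Real.rpow_add hk, ← div_two_pow_rpow hh.le]
    congr 1
    ring
  rw [mul_assoc g₂, hmart, mul_assoc g₁, mul_assoc g₁, hcond, div_two_pow_rpow hh.le, levelBound]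
  ring

theorem eventually_lpBound_dyadicSum (hm : 2 ≤ m) (hκ : IsBDGConstant.{u} m d κ) (hκ₁ : 1 ≤ κ)
    (hA : IsAdaptedGerm P 𝓕 T m A) (hB : HasGermBound P 𝓕 T m M α β₁ β₂ β₃ γ γ' A s g₁ g₂ g₃)
    (hexp : SewingExponents α β₁ β₂ β₃ γ γ') {Λ : ℕ} (hΛ₀ : 0 < Λ) (hΛ : M ≤ Λ) (hTH : T ≤ H)
    (hs : 0 ≤ s) (hst : s < t) (ht : t ≤ T) :
    ∀ᶠ n in atTop, LpBound P m (fun ω => dyadicSum A H n s t ω - A s t ω)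
      (sewingBound κ Λ α β₁ β₂ β₃ γ γ' g₁ g₂ g₃ (t - s)) := by
  have hts : 0 < t - s := sub_pos.2 hst
  have hH : 0 < H := by linarith
  obtain ⟨n₀, hlo, hhi⟩ := exists_two_pow_scale (H := H) hts (by linarith)
  obtain ⟨r, hsr, hrt, hr⟩ := hA.exists_dyadicSum_sub_ae_eq hH hs hst.le ht hTH hlo
  have hlev (k : ℕ) := hB.lpBound_dyadicSum_succ_sub hm hκ hκ₁ hA hexp hΛ₀ hΛ hH n₀ k hs hst.le ht
    hlo
  have hstep := LpBound.sub_of_succ_sub (one_le_two.trans hm)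
    (F := fun k => dyadicSum A H (n₀ + k) s t)
    ((hB.plain s r t le_rfl hsr hrt ht).neg.congr hr.symm) hlev
  refine eventually_atTop.2 ⟨n₀, fun n hn => ?_⟩
  obtain ⟨k, rfl⟩ := Nat.exists_eq_add_of_le hn
  exact (hstep k).mono <| sum_levelBound_le hκ₁ Λ hexp hB.g₁_nonneg hB.g₂_nonneg hB.g₃_nonneg
    (by positivity) hts hhi (fun k => (hlev k).nonneg) k

end HasGermBound

/-- `I t` is an `L_m`-limit of the Riemann sums of `A` over `[0, t]` along the dyadic grids. -/
structure IsDyadicLimit {Ω V : Type*} {mΩ : MeasurableSpace Ω} [NormedAddCommGroup V]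
    (P : Measure Ω) (𝓕 : Filtration ℝ mΩ) (T m H : ℝ) (A : ℝ → ℝ → Ω → V) (I : ℝ → Ω → V) :
    Prop where
  adapted : ∀ t, 0 ≤ t → t ≤ T → StronglyMeasurable[𝓕 t] (I t)
  memLp : ∀ t, 0 ≤ t → t ≤ T → MemLp (I t) (ENNReal.ofReal m) P
  tendsto : ∀ t, 0 ≤ t → t ≤ T → Tendsto (fun n =>
    eLpNorm (fun ω => dyadicSum A H n 0 t ω - I t ω) (ENNReal.ofReal m) P) atTop (𝓝 0)

theorem HasGermBound.exists_isDyadicLimit {Ω : Type u} {mΩ : MeasurableSpace Ω} {P : Measure Ω}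
    [IsProbabilityMeasure P] {𝓕 : Filtration ℝ mΩ} {T m M α β₁ β₂ β₃ γ γ' g₁ g₂ g₃ H : ℝ} {d : ℕ}
    {A : ℝ → ℝ → Ω → EuclideanSpace ℝ (Fin d)} {κ : ℝ} (hm : 2 ≤ m)
    (hκ : IsBDGConstant.{u} m d κ) (hκ₁ : 1 ≤ κ) (hA : IsAdaptedGerm P 𝓕 T m A)
    (hB : HasGermBound P 𝓕 T m M α β₁ β₂ β₃ γ γ' A 0 g₁ g₂ g₃)
    (hexp : SewingExponents α β₁ β₂ β₃ γ γ') (hH : 0 < H) (hTH : T ≤ H) :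
    ∃ I, IsDyadicLimit P 𝓕 T m H A I := by
  have hlim (t : ℝ) : ∃ f : Ω → EuclideanSpace ℝ (Fin d), 0 ≤ t → t ≤ T →
      StronglyMeasurable[𝓕 t] f ∧ MemLp f (ENNReal.ofReal m) P ∧
      Tendsto (fun n => eLpNorm (fun ω => dyadicSum A H n 0 t ω - f ω)
        (ENNReal.ofReal m) P) atTop (𝓝 0) := by
    by_cases ht : 0 ≤ t ∧ t ≤ T
    · have hΛ : M ≤ (⌈M⌉₊ + 1 : ℕ) := (Nat.le_ceil M).trans (by exact_mod_cast Nat.le_succ _)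
      obtain ⟨f, hf⟩ := exists_stronglyMeasurable_lp_limit (one_le_two.trans hm) (𝓕.le t)
        (fun n => hA.stronglyMeasurable_dyadicSum hH.le n le_rfl ht.1 ht.2)
        (fun n => hA.memLp_dyadicSum hH.le n le_rfl ht.1 ht.2)
        (hasSum_levelBound κ (⌈M⌉₊ + 1) hexp g₁ g₂ g₃ (H / 2 ^ 0)).summable fun n => by
          simpa only [zero_add] using hB.lpBound_dyadicSum_succ_sub hm hκ hκ₁ hA hexp
            (Nat.succ_pos _) hΛ hH 0 n le_rfl ht.1 ht.2
            (by rw [pow_zero, div_one, sub_zero]; exact ht.2.trans hTH)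
      exact ⟨f, fun _ _ => hf⟩
    · exact ⟨0, fun h₀ hT => absurd ⟨h₀, hT⟩ ht⟩
  choose I hI using hlim
  exact ⟨I, fun t h₀ hT => (hI t h₀ hT).1, fun t h₀ hT => (hI t h₀ hT).2.1,
    fun t h₀ hT => (hI t h₀ hT).2.2⟩

lemma tendsto_ofReal_mul_div_two_pow_rpow (c H : ℝ) {e : ℝ} (he : 0 < e) :
    Tendsto (fun n : ℕ => ENNReal.ofReal (c * (H / 2 ^ n) ^ e)) atTop (𝓝 0) := by
  have hlim : Tendsto (fun n : ℕ => c * (H / 2 ^ n) ^ e) atTop (𝓝 (c * (0 : ℝ) ^ e)) :=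
    ((tendsto_const_nhds.div_atTop (tendsto_pow_atTop_atTop_of_one_lt one_lt_two)).rpow_const
      (Or.inr he.le)).const_mul _
  rw [Real.zero_rpow he.ne', mul_zero] at hlim
  simpa only [ENNReal.ofReal_zero] using ENNReal.tendsto_ofReal hlim

theorem IsDyadicLimit.tendsto_dyadicSum_sub {Ω V : Type*} {mΩ : MeasurableSpace Ω}
    [NormedAddCommGroup V] [NormedSpace ℝ V] [CompleteSpace V] {P : Measure Ω}
    {𝓕 : Filtration ℝ mΩ} {T m M α β₁ β₂ β₃ γ γ' g₁ g₂ g₃ H : ℝ} {A : ℝ → ℝ → Ω → V}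
    {I : ℝ → Ω → V} (hm : 1 ≤ m) (hA : IsAdaptedGerm P 𝓕 T m A)
    (hB : HasGermBound P 𝓕 T m M α β₁ β₂ β₃ γ γ' A 0 g₁ g₂ g₃) (hβ₃ : 0 < β₃) (hTH : T < H)
    (hI : IsDyadicLimit P 𝓕 T m H A I) {s t : ℝ} (hs : 0 ≤ s) (hst : s ≤ t) (ht : t ≤ T) :
    Tendsto (fun n => eLpNorm (fun ω => dyadicSum A H n s t ω - A s t ω - (I t ω - I s ω - A s t ω))
      (ENNReal.ofReal m) P) atTop (𝓝 0) := by
  have hH : 0 < H := by linarith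
  have hp : 1 ≤ ENNReal.ofReal m := ENNReal.one_le_ofReal.2 hm
  have hmeas (n : ℕ) (v : ℝ) (hv : 0 ≤ v) (hvT : v ≤ T) :
      AEStronglyMeasurable (fun ω => dyadicSum A H n 0 v ω - I v ω) P :=
    ((hA.memLp_dyadicSum hH.le n le_rfl hv hvT).sub (hI.memLp v hv hvT)).1
  have hlim := ((hI.tendsto t (hs.trans hst) ht).add (hI.tendsto s hs (hst.trans ht))).add
    (tendsto_ofReal_mul_div_two_pow_rpow g₃ H hβ₃)
  rw [add_zero, add_zero] at hlim
  refine tendsto_of_tendsto_of_tendsto_of_le_of_le tendsto_const_nhds hlim (fun _ => bot_le)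
    fun n => ?_
  set h := H / 2 ^ n
  have hh : 0 < h := by positivity
  set a : ℝ := ⌊s / h⌋₊ * h
  set b := clip s t ((⌊s / h⌋₊ + 1 : ℕ) * h)
  have has : a ≤ s := floor_div_mul_le hh hs
  have hba : b ≤ a + h := max_le
    ((lt_floor_div_add_one_mul hh).le.trans_eq (by ring))
    ((min_le_right _ _).trans_eq (by push_cast; ring))
  have hδ : LpBound P m (germDelta A a s b) (g₃ * h ^ β₃) := by
    have := hB.g₃_nonneg
    have hsb : s ≤ b := le_clip _ _ _
    refine (hB.plain a s b (by positivity) has hsb ((clip_le hst _).trans ht)).mono ?_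
    have : 0 ≤ b - a := by linarith
    gcongr
    linarith
  have hN : t < (2 ^ n : ℕ) * h := by
    push_cast
    rw [mul_div_cancel₀ _ (by positivity)]
    linarith
  calc _ = eLpNorm (((fun ω => dyadicSum A H n 0 t ω - I t ω)
        - fun ω => dyadicSum A H n 0 s ω - I s ω) - germDelta A a s b) (ENNReal.ofReal m) P := by
        refine eLpNorm_congr_ae ?_
        filter_upwards [hA.diag s hs (hst.trans ht)] with ω hss
        rw [Pi.sub_apply, Pi.sub_apply, ← gridSum_sub_sub_eq_germDelta hss hh hs hst hN]
        simp only [dyadicSum, h]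
        abel
    _ ≤ _ := (eLpNorm_sub_le ((hmeas n t (hs.trans hst) ht).sub (hmeas n s hs (hst.trans ht)))
        hδ.aestronglyMeasurable hp).trans (add_le_add (eLpNorm_sub_le
          (hmeas n t (hs.trans hst) ht) (hmeas n s hs (hst.trans ht)) hp) hδ.le)

end Existence

section Convergence

lemma IsBDGConstant.mono {m : ℝ} {d : ℕ} {K K' : ℝ} (h : IsBDGConstant.{u} m d K) (hK : K ≤ K') :
    IsBDGConstant.{u} m d K' := by
  refine ⟨h.1.trans hK, fun Ω mΩ P hP 𝓖 X hX hXm h₀ N =>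
    (h.2 Ω mΩ P hP 𝓖 X hX hXm h₀ N).trans ?_⟩
  gcongr

lemma sum_fin_succ_sub_castSucc {V : Type*} [AddCommGroup V] :
    ∀ {n : ℕ} (f : Fin (n + 1) → V),
      ∑ i : Fin n, (f i.succ - f i.castSucc) = f (Fin.last n) - f 0
  | 0, f => by rw [Fin.sum_univ_zero]; exact (sub_self _).symm
  | n + 1, f => by rw [← Finset.Iic_top, Fin.sum_Iic_sub]; rfl

namespace IntervalPartition

variable {a b : ℝ}

lemma castSucc_lt_succ (π : IntervalPartition a b) (i : Fin π.n) :
    π.pt i.castSucc < π.pt i.succ := π.strictMono Fin.castSucc_lt_succ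

lemma left_le (π : IntervalPartition a b) (i : Fin (π.n + 1)) : a ≤ π.pt i :=
  π.left.ge.trans (π.strictMono.monotone (Fin.zero_le i))

lemma le_right (π : IntervalPartition a b) (i : Fin (π.n + 1)) : π.pt i ≤ b :=
  (π.strictMono.monotone (Fin.le_last i)).trans π.right.le

lemma sub_le_mesh (π : IntervalPartition a b) (i : Fin π.n) :
    π.pt i.succ - π.pt i.castSucc ≤ π.mesh :=
  le_ciSup (f := fun i : Fin π.n => π.pt i.succ - π.pt i.castSucc) (Set.finite_range _).bddAbove i

variable {τ : ℝ}

lemma strictMonoOn_floor_div (π : IntervalPartition 0 τ) {δ : ℝ} (hδ : 0 < δ)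
    {I : Finset (Fin π.n)} (hI : ∀ i ∈ I, δ ≤ π.pt i.succ - π.pt i.castSucc) :
    StrictMonoOn (fun i => ⌊π.pt i.castSucc / δ⌋₊) (I : Set (Fin π.n)) := by
  intro i hi j _ hij
  have hle : π.pt i.succ ≤ π.pt j.castSucc := π.strictMono.monotone (Fin.succ_le_castSucc_iff.2 hij)
  have hfloor := floor_div_mul_le hδ (π.left_le i.castSucc)
  have hlen := hI i hi
  rw [← Nat.add_one_le_iff, Nat.le_floor_iff (div_nonneg (π.left_le _) hδ.le), le_div_iff₀ hδ]
  push_cast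
  linarith

lemma blockCover (π : IntervalPartition 0 τ) {h : ℝ} (hh : 0 < h) {Λ K : ℕ} (hΛ : 0 < Λ)
    (hK : τ ≤ 2 ^ K * h) {I : Finset (Fin π.n)}
    (hI : ∀ i ∈ I, h ≤ 2 * (π.pt i.succ - π.pt i.castSucc)) :
    BlockCover I (fun i => π.pt i.castSucc) (fun i => ⌊π.pt i.castSucc / (Λ * h)⌋₊) 0 (Λ * h)
      (2 * Λ) K where
  left_le i _ := by
    rw [zero_add]
    exact floor_div_mul_le (by positivity) (π.left_le _)
  lt_right i _ := by
    rw [zero_add]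
    exact lt_floor_div_add_one_mul (by positivity)
  lt_two_pow i _ := by
    have hΛr : (1 : ℝ) ≤ Λ := by exact_mod_cast hΛ
    rw [Nat.floor_lt (div_nonneg (π.left_le _) (by positivity)), div_lt_iff₀ (by positivity)]
    push_cast
    calc π.pt i.castSucc < 2 ^ K * (1 * h) := by
          linarith [π.castSucc_lt_succ i, π.le_right i.succ]
      _ ≤ 2 ^ K * (Λ * h) := by gcongr
  card_le j := by
    have hδ : 0 < h / 2 := by positivity
    have hmaps : Set.MapsTo (fun i => ⌊π.pt (Fin.castSucc i) / (h / 2)⌋₊)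
        (↑(I.filter fun i => ⌊π.pt (Fin.castSucc i) / (Λ * h)⌋₊ = j) : Set (Fin π.n))
        (Finset.Ico (2 * Λ * j) (2 * Λ * (j + 1))) := fun i hi => by
      have hblk := (Finset.mem_filter.1 (Finset.mem_coe.1 hi)).2
      have hpos := π.left_le i.castSucc
      rw [Nat.floor_eq_iff (div_nonneg hpos (by positivity)), le_div_iff₀ (by positivity),
        div_lt_iff₀ (by positivity)] at hblk
      rw [Finset.mem_coe, Finset.mem_Ico, Nat.le_floor_iff (div_nonneg hpos hδ.le),
        Nat.floor_lt (div_nonneg hpos hδ.le), le_div_iff₀ hδ, div_lt_iff₀ hδ]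
      push_cast
      constructor <;> linarith
    have hinj := (π.strictMonoOn_floor_div hδ (I := I) fun i hi => by linarith [hI i hi]).injOn
    refine (Finset.card_le_card_of_injOn _ hmaps
      (hinj.mono (Finset.coe_subset.2 (Finset.filter_subset _ _)))).trans_eq ?_
    rw [Nat.card_Ico, mul_add, mul_one, Nat.add_sub_cancel_left]

/-- The partition of `[0, τ]` into `n + 1` intervals of equal length. -/
noncomputable def uniform (hτ : 0 < τ) (n : ℕ) : IntervalPartition 0 τ where
  n := n + 1
  pt i := (i : ℕ) * (τ / (n + 1))
  strictMono _ _ hij := mul_lt_mul_of_pos_right (Nat.cast_lt.2 hij) (by positivity)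
  left := by rw [Fin.val_zero, Nat.cast_zero, zero_mul]
  right := by
    rw [Fin.val_last]
    push_cast
    exact mul_div_cancel₀ _ (by positivity)

lemma mesh_uniform (hτ : 0 < τ) (n : ℕ) : (uniform hτ n).mesh = τ / (n + 1) := by
  have hlen (i : Fin (n + 1)) : ((i.succ : ℕ) : ℝ) * (τ / (n + 1)) -
      ((i.castSucc : ℕ) : ℝ) * (τ / (n + 1)) = τ / (n + 1) := by
    rw [Fin.val_succ, Fin.val_castSucc]
    push_cast
    ring
  exact (iSup_congr hlen).trans ciSup_const

lemma neBot_comap_mesh (hτ : 0 ≤ τ) : (comap (mesh (a := 0) (b := τ)) (𝓝 0)).NeBot := by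
  refine comap_neBot_iff.2 fun U hU => ?_
  rcases hτ.eq_or_lt with rfl | hτ
  · exact ⟨⟨0, fun _ => 0, Subsingleton.strictMono (α := Fin 1) _, rfl, rfl⟩,
      by rw [mesh, Real.iSup_of_isEmpty]; exact mem_of_mem_nhds hU⟩
  · have hlim : Tendsto (fun n : ℕ => τ / ((n : ℝ) + 1)) atTop (𝓝 0) :=
      tendsto_const_nhds.div_atTop (tendsto_atTop_add_const_right _ _ tendsto_natCast_atTop_atTop)
    obtain ⟨n, hn⟩ := (hlim.eventually hU).exists
    exact ⟨uniform hτ n, by rwa [mesh_uniform]⟩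

end IntervalPartition

/-- The bound for the contribution of the intervals of length about `2⁻ⁿ` of a partition. -/
noncomputable def classBound (κ : ℝ) (Λ K : ℕ) (α β₁ β₂ β₃ γ₁ γ₂ c₁ c₂ c₃ c₄ c₅ c₆ : ℝ) (n : ℕ) :
    ℝ :=
  2 * Λ * (c₄ * ((2 : ℝ) ^ (-(β₁ - α - γ₁))) ^ n + c₅ * ((2 : ℝ) ^ (-(β₂ - γ₂))) ^ n
    + c₆ * ((2 : ℝ) ^ (-β₃)) ^ n)
  + κ * (2 * Λ * (6 * (c₂ * (((2 : ℝ) ^ (-(β₁ - α - γ₁))) ^ n * blockWeight γ₁ (n + K))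
      + c₃ * (((2 : ℝ) ^ (-(β₂ - γ₂))) ^ n * blockWeight γ₂ (n + K)))
    + c₁ * (((2 : ℝ) ^ (-(β₁ - α - γ₁))) ^ n * blockGrowth α γ₁ (n + K))))

variable {T m κ M α β₁ β₂ β₃ γ₁ γ₂ : ℝ}

lemma summable_classBound (κ : ℝ) (Λ K : ℕ) (hexp : SewingExponents α β₁ β₂ β₃ γ₁ γ₂)
    (c₁ c₂ c₃ c₄ c₅ c₆ : ℝ) :
    Summable (classBound κ Λ K α β₁ β₂ β₃ γ₁ γ₂ c₁ c₂ c₃ c₄ c₅ c₆) := by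
  have hβ₁ := hexp.half_lt_β₁_sub_α
  have hβ₂ := hexp.half_lt_β₂
  have hγ₁ := hexp.γ_lt_half
  have hγ₂ := hexp.γ'_lt_half
  have hgeom₁ := summable_two_rpow_neg_pow (e := β₁ - α - γ₁) (by linarith)
  have hgeom₂ := summable_two_rpow_neg_pow (e := β₂ - γ₂) (by linarith)
  have hgeom₃ := summable_two_rpow_neg_pow hexp.β₃_pos
  have hweight₁ := summable_pow_mul_add (by positivity) (summable_blockWeight (γ := γ₁) hβ₁) K
  have hweight₂ := summable_pow_mul_add (by positivity) (summable_blockWeight (γ := γ₂) hβ₂) K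
  have hgrowth := summable_pow_mul_add (by positivity)
    (summable_blockGrowth hexp.one_lt_β₁ hβ₁ hγ₁) K
  have hplain := ((hgeom₁.mul_left c₄).add (hgeom₂.mul_left c₅)).add (hgeom₃.mul_left c₆)
  have hmart := (((hweight₁.mul_left c₂).add (hweight₂.mul_left c₃)).mul_left 6).add
    (hgrowth.mul_left c₁)
  exact (hplain.mul_left (2 * (Λ : ℝ))).add ((hmart.mul_left (2 * (Λ : ℝ))).mul_left κ)

namespace IsSingularSewing

variable {Ω : Type u} {mΩ : MeasurableSpace Ω} {P : Measure Ω}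
  {𝓕 : Filtration ℝ mΩ} {d : ℕ} {A : ℝ → ℝ → Ω → EuclideanSpace ℝ (Fin d)}
  {𝒜 : ℝ → Ω → EuclideanSpace ℝ (Fin d)}

lemma abs {C₁ C₂ C₃ C₄ C₅ C₆ : ℝ}
    (hS : IsSingularSewing P 𝓕 T m M α β₁ β₂ β₃ γ₁ γ₂ A C₁ C₂ C₃ C₄ C₅ C₆ 𝒜) :
    IsSingularSewing P 𝓕 T m M α β₁ β₂ β₃ γ₁ γ₂ A |C₁| |C₂| |C₃| |C₄| |C₅| |C₆| 𝒜 where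
  zero := hS.zero
  adapted := hS.adapted
  memLp := hS.memLp
  condExp_bound t₀ t₁ t₂ h₀ h₀₁ h₁₂ hT hlag := by
    refine (hS.condExp_bound t₀ t₁ t₂ h₀ h₀₁ h₁₂ hT hlag).trans (ENNReal.ofReal_le_ofReal ?_)
    have : 0 ≤ t₁ := h₀.trans h₀₁.le
    have : 0 ≤ t₁ - t₀ := sub_nonneg.2 h₀₁.le
    have : 0 ≤ t₂ - t₁ := sub_nonneg.2 h₁₂.le
    gcongr
    exact le_abs_self C₁
  weighted_bound t₁ t₂ h₁ h₁₂ hT := by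
    refine (hS.weighted_bound t₁ t₂ h₁ h₁₂ hT).trans (ENNReal.ofReal_le_ofReal ?_)
    have : 0 ≤ t₂ - t₁ := sub_nonneg.2 h₁₂.le
    gcongr
    exacts [le_abs_self C₂, le_abs_self C₃]
  continuity_bound t₁ t₂ h₁ h₁₂ hT := by
    refine (hS.continuity_bound t₁ t₂ h₁ h₁₂ hT).trans (ENNReal.ofReal_le_ofReal ?_)
    have : 0 ≤ t₂ - t₁ := sub_nonneg.2 h₁₂.le
    gcongr
    exacts [le_abs_self C₄, le_abs_self C₅, le_abs_self C₆]

variable {C₁ C₂ C₃ C₄ C₅ C₆ : ℝ≥0}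

lemma cellBound_sub (hA : IsAdaptedGerm P 𝓕 T m A)
    (hS : IsSingularSewing P 𝓕 T m M α β₁ β₂ β₃ γ₁ γ₂ A C₁ C₂ C₃ C₄ C₅ C₆ 𝒜)
    (hexp : SewingExponents α β₁ β₂ β₃ γ₁ γ₂) (hM : 0 ≤ M) {h s t : ℝ} (hs : 0 ≤ s) (hst : s < t)
    (ht : t ≤ T) (hh : t - s ≤ h) :
    CellBound P 𝓕 m M α γ₁ γ₂ (C₁ * h ^ β₁) (C₂ * h ^ (β₁ - α)) (C₃ * h ^ β₂)
      (C₄ * h ^ (β₁ - α - γ₁) + C₅ * h ^ (β₂ - γ₂) + C₆ * h ^ β₃) h s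
      (fun ω => 𝒜 t ω - 𝒜 s ω - A s t ω) := by
  have hβ₁ := hexp.one_lt_β₁
  have hαβ := hexp.half_lt_β₁_sub_α
  have hβ₂ := hexp.half_lt_β₂
  have hβ₃ := hexp.β₃_pos
  have hγ₁ := hexp.γ_lt_half
  have hγ₂ := hexp.γ'_lt_half
  have hst₀ : 0 ≤ t - s := sub_nonneg.2 hst.le
  have hh₀ : 0 ≤ h := hst₀.trans hh
  have hmeas : StronglyMeasurable[𝓕 t] (fun ω => 𝒜 t ω - 𝒜 s ω - A s t ω) :=
    ((hS.adapted t (hs.trans hst.le) ht).sub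
      ((hS.adapted s hs (hst.le.trans ht)).mono (𝓕.mono hst.le))).sub (hA.adapted s t hs hst.le ht)
  have hmeasP := (hmeas.mono (𝓕.le t)).aestronglyMeasurable (μ := P)
  refine ⟨hmeas.mono (𝓕.mono (by linarith)), ⟨hmeasP, by positivity, ?_⟩,
    fun hpos => ⟨hmeasP, by positivity, ?_⟩, fun v hv hvs hlag =>
      ⟨integrable_condExp.aestronglyMeasurable, ?_, ?_⟩⟩
  · refine (hS.continuity_bound s t hs hst ht).trans (ENNReal.ofReal_le_ofReal ?_)
    gcongr <;> linarith
  · refine (hS.weighted_bound s t hpos hst ht).trans (ENNReal.ofReal_le_ofReal ?_)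
    rw [mul_right_comm (C₂ : ℝ), mul_right_comm (C₃ : ℝ)]
    gcongr
  · have : 0 ≤ s - v := sub_nonneg.2 hvs.le
    positivity
  · have : 0 ≤ s - v := sub_nonneg.2 hvs.le
    refine (hS.condExp_bound v s t hv hvs hst ht
      ((mul_le_mul_of_nonneg_left hh hM).trans hlag)).trans (ENNReal.ofReal_le_ofReal ?_)
    calc C₁ * s ^ (-γ₁) * (s - v) ^ (-α) * (t - s) ^ β₁
        ≤ C₁ * s ^ (-γ₁) * (s - v) ^ (-α) * h ^ β₁ := by gcongr
      _ = C₁ * h ^ β₁ * s ^ (-γ₁) * (s - v) ^ (-α) := by ring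

variable [IsProbabilityMeasure P]

lemma lpBound_sum_class (hm : 2 ≤ m) (hκ : IsBDGConstant.{u} m d κ) (hκ₁ : 1 ≤ κ)
    (hA : IsAdaptedGerm P 𝓕 T m A)
    (hS : IsSingularSewing P 𝓕 T m M α β₁ β₂ β₃ γ₁ γ₂ A C₁ C₂ C₃ C₄ C₅ C₆ 𝒜)
    (hexp : SewingExponents α β₁ β₂ β₃ γ₁ γ₂) (hM : 0 ≤ M) {Λ K : ℕ} (hΛ₀ : 0 < Λ) (hΛ : M ≤ Λ)
    {τ : ℝ} (hτ : τ ≤ T) (hK : τ ≤ 2 ^ K) (π : IntervalPartition 0 τ) (n : ℕ)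
    {I : Finset (Fin π.n)} (hle : ∀ i ∈ I, π.pt i.succ - π.pt i.castSucc ≤ 1 / 2 ^ n)
    (hge : ∀ i ∈ I, 1 / 2 ^ n ≤ 2 * (π.pt i.succ - π.pt i.castSucc)) :
    LpBound P m (fun ω => ∑ i ∈ I, (𝒜 (π.pt i.succ) ω - 𝒜 (π.pt i.castSucc) ω
        - A (π.pt i.castSucc) (π.pt i.succ) ω))
      (classBound κ Λ K α β₁ β₂ β₃ γ₁ γ₂ C₁ C₂ C₃ C₄ C₅ C₆ n) := by
  set h : ℝ := 1 / 2 ^ n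
  have hh : 0 < h := by positivity
  have hΛr : (1 : ℝ) ≤ Λ := by exact_mod_cast hΛ₀
  have hKh : τ ≤ 2 ^ (n + K) * h :=
    hK.trans_eq (by rw [pow_add, mul_right_comm, mul_one_div_cancel (by positivity), one_mul])
  have hpow (e : ℝ) : h ^ e = ((2 : ℝ) ^ (-e)) ^ n := by
    rw [div_two_pow_rpow zero_le_one, Real.one_rpow, one_mul]
  refine ((π.blockCover hh hΛ₀ hKh hge).lpBound_sum hm hκ hκ₁ (fun i hi =>
    hS.cellBound_sub hA hexp hM (π.left_le _) (π.castSucc_lt_succ i) ((π.le_right _).trans hτ)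
      (hle i hi)) hexp.α_nonneg hexp.γ_nonneg hexp.γ_lt_half hexp.γ'_nonneg hexp.γ'_lt_half
    (by positivity) (by positivity) (by positivity) (by positivity) le_rfl hh
    (le_mul_of_one_le_left hh.le hΛr) (mul_le_mul_of_nonneg_right hΛ hh.le)).mono (le_of_eq ?_)
  have hx : C₂ * h ^ (β₁ - α) * h ^ (-γ₁) = C₂ * h ^ (β₁ - α - γ₁) := by
    rw [mul_assoc, ← Real.rpow_add hh, ← sub_eq_add_neg]
  have hy : C₃ * h ^ β₂ * h ^ (-γ₂) = C₃ * h ^ (β₂ - γ₂) := by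
    rw [mul_assoc, ← Real.rpow_add hh, ← sub_eq_add_neg]
  have hg : C₁ * h ^ β₁ * h ^ (-γ₁) * h ^ (-α) = C₁ * h ^ (β₁ - α - γ₁) := by
    rw [mul_assoc, mul_assoc, ← Real.rpow_add hh, ← Real.rpow_add hh]
    ring_nf
  rw [hx, hy, hg, classBound]
  simp only [hpow]
  push_cast
  ring

lemma exists_lpBound_riemannSum_sub (hm : 2 ≤ m) (hκ : IsBDGConstant.{u} m d κ) (hκ₁ : 1 ≤ κ)
    (hA : IsAdaptedGerm P 𝓕 T m A)
    (hS : IsSingularSewing P 𝓕 T m M α β₁ β₂ β₃ γ₁ γ₂ A C₁ C₂ C₃ C₄ C₅ C₆ 𝒜)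
    (hexp : SewingExponents α β₁ β₂ β₃ γ₁ γ₂) (hM : 0 ≤ M) {Λ K : ℕ} (hΛ₀ : 0 < Λ) (hΛ : M ≤ Λ)
    {τ : ℝ} (hτ : τ ≤ T) (hK : τ ≤ 2 ^ K) (π : IntervalPartition 0 τ) {k : ℕ}
    (hπ : π.mesh < 1 / 2 ^ (k + 1)) :
    ∃ S : Finset ℕ, (∀ n ∈ S, k ≤ n) ∧ LpBound P m (fun ω => riemannSum A π ω - 𝒜 τ ω)
      (∑ n ∈ S, classBound κ Λ K α β₁ β₂ β₃ γ₁ γ₂ C₁ C₂ C₃ C₄ C₅ C₆ n) := by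
  have hlen (i : Fin π.n) : π.pt i.succ - π.pt i.castSucc < 1 / 2 ^ (k + 1) :=
    (π.sub_le_mesh i).trans_lt hπ
  have hone : (1 : ℝ) / 2 ^ (k + 1) ≤ 1 :=
    div_le_one_of_le₀ (one_le_pow₀ one_le_two) (by positivity)
  choose cls hle hge using fun i : Fin π.n =>
    exists_two_pow_scale (sub_pos.2 (π.castSucc_lt_succ i)) ((hlen i).le.trans hone)
  have hcls (i : Fin π.n) : k < cls i := by
    have hlt : (1 : ℝ) / 2 ^ cls i < 1 / 2 ^ k := by
      refine (hge i).trans_lt ?_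
      have := hlen i
      rw [pow_succ, ← div_div] at this
      linarith
    rwa [one_div_lt_one_div (by positivity) (by positivity),
      pow_lt_pow_iff_right₀ one_lt_two] at hlt
  refine ⟨Finset.univ.image cls, Finset.forall_mem_image.2 fun i _ => (hcls i).le,
    (LpBound.sum (one_le_two.trans hm) fun n _ => hS.lpBound_sum_class hm hκ hκ₁ hA hexp hM hΛ₀ hΛ
      hτ hK π n (I := Finset.univ.filter fun i => cls i = n)
      (fun i hi => (Finset.mem_filter.1 hi).2 ▸ hle i)
      (fun i hi => (Finset.mem_filter.1 hi).2 ▸ hge i)).neg.congr ?_⟩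
  filter_upwards [hS.zero] with ω hω
  rw [Finset.sum_fiberwise_of_maps_to fun i _ => Finset.mem_image_of_mem cls (Finset.mem_univ i),
    Finset.sum_sub_distrib, sum_fin_succ_sub_castSucc (fun i => 𝒜 (π.pt i) ω), π.left, π.right, hω,
    Pi.zero_apply, sub_zero, neg_sub, riemannSum]

theorem tendsto_riemannSum {C₁ C₂ C₃ C₄ C₅ C₆ : ℝ} (hm : 2 ≤ m) (hA : IsAdaptedGerm P 𝓕 T m A)
    (hS : IsSingularSewing P 𝓕 T m M α β₁ β₂ β₃ γ₁ γ₂ A C₁ C₂ C₃ C₄ C₅ C₆ 𝒜)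
    (hexp : SewingExponents α β₁ β₂ β₃ γ₁ γ₂) (hM : 0 ≤ M) {τ : ℝ} (hτ : τ ≤ T) :
    Tendsto (fun π : IntervalPartition 0 τ =>
        eLpNorm (fun ω => riemannSum A π ω - 𝒜 τ ω) (ENNReal.ofReal m) P)
      (comap IntervalPartition.mesh (𝓝 0)) (𝓝 0) := by
  obtain ⟨K, hK⟩ := pow_unbounded_of_one_lt τ (one_lt_two (α := ℝ))
  have hΛ : M ≤ (⌈M⌉₊ + 1 : ℕ) := (Nat.le_ceil M).trans (by exact_mod_cast Nat.le_succ _)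
  set κ := max (bdgConst.{u} m d) 1
  have hκ : IsBDGConstant.{u} m d κ := (isBDGConstant_bdgConst hm d).mono (le_max_left _ _)
  rw [ENNReal.tendsto_nhds_zero]
  intro ε hε
  rcases eq_or_ne ε ∞ with rfl | hε'
  · exact Eventually.of_forall fun _ => le_top
  obtain ⟨s, hs⟩ := summable_iff_vanishing_norm.1
    (summable_classBound κ (⌈M⌉₊ + 1) K hexp |C₁| |C₂| |C₃| |C₄| |C₅| |C₆|) ε.toReal
    (ENNReal.toReal_pos hε.ne' hε')
  obtain ⟨k, hk⟩ := s.exists_nat_subset_range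
  have hmesh : ∀ᶠ π : IntervalPartition 0 τ in comap IntervalPartition.mesh (𝓝 0),
      π.mesh < 1 / 2 ^ (k + 1) :=
    tendsto_comap.eventually (gt_mem_nhds (by positivity))
  filter_upwards [hmesh] with π hπ
  obtain ⟨S, hSk, hbound⟩ := exists_lpBound_riemannSum_sub (C₁ := Real.nnabs C₁)
    (C₂ := Real.nnabs C₂) (C₃ := Real.nnabs C₃) (C₄ := Real.nnabs C₄) (C₅ := Real.nnabs C₅)
    (C₆ := Real.nnabs C₆) hm hκ (le_max_right _ _) hA hS.abs hexp hM (Nat.succ_pos _) hΛ hτ hK.le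
    π hπ
  have hdisj : Disjoint S s := Finset.disjoint_left.2 fun n hn hns =>
    (hSk n hn).not_gt (Finset.mem_range.1 (hk hns))
  calc _ ≤ _ := hbound.le
    _ ≤ ENNReal.ofReal ε.toReal :=
      ENNReal.ofReal_le_ofReal ((le_abs_self _).trans (hs S hdisj).le)
    _ = ε := ENNReal.ofReal_toReal hε'

end IsSingularSewing

end Convergence

section Sewing

variable {Ω : Type u} {mΩ : MeasurableSpace Ω} {P : Measure Ω} {𝓕 : Filtration ℝ mΩ}
  {T m M α β₁ β₂ β₃ γ γ' s t g₁ g₂ g₃ H : ℝ}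

section General

variable {V : Type*} [NormedAddCommGroup V] {A : ℝ → ℝ → Ω → V} {I : ℝ → Ω → V}

lemma ae_eq_of_tendsto_eLpNorm {ι : Type*} {l : Filter ι} [l.NeBot] {p : ℝ≥0∞} (hp : 1 ≤ p)
    {F : ι → Ω → V} {f g : Ω → V} (hF : ∀ i, AEStronglyMeasurable (F i) P)
    (hf : AEStronglyMeasurable f P) (hg : AEStronglyMeasurable g P)
    (hFf : Tendsto (fun i => eLpNorm (fun ω => F i ω - f ω) p P) l (𝓝 0))
    (hFg : Tendsto (fun i => eLpNorm (fun ω => F i ω - g ω) p P) l (𝓝 0)) : f =ᵐ[P] g := by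
  have hlim := hFg.add hFf
  rw [add_zero] at hlim
  have hzero : eLpNorm (f - g) p P = 0 := nonpos_iff_eq_zero.1 <| ge_of_tendsto' hlim fun i => by
    rw [show f - g = (fun ω => F i ω - g ω) - fun ω => F i ω - f ω from
      funext fun ω => (sub_sub_sub_cancel_left _ _ _).symm]
    exact eLpNorm_sub_le ((hF i).sub hg) ((hF i).sub hf) hp
  rw [eLpNorm_eq_zero_iff (hf.sub hg) (zero_lt_one.trans_le hp).ne'] at hzero
  exact hzero.mono fun ω hω => sub_eq_zero.1 hω

lemma IsAdaptedGerm.memLp_riemannSum (hA : IsAdaptedGerm P 𝓕 T m A) {τ : ℝ} (hτ : τ ≤ T)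
    (π : IntervalPartition 0 τ) : MemLp (riemannSum A π) (ENNReal.ofReal m) P :=
  memLp_finsetSum _ fun i _ => hA.memLp _ _ (π.left_le _) (π.castSucc_lt_succ i).le
    ((π.le_right _).trans hτ)

namespace IsDyadicLimit

lemma ae_eq_zero (hm : 1 ≤ m) (hA : IsAdaptedGerm P 𝓕 T m A) (hT : 0 ≤ T) (hH : 0 ≤ H)
    (hI : IsDyadicLimit P 𝓕 T m H A I) : I 0 =ᵐ[P] 0 := by
  have hsum (n : ℕ) : dyadicSum A H n 0 0 =ᵐ[P] 0 := by
    filter_upwards [hA.diag 0 le_rfl hT] with ω hω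
    rw [dyadicSum, gridSum]
    refine Finset.sum_eq_zero fun i _ => ?_
    rw [gridTerm, clip_of_right_le le_rfl (by positivity), clip_of_right_le le_rfl (by positivity)]
    exact hω
  have hbound := LpBound.of_tendsto hm (Eventually.of_forall fun n =>
    LpBound.of_ae_eq_zero (m := m) (hsum n) le_rfl)
    (hI.memLp 0 le_rfl hT).1 (hI.tendsto 0 le_rfl hT)
  have hnorm := hbound.le
  rwa [ENNReal.ofReal_zero, nonpos_iff_eq_zero, eLpNorm_eq_zero_iff hbound.aestronglyMeasurable
    (ENNReal.ofReal_pos.2 (zero_lt_one.trans_le hm)).ne'] at hnorm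

lemma memLp_sub_sub (hA : IsAdaptedGerm P 𝓕 T m A) (hI : IsDyadicLimit P 𝓕 T m H A I)
    (hs : 0 ≤ s) (hst : s ≤ t) (ht : t ≤ T) :
    MemLp (fun ω => I t ω - I s ω - A s t ω) (ENNReal.ofReal m) P :=
  ((hI.memLp t (hs.trans hst) ht).sub (hI.memLp s hs (hst.trans ht))).sub (hA.memLp s t hs hst ht)

end IsDyadicLimit

variable [NormedSpace ℝ V] [CompleteSpace V]

namespace HasGermBound

lemma mono_left (hB : HasGermBound P 𝓕 T m M α β₁ β₂ β₃ γ γ' A 0 g₁ g₂ g₃) (hs : 0 ≤ s) :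
    HasGermBound P 𝓕 T m M α β₁ β₂ β₃ γ γ' A s g₁ g₂ g₃ :=
  { hB with
    cond := fun t₀ t₁ t₂ t₃ h₀ h₁ hst => hB.cond t₀ t₁ t₂ t₃ h₀ h₁ (hs.trans hst)
    weighted := fun t₁ t₂ t₃ h₁ hst => hB.weighted t₁ t₂ t₃ h₁ (hs.trans hst)
    plain := fun t₁ t₂ t₃ hst => hB.plain t₁ t₂ t₃ (hs.trans hst) }

/-- The weights are at most their values at `s > 0`, which can be moved into the constants. -/
lemma freeze_weights (hB : HasGermBound P 𝓕 T m M α β₁ β₂ β₃ γ γ' A 0 g₁ g₂ g₃) (hs : 0 < s)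
    (hγ : 0 ≤ γ) (hγ' : 0 ≤ γ') :
    HasGermBound P 𝓕 T m M α β₁ β₂ β₂ 0 0 A s (g₁ * s ^ (-γ)) (g₂ * s ^ (-γ'))
      (g₂ * s ^ (-γ')) := by
  have hg₁ := hB.g₁_nonneg
  have hg₂ := hB.g₂_nonneg
  have hweight {e r : ℝ} (he : 0 ≤ e) (hr : s ≤ r) : r ^ (-e) ≤ s ^ (-e) :=
    Real.rpow_le_rpow_of_nonpos hs hr (neg_nonpos.2 he)
  have hplain (t₁ t₂ t₃ : ℝ) (h₁ : s ≤ t₁) (h₁₂ : t₁ ≤ t₂) (h₂₃ : t₂ ≤ t₃) (hT : t₃ ≤ T) :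
      LpBound P m (germDelta A t₁ t₂ t₃) (g₂ * s ^ (-γ') * (t₃ - t₁) ^ β₂) := by
    refine (hB.weighted t₁ t₂ t₃ (hs.trans_le h₁) (hs.le.trans h₁) h₁₂ h₂₃ hT).mono ?_
    have : 0 ≤ t₃ - t₁ := by linarith
    grw [hweight hγ' h₁]
  refine ⟨hB.lag_nonneg, by positivity, by positivity, by positivity,
    fun t₀ t₁ t₂ t₃ h₀ h₀₁ h₁ h₁₂ h₂₃ hT hlag => ?_,
    fun t₁ t₂ t₃ _ h₁ h₁₂ h₂₃ hT => ?_, hplain⟩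
  · refine (hB.cond t₀ t₁ t₂ t₃ h₀ h₀₁ (hs.le.trans h₁) h₁₂ h₂₃ hT hlag).mono ?_
    have : 0 ≤ t₁ - t₀ := by linarith
    have : 0 ≤ t₃ - t₁ := by linarith
    rw [neg_zero, Real.rpow_zero, mul_one]
    grw [hweight hγ h₁]
  · rw [neg_zero, Real.rpow_zero, mul_one]
    exact hplain t₁ t₂ t₃ h₁ h₁₂ h₂₃ hT

end HasGermBound

lemma IsAdaptedGerm.hasGermBound (hA : IsAdaptedGerm P 𝓕 T m A)
    (hM : 0 ≤ M) (hg₁ : 0 ≤ g₁) (hg₂ : 0 ≤ g₂) (hg₃ : 0 ≤ g₃)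
    (hcond : ∀ t₀ t₁ t₂ t₃, 0 ≤ t₀ → t₀ < t₁ → t₁ < t₂ → t₂ < t₃ → t₃ ≤ T →
      M * (t₃ - t₁) ≤ t₁ - t₀ →
      eLpNorm (P[germDelta A t₁ t₂ t₃ | 𝓕 t₀]) (ENNReal.ofReal m) P ≤
        ENNReal.ofReal (g₁ * t₁ ^ (-γ) * (t₁ - t₀) ^ (-α) * (t₃ - t₁) ^ β₁))
    (hweighted : ∀ t₀ t₁ t₂, 0 < t₀ → t₀ < t₁ → t₁ < t₂ → t₂ ≤ T →
      eLpNorm (germDelta A t₀ t₁ t₂) (ENNReal.ofReal m) P ≤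
        ENNReal.ofReal (g₂ * t₀ ^ (-γ') * (t₂ - t₀) ^ β₂))
    (hplain : ∀ t₀ t₁ t₂, 0 ≤ t₀ → t₀ < t₁ → t₁ < t₂ → t₂ ≤ T →
      eLpNorm (germDelta A t₀ t₁ t₂) (ENNReal.ofReal m) P ≤
        ENNReal.ofReal (g₃ * (t₂ - t₀) ^ β₃)) :
    HasGermBound P 𝓕 T m M α β₁ β₂ β₃ γ γ' A 0 g₁ g₂ g₃ := by
  have hdegenerate (t₁ t₂ t₃ : ℝ) (h₁ : 0 ≤ t₁) (h₁₂ : t₁ ≤ t₂) (h₂₃ : t₂ ≤ t₃) (hT : t₃ ≤ T) :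
      (t₁ < t₂ ∧ t₂ < t₃) ∨ germDelta A t₁ t₂ t₃ =ᵐ[P] 0 := by
    rcases h₁₂.eq_or_lt with rfl | h₁₂
    · exact Or.inr (hA.germDelta_left h₁ (h₂₃.trans hT) t₃)
    rcases h₂₃.eq_or_lt with rfl | h₂₃
    · exact Or.inr (hA.germDelta_right t₁ (h₁.trans h₁₂.le) hT)
    exact Or.inl ⟨h₁₂, h₂₃⟩
  refine ⟨hM, hg₁, hg₂, hg₃, fun t₀ t₁ t₂ t₃ h₀ h₀₁ h₁ h₁₂ h₂₃ hT hlag => ?_,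
    fun t₁ t₂ t₃ hpos h₁ h₁₂ h₂₃ hT => ?_, fun t₁ t₂ t₃ h₁ h₁₂ h₂₃ hT => ?_⟩ <;>
    have : 0 ≤ t₃ - t₁ := by linarith
  · have : 0 ≤ t₁ - t₀ := by linarith
    rcases hdegenerate t₁ t₂ t₃ h₁ h₁₂ h₂₃ hT with ⟨h₁₂, h₂₃⟩ | hzero
    · exact ⟨integrable_condExp.1, by positivity, hcond t₀ t₁ t₂ t₃ h₀ h₀₁ h₁₂ h₂₃ hT hlag⟩
    · refine LpBound.of_ae_eq_zero ((condExp_congr_ae hzero).trans ?_) (by positivity)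
      rw [condExp_zero]
  · rcases hdegenerate t₁ t₂ t₃ h₁ h₁₂ h₂₃ hT with ⟨h₁₂, h₂₃⟩ | hzero
    · exact ⟨(hA.memLp_germDelta h₁ h₁₂.le h₂₃.le hT).1, by positivity,
        hweighted t₁ t₂ t₃ hpos h₁₂ h₂₃ hT⟩
    · exact LpBound.of_ae_eq_zero hzero (by positivity)
  · rcases hdegenerate t₁ t₂ t₃ h₁ h₁₂ h₂₃ hT with ⟨h₁₂, h₂₃⟩ | hzero
    · exact ⟨(hA.memLp_germDelta h₁ h₁₂.le h₂₃.le hT).1, by positivity,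
        hplain t₁ t₂ t₃ h₁ h₁₂ h₂₃ hT⟩
    · exact LpBound.of_ae_eq_zero hzero (by positivity)

lemma tendsto_eLpNorm_condExp {p : ℝ≥0∞} (hp : 1 ≤ p) {𝓗 : MeasurableSpace Ω}
    {F : ℕ → Ω → V} {f : Ω → V} (hF : ∀ n, Integrable (F n) P) (hf : Integrable f P)
    (hlim : Tendsto (fun n => eLpNorm (fun ω => F n ω - f ω) p P) atTop (𝓝 0)) :
    Tendsto (fun n => eLpNorm (fun ω => (P[F n | 𝓗]) ω - (P[f | 𝓗]) ω) p P) atTop (𝓝 0) :=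
  tendsto_of_tendsto_of_tendsto_of_le_of_le tendsto_const_nhds hlim (fun _ => bot_le) fun n =>
    (eLpNorm_congr_ae (condExp_fun_sub (hF n) hf).symm).trans_le (eLpNorm_condExp_le_eLpNorm _ hp)

lemma IsDyadicLimit.lpBound_condExp [IsFiniteMeasure P] (hm : 1 ≤ m) (hA : IsAdaptedGerm P 𝓕 T m A)
    (hB : HasGermBound P 𝓕 T m M α β₁ β₂ β₃ γ γ' A 0 g₁ g₂ g₃)
    (hexp : SewingExponents α β₁ β₂ β₃ γ γ') (hTH : T < H) (hI : IsDyadicLimit P 𝓕 T m H A I)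
    {t₀ : ℝ} (ht₀ : 0 ≤ t₀) (hts : t₀ < s) (hst : s < t) (ht : t ≤ T)
    (hlag : M * (t - s) ≤ s - t₀) :
    LpBound P m (P[fun ω => I t ω - I s ω - A s t ω | 𝓕 t₀])
      (pastConst β₁ * g₁ * s ^ (-γ) * (s - t₀) ^ (-α) * (t - s) ^ β₁) := by
  have hp : 1 ≤ ENNReal.ofReal m := ENNReal.one_le_ofReal.2 hm
  have hs : 0 ≤ s := ht₀.trans hts.le
  have hH : 0 < H := by linarith
  exact LpBound.of_tendsto hm
    ((hB.mono_left hs).eventually_lpBound_condExp_dyadicSum hm hA hexp.α_nonneg hexp.γ_nonneg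
      hexp.one_lt_β₁ hTH.le ht₀ hts hst ht hlag) integrable_condExp.1
    (tendsto_eLpNorm_condExp hp
      (fun n => ((hA.memLp_dyadicSum hH.le n hs hst.le ht).sub
        (hA.memLp s t hs hst.le ht)).integrable hp)
      ((hI.memLp_sub_sub hA hs hst.le ht).integrable hp)
      (hI.tendsto_dyadicSum_sub hm hA hB hexp.β₃_pos hTH hs hst.le ht))

end General

variable [IsProbabilityMeasure P] {d : ℕ} {A : ℝ → ℝ → Ω → EuclideanSpace ℝ (Fin d)}
  {I : ℝ → Ω → EuclideanSpace ℝ (Fin d)}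

lemma HasGermBound.lpBound_of_tendsto_dyadicSum (hm : 2 ≤ m) (hA : IsAdaptedGerm P 𝓕 T m A)
    (hB : HasGermBound P 𝓕 T m M α β₁ β₂ β₃ γ γ' A s g₁ g₂ g₃)
    (hexp : SewingExponents α β₁ β₂ β₃ γ γ') {Λ : ℕ} (hΛ₀ : 0 < Λ) (hΛ : M ≤ Λ) (hTH : T ≤ H)
    (hs : 0 ≤ s) (hst : s < t) (ht : t ≤ T) {X : Ω → EuclideanSpace ℝ (Fin d)}
    (hX : AEStronglyMeasurable X P)
    (hlim : Tendsto (fun n => eLpNorm (fun ω => dyadicSum A H n s t ω - A s t ω - X ω)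
      (ENNReal.ofReal m) P) atTop (𝓝 0)) :
    LpBound P m X (sewingBound (bdgConst.{u} m d) Λ α β₁ β₂ β₃ γ γ' g₁ g₂ g₃ (t - s)) := by
  rcases eq_or_ne d 0 with rfl | hd
  · refine LpBound.of_ae_eq_zero (ae_of_all _ fun ω => Subsingleton.elim _ _) ?_
    have := hB.g₁_nonneg
    have := hB.g₂_nonneg
    have := hB.g₃_nonneg
    have := condConst_nonneg Λ α β₁ γ
    have := martConst_nonneg Λ β₂ γ'
    have := plainConst_nonneg Λ β₃
    have := bdgConst_nonneg.{u} m 0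
    have : 0 ≤ t - s := sub_nonneg.2 hst.le
    rw [sewingBound]
    positivity
  · exact LpBound.of_tendsto (one_le_two.trans hm)
      (hB.eventually_lpBound_dyadicSum hm (isBDGConstant_bdgConst hm d) (one_le_bdgConst hm hd P)
        hA hexp hΛ₀ hΛ hTH hs hst ht) hX hlim

lemma IsDyadicLimit.isSingularSewing (hm : 2 ≤ m) (hA : IsAdaptedGerm P 𝓕 T m A)
    (hB : HasGermBound P 𝓕 T m M α β₁ β₂ β₃ γ γ' A 0 g₁ g₂ g₃)
    (hexp : SewingExponents α β₁ β₂ β₃ γ γ') (hT : 0 ≤ T) (hTH : T < H)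
    (hI : IsDyadicLimit P 𝓕 T m H A I) {Λ : ℕ} (hΛ₀ : 0 < Λ) (hΛ : M ≤ Λ) :
    IsSingularSewing P 𝓕 T m M α β₁ β₂ β₃ γ γ' A (pastConst β₁ * g₁)
      (condConst Λ α β₁ 0 * bdgConst.{u} m d * g₁)
      ((martConst Λ β₂ 0 + plainConst Λ β₂) * bdgConst.{u} m d * g₂)
      (condConst Λ α β₁ γ * bdgConst.{u} m d * g₁)
      (martConst Λ β₂ γ' * bdgConst.{u} m d * g₂)
      (plainConst Λ β₃ * bdgConst.{u} m d * g₃) I := by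
  have hm₁ : 1 ≤ m := one_le_two.trans hm
  have hH : 0 < H := hT.trans_lt hTH
  have hlim {s t : ℝ} (hs : 0 ≤ s) (hst : s ≤ t) (ht : t ≤ T) :=
    hI.tendsto_dyadicSum_sub hm₁ hA hB hexp.β₃_pos hTH hs hst ht
  refine ⟨hI.ae_eq_zero hm₁ hA hT hH.le, hI.adapted, hI.memLp,
    fun t₀ s t h₀ hts hst ht hlag =>
      (hI.lpBound_condExp hm₁ hA hB hexp hTH h₀ hts hst ht hlag).le,
    fun s t hs hst ht => ?_, fun s t hs hst ht => ?_⟩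
  · have hfrozen : SewingExponents α β₁ β₂ β₂ 0 0 :=
      ⟨hexp.α_nonneg, hexp.one_lt_β₁, hexp.half_lt_β₂, hexp.half_lt_β₁_sub_α,
        one_half_pos.trans hexp.half_lt_β₂, le_rfl, one_half_pos, le_rfl, one_half_pos⟩
    refine (((hB.freeze_weights hs hexp.γ_nonneg hexp.γ'_nonneg).lpBound_of_tendsto_dyadicSum hm hA
      hfrozen hΛ₀ hΛ hTH.le hs.le hst ht (hI.memLp_sub_sub hA hs.le hst.le ht).1
      (hlim hs.le hst.le ht)).mono (le_of_eq ?_)).le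
    rw [sewingBound, sub_zero, sub_zero]
    ring
  · refine (((hB.mono_left hs).lpBound_of_tendsto_dyadicSum hm hA hexp hΛ₀ hΛ hTH.le hs hst ht
      (hI.memLp_sub_sub hA hs hst.le ht).1 (hlim hs hst.le ht)).mono (le_of_eq ?_)).le
    rw [sewingBound]
    ring

theorem HasGermBound.exists_isSingularSewing (hm : 2 ≤ m) (hA : IsAdaptedGerm P 𝓕 T m A)
    (hB : HasGermBound P 𝓕 T m M α β₁ β₂ β₃ γ γ' A 0 g₁ g₂ g₃)
    (hexp : SewingExponents α β₁ β₂ β₃ γ γ') (hT : 0 ≤ T) {Λ : ℕ} (hΛ₀ : 0 < Λ) (hΛ : M ≤ Λ) :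
    ∃ 𝒜, IsSingularSewing P 𝓕 T m M α β₁ β₂ β₃ γ γ' A (pastConst β₁ * g₁)
      (condConst Λ α β₁ 0 * bdgConst.{u} m d * g₁)
      ((martConst Λ β₂ 0 + plainConst Λ β₂) * bdgConst.{u} m d * g₂)
      (condConst Λ α β₁ γ * bdgConst.{u} m d * g₁)
      (martConst Λ β₂ γ' * bdgConst.{u} m d * g₂)
      (plainConst Λ β₃ * bdgConst.{u} m d * g₃) 𝒜 := by
  obtain ⟨I, hI⟩ := hB.exists_isDyadicLimit hm
    ((isBDGConstant_bdgConst.{u} hm d).mono (le_max_left _ 1)) (le_max_right _ _) hA hexp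
    (by linarith : 0 < T + 1) (by linarith)
  exact ⟨I, hI.isSingularSewing hm hA hB hexp hT (lt_add_one T) hΛ₀ hΛ⟩

theorem IsSingularSewing.ae_eq {γ₁ γ₂ C₁ C₂ C₃ C₄ C₅ C₆ C₁' C₂' C₃' C₄' C₅' C₆' : ℝ}
    {𝒜 𝒜' : ℝ → Ω → EuclideanSpace ℝ (Fin d)} (hm : 2 ≤ m) (hA : IsAdaptedGerm P 𝓕 T m A)
    (hexp : SewingExponents α β₁ β₂ β₃ γ₁ γ₂) (hM : 0 ≤ M)
    (hS : IsSingularSewing P 𝓕 T m M α β₁ β₂ β₃ γ₁ γ₂ A C₁ C₂ C₃ C₄ C₅ C₆ 𝒜)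
    (hS' : IsSingularSewing P 𝓕 T m M α β₁ β₂ β₃ γ₁ γ₂ A C₁' C₂' C₃' C₄' C₅' C₆' 𝒜')
    (h₀ : 0 ≤ t) (ht : t ≤ T) : 𝒜 t =ᵐ[P] 𝒜' t :=
  have := IntervalPartition.neBot_comap_mesh h₀
  ae_eq_of_tendsto_eLpNorm (one_le_ofReal_of_two_le hm) (fun π => (hA.memLp_riemannSum ht π).1)
    (hS.memLp t h₀ ht).1 (hS'.memLp t h₀ ht).1 (hS.tendsto_riemannSum hm hA hexp hM ht)
    (hS'.tendsto_riemannSum hm hA hexp hM ht)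

end Sewing

theorem corollary2p6 :
    ∃ (c₁ : ℝ → ℝ≥0) (c₂ c₃ : ℝ → ℝ → ℝ → ℝ → ℝ≥0) (c₄ : ℝ → ℝ → ℝ → ℝ → ℝ≥0)
      (c₅ : ℝ → ℝ → ℝ → ℝ≥0) (c₆ : ℝ → ℝ → ℝ≥0),
    ∀ (Ω : Type u) (mΩ : MeasurableSpace Ω) (P : Measure Ω) (_ : IsProbabilityMeasure P)
      (T : ℝ) (_ : 0 ≤ T) (𝓕 : Filtration ℝ mΩ) (d : ℕ)
      (A : ℝ → ℝ → Ω → EuclideanSpace ℝ (Fin d))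
      (m Γ₁ Γ₂ Γ₃ M α β₁ β₂ β₃ γ₁ γ₂ : ℝ),
      2 ≤ m → 0 ≤ Γ₁ → 0 ≤ Γ₂ → 0 ≤ Γ₃ → 0 ≤ M → 0 ≤ α → 0 ≤ γ₁ → 0 ≤ γ₂ →
      1 < β₁ → 1 / 2 < β₂ → 1 / 2 < β₁ - α → γ₁ < 1 / 2 → γ₂ < 1 / 2 → 0 < β₃ →
      (∀ s, 0 ≤ s → s ≤ T → A s s =ᵐ[P] 0) →
      (∀ s t, 0 ≤ s → s ≤ t → t ≤ T → StronglyMeasurable[𝓕 t] (A s t)) →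
      (∀ s t, 0 ≤ s → s ≤ t → t ≤ T → MemLp (A s t) (ENNReal.ofReal m) P) →
      (∀ t₀ t₁ t₂ t₃, 0 ≤ t₀ → t₀ < t₁ → t₁ < t₂ → t₂ < t₃ → t₃ ≤ T →
        M * (t₃ - t₁) ≤ t₁ - t₀ →
        eLpNorm (P[germDelta A t₁ t₂ t₃ | 𝓕 t₀]) (ENNReal.ofReal m) P ≤
          ENNReal.ofReal (Γ₁ * t₁ ^ (-γ₁) * (t₁ - t₀) ^ (-α) * (t₃ - t₁) ^ β₁)) →
      (∀ t₀ t₁ t₂, 0 < t₀ → t₀ < t₁ → t₁ < t₂ → t₂ ≤ T →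
        eLpNorm (germDelta A t₀ t₁ t₂) (ENNReal.ofReal m) P ≤
          ENNReal.ofReal (Γ₂ * t₀ ^ (-γ₂) * (t₂ - t₀) ^ β₂)) →
      (∀ t₀ t₁ t₂, 0 ≤ t₀ → t₀ < t₁ → t₁ < t₂ → t₂ ≤ T →
        eLpNorm (germDelta A t₀ t₁ t₂) (ENNReal.ofReal m) P ≤
          ENNReal.ofReal (Γ₃ * (t₂ - t₀) ^ β₃)) →
      ∃ 𝒜 : ℝ → Ω → EuclideanSpace ℝ (Fin d),
        IsSingularSewing P 𝓕 T m M α β₁ β₂ β₃ γ₁ γ₂ A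
          (c₁ β₁ * Γ₁)
          (c₂ α β₁ β₂ M * bdgConst.{u} m d * Γ₁)
          (c₃ α β₁ β₂ M * bdgConst.{u} m d * Γ₂)
          (c₄ α β₁ γ₁ M * bdgConst.{u} m d * Γ₁)
          (c₅ β₂ γ₂ M * bdgConst.{u} m d * Γ₂)
          (c₆ β₃ M * bdgConst.{u} m d * Γ₃) 𝒜 ∧
        (∀ (𝒜' : ℝ → Ω → EuclideanSpace ℝ (Fin d)) (C₁ C₂ C₃ C₄ C₅ C₆ : ℝ),
          IsSingularSewing P 𝓕 T m M α β₁ β₂ β₃ γ₁ γ₂ A C₁ C₂ C₃ C₄ C₅ C₆ 𝒜' →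
          ∀ t, 0 ≤ t → t ≤ T → 𝒜' t =ᵐ[P] 𝒜 t) ∧
        (∀ τ, 0 ≤ τ → τ ≤ T →
          Tendsto
            (fun π : IntervalPartition 0 τ =>
              eLpNorm (fun ω => riemannSum A π ω - 𝒜 τ ω) (ENNReal.ofReal m) P)
            (comap IntervalPartition.mesh (𝓝 0)) (𝓝 0)) := by
  refine ⟨fun β₁ => (pastConst β₁).toNNReal,
    fun α β₁ _ M => (condConst (⌈M⌉₊ + 1) α β₁ 0).toNNReal,
    fun _ _ β₂ M => (martConst (⌈M⌉₊ + 1) β₂ 0 + plainConst (⌈M⌉₊ + 1) β₂).toNNReal,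
    fun α β₁ γ₁ M => (condConst (⌈M⌉₊ + 1) α β₁ γ₁).toNNReal,
    fun β₂ γ₂ M => (martConst (⌈M⌉₊ + 1) β₂ γ₂).toNNReal,
    fun β₃ M => (plainConst (⌈M⌉₊ + 1) β₃).toNNReal, ?_⟩
  intro Ω mΩ P _ T hT 𝓕 d A m Γ₁ Γ₂ Γ₃ M α β₁ β₂ β₃ γ₁ γ₂ hm hΓ₁ hΓ₂ hΓ₃ hM hα hγ₁₀ hγ₂₀ hβ₁ hβ₂
    hαβ hγ₁ hγ₂ hβ₃ hdiag hadapted hmem hcond hweighted hplain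
  have hA : IsAdaptedGerm P 𝓕 T m A := ⟨hdiag, hadapted, hmem⟩
  have hexp : SewingExponents α β₁ β₂ β₃ γ₁ γ₂ := ⟨hα, hβ₁, hβ₂, hαβ, hβ₃, hγ₁₀, hγ₁, hγ₂₀, hγ₂⟩
  have hB := hA.hasGermBound hM hΓ₁ hΓ₂ hΓ₃ hcond hweighted hplain
  obtain ⟨𝒜, h𝒜⟩ := hB.exists_isSingularSewing hm hA hexp hT (Nat.succ_pos ⌈M⌉₊)
    ((Nat.le_ceil M).trans (by exact_mod_cast Nat.le_succ _))
  refine ⟨𝒜, ?_, fun _ _ _ _ _ _ _ h𝒜' t h₀ ht => h𝒜'.ae_eq hm hA hexp hM h𝒜 h₀ ht,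
    fun τ _ hτ => h𝒜.tendsto_riemannSum hm hA hexp hM hτ⟩
  simpa only [Real.coe_toNNReal, pastConst_nonneg, condConst_nonneg, martConst_nonneg,
    plainConst_nonneg, add_nonneg] using h𝒜
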